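/- Let $d\ge 1$, let $\mathcal P$ be a probability distribution, and let $F(x;\xi)$ be real-valued for $x\in\mathbb R^d$, with $F(x;\cdot)$ measurable and $\mathcal P$-integrable for every $x$; put $f(x)=\mathbb E_{\xi\sim\mathcal P}[F(x;\xi)]$. Let $p\in(1,2]$, $L>0$, and assume: (i) $|F(x;\xi)-F(y;\xi)|\le L(\xi)\|x-y\|$ for all $x,y,\xi$, where $\mathbb E[L(\xi)^p]\le L^p$; (ii) $f$ is well-behaved: $f(y)-f(x)=\int_0^1\langle\nabla f(x+t(y-x)),y-x\rangle\,dt$ for all $x,y$; (iii) $f^*:=\inf_x f(x)>-\infty$. For a Lipschitz function $f$ let $Df(x;v)=\limsup_{y\to x,\,t\downarrow 0}\frac{f(y+tv)-f(y)}{t}$, $\partial f(x)=\{g:\langle g,v\rangle\le Df(x;v)\ \forall v\}$, $\partial_\delta f(x)=\mathrm{conv}\big(\bigcup_{\|y-x\|\le\delta}\partial f(y)\big)$ and $\|\nabla f(x)\|_\delta=\min\{\|g\|:g\in\partial_\delta f(x)\}$. The algorithm ZOCOON with initial point $x_0$, $K$ rounds of length $T$, clipping level $\tau$, radius $D$ and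 smoothing parameter $\delta'$ sets $\Delta_1=0$ and, for $n=1,\dots,KT$, puts $x_n=x_{n-1}+\Delta_n$ and $w_n=x_{n-1}+s_n\Delta_n$, evaluates $g_n=\frac{d}{2\delta'}\big(F(w_n+\delta'u_n;\xi_n)-F(w_n-\delta'u_n;\xi_n)\big)u_n$ (two oracle calls), and puts $\Delta_{n+1}=\Pi_{\mathbb B(0,D)}\big[\Delta_n-\tfrac{D}{\tau}\,\mathrm{clip}(g_n,\tau)\big]$, where $\Pi_{\mathbb B(0,D)}$ is the projection onto the closed ball of radius $D$ centred at $0$, $\mathrm{clip}(g,\tau)=\min\{1,\tau/\|g\|\}g$ for $g\ne 0$, and $\mathrm{clip}(0,\tau)=0$. Here $s_n$ is uniform on $[0,1]$, $u_n$ is uniform on the unit sphere, $\xi_n\sim\mathcal P$, and all samples are independent. The output $w_{\rm out}$ is drawn uniformly, independently of everything else, from $\bar w^1,\dots,\bar w^K$, where $\bar w^k=\frac1T\sum_{t=1}^T w_{(k-1)T+t}$. Let $\delta\in(0,1)$, $\Delta\ge f(x_0)-f^*$, let $M\ge 2$ be an integer, and run ZOCOON with $$T=\min\left(\left\lceil\left(\frac{\delta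 ML(d^{p/2}+1)^{1/p}}{2\delta L+2\Delta}\right)^{\frac{p}{2p-1}}\right\rceil,\left\lfloor\frac M2\right\rfloor\right),\quad K=\left\lfloor\frac MT\right\rfloor,\quad D=\frac{\delta}{2T},\quad \tau=T^{1/p}L(d^{p/2}+1)^{1/p},\quad \delta'=\frac\delta2 .$$ Then the run makes at most $2M$ oracle calls, and $$\mathbb E\big[\|\nabla f(w_{\rm out})\|_\delta\big]\le\max\left(\frac{18(\Delta+\delta L)^{\frac{p-1}{2p-1}}(d^{p/2}L^p+L^p)^{\frac1{2p-1}}}{(\delta M)^{\frac{p-1}{2p-1}}},\ \frac{16L(d^{p/2}+1)^{1/p}}{M^{\frac{p-1}{p}}}\right)+\frac{2\Delta+2\delta L}{\delta M}.$$ Moreover there is a constant $C>0$ depending only on $p$ such that, for every $\epsilon\in(0,1)$, with $$Q=\frac{(\Delta+\delta L)\,d^{\frac{p}{2(p-1)}}L^{\frac p{p-1}}}{\delta\,\epsilon^{\frac{2p-1}{p-1}}},$$ every choice $M\ge\max(2,CQ)$ gives $\mathbb E[\|\nabla f(w_{\rm out})\|_\delta]\le\epsilon$; and for $M=\max(2,\lceil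 CQ\rceil)$ the number of oracle calls is at most $4\big(1+C(\Delta+L)L^{\frac p{p-1}}\big)\,d^{\frac{p}{2(p-1)}}\delta^{-1}\epsilon^{-\frac{2p-1}{p-1}}$. That is, for fixed $p,L,\Delta$, a $(\delta,\epsilon)$-Goldstein stationary point in expectation is reached with $O\big(d^{\frac{p}{2(p-1)}}\delta^{-1}\epsilon^{-\frac{2p-1}{p-1}}\big)$ zeroth-order oracle calls. -/

import Mathlib

open MeasureTheory ProbabilityTheory Filter Topology

noncomputable section

namespace ZOCOON

/-- `ℝ^d` with the Euclidean norm. -/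
abbrev E (d : ℕ) : Type := EuclideanSpace ℝ (Fin d)

/-! ### Clarke and Goldstein subdifferentials -/

/-- Clarke's generalized directional derivative
`Df(x; v) = limsup_{y → x, t ↓ 0} (f (y + t v) - f y) / t`. -/
def clarkeDeriv {d : ℕ} (f : E d → ℝ) (x v : E d) : ℝ :=
  limsup (fun q : E d × ℝ => (f (q.1 + q.2 • v) - f q.1) / q.2) (𝓝 x ×ˢ 𝓝[>] (0 : ℝ))

/-- The Clarke subdifferential `∂f(x)`. -/
def clarkeSubdiff {d : ℕ} (f : E d → ℝ) (x : E d) : Set (E d) :=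
  {g | ∀ v : E d, inner ℝ g v ≤ clarkeDeriv f x v}

/-- The Goldstein `δ`-subdifferential `∂_δ f(x)`: the convex hull of the union of the Clarke
subdifferentials over the closed ball of radius `δ` around `x`. -/
def goldsteinSubdiff {d : ℕ} (f : E d → ℝ) (δ : ℝ) (x : E d) : Set (E d) :=
  convexHull ℝ (⋃ y ∈ Metric.closedBall x δ, clarkeSubdiff f y)

/-- `‖∇f(x)‖_δ`, the least norm of an element of `∂_δ f(x)`. -/
def goldsteinNorm {d : ℕ} (f : E d → ℝ) (δ : ℝ) (x : E d) : ℝ :=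
  sInf ((fun g : E d => ‖g‖) '' goldsteinSubdiff f δ x)

/-! ### Assumptions on the stochastic problem `min_x f(x) = E_{ξ ∼ P} [F(x; ξ)]` -/

/-- The objective `f(x) = E_{ξ ∼ P} [F(x; ξ)]`. -/
def objective {d : ℕ} {Ξ : Type*} [MeasurableSpace Ξ] (P : Measure Ξ) (F : E d → Ξ → ℝ)
    (x : E d) : ℝ :=
  ∫ ξ, F x ξ ∂P

/-- `F(·; ξ)` is `ℓ(ξ)`-Lipschitz with `E[ℓ(ξ)^p] ≤ L^p`. -/
def LipschitzWithMoment {d : ℕ} {Ξ : Type*} [MeasurableSpace Ξ] (P : Measure Ξ)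
    (F : E d → Ξ → ℝ) (p L : ℝ) : Prop :=
  ∃ ℓ : Ξ → ℝ, Measurable ℓ ∧ (∀ ξ, 0 ≤ ℓ ξ) ∧
    (∀ ξ x y, |F x ξ - F y ξ| ≤ ℓ ξ * ‖x - y‖) ∧
    Integrable (fun ξ => ℓ ξ ^ p) P ∧ ∫ ξ, ℓ ξ ^ p ∂P ≤ L ^ p

/-- `f` is well-behaved: it is the integral of its gradient along every segment. -/
def WellBehaved {d : ℕ} (f : E d → ℝ) : Prop :=
  ∀ x y : E d, f y - f x = ∫ t in (0 : ℝ)..1, inner ℝ (gradient f (x + t • (y - x))) (y - x)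

/-! ### The algorithm -/

/-- `clip(g, τ) = min{1, τ / ‖g‖} g` for `g ≠ 0`, and `clip(0, τ) = 0`. -/
def clip {d : ℕ} (g : E d) (τ : ℝ) : E d :=
  open Classical in if g = 0 then 0 else min 1 (τ / ‖g‖) • g

/-- The Euclidean projection onto the closed ball of radius `D` around `0`
(see `projBall_mem` and `norm_sub_projBall_le`). -/
def projBall {d : ℕ} (D : ℝ) (v : E d) : E d :=
  if ‖v‖ ≤ D then v else (D / ‖v‖) • v

theorem projBall_mem {d : ℕ} {D : ℝ} (hD : 0 ≤ D) (v : E d) :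
    projBall D v ∈ Metric.closedBall (0 : E d) D := by
  rw [mem_closedBall_zero_iff]
  unfold projBall
  split_ifs with h
  · exact h
  · have hv : 0 < ‖v‖ := lt_of_le_of_lt hD (not_le.mp h)
    rw [norm_smul, Real.norm_of_nonneg (by positivity), div_mul_cancel₀ _ hv.ne']

theorem norm_sub_projBall_le {d : ℕ} {D : ℝ} (hD : 0 ≤ D) (v y : E d)
    (hy : y ∈ Metric.closedBall (0 : E d) D) : ‖v - projBall D v‖ ≤ ‖v - y‖ := by
  rw [mem_closedBall_zero_iff] at hy
  unfold projBall
  split_ifs with h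
  · simp
  · have hlt := not_le.mp h
    have hv : 0 < ‖v‖ := lt_of_le_of_lt hD hlt
    have h1 : v - (D / ‖v‖) • v = (1 - D / ‖v‖) • v := by rw [sub_smul, one_smul]
    have h2 : 0 ≤ 1 - D / ‖v‖ := by
      rw [sub_nonneg, div_le_one hv]; exact hlt.le
    rw [h1, norm_smul, Real.norm_of_nonneg h2, sub_mul, div_mul_cancel₀ _ hv.ne', one_mul]
    have := norm_sub_norm_le v y
    linarith

/-- One call of the stochastic zeroth-order oracle: the value `F(x; ξ)`, at cost `1`. -/
def query {d : ℕ} {Ξ : Type*} (F : E d → Ξ → ℝ) (x : E d) (ξ : Ξ) : ℝ × ℕ :=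
  (F x ξ, 1)

/-- The two-point estimator `d / (2 δ') (F(x + δ' u; ξ) - F(x - δ' u; ξ)) u`, together with
the number of oracle calls it made. -/
def gradientEstimator {d : ℕ} {Ξ : Type*} (F : E d → Ξ → ℝ) (δ' : ℝ) (x : E d) (ξ : Ξ)
    (u : E d) : E d × ℕ :=
  let a := query F (x + δ' • u) ξ
  let b := query F (x - δ' • u) ξ
  (((d : ℝ) / (2 * δ') * (a.1 - b.1)) • u, a.2 + b.2)

/-- The state after `n` iterations: `x = x_n`, `Δ = Δ_{n+1}`, `w = w_n` (for `n ≥ 1`), and the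
number of oracle calls made so far. -/
structure State (d : ℕ) where
  x : E d
  Δ : E d
  w : E d
  calls : ℕ

/-- One iteration, with the samples `ξ`, `s`, `u` and the step size `η = D / τ`. -/
def step {d : ℕ} {Ξ : Type*} (F : E d → Ξ → ℝ) (δ' τ D : ℝ) (ξ : Ξ) (s : ℝ) (u : E d)
    (st : State d) : State d :=
  let w := st.x + s • st.Δ
  let g := gradientEstimator F δ' w ξ u
  { x := st.x + st.Δ
    Δ := projBall D (st.Δ - (D / τ) • clip g.1 τ)
    w := w
    calls := st.calls + g.2 }

/-- The state after `n` iterations. Iteration `n + 1` uses the samples of index `n`. -/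
def iter {d : ℕ} {Ξ : Type*} (F : E d → Ξ → ℝ) (x₀ : E d) (δ' τ D : ℝ)
    (ξ : ℕ → Ξ) (s : ℕ → ℝ) (u : ℕ → Metric.sphere (0 : E d) 1) : ℕ → State d
  | 0 => { x := x₀, Δ := 0, w := x₀, calls := 0 }
  | n + 1 => step F δ' τ D (ξ n) (s n) (u n : E d) (iter F x₀ δ' τ D ξ s u n)

/-- The average `w̄^k = (1 / T) ∑_{t = 1}^T w_{(k - 1) T + t}` of the `k`-th round, `k ≥ 1`. -/
def roundAverage {d : ℕ} {Ξ : Type*} (F : E d → Ξ → ℝ) (x₀ : E d) (T : ℕ) (δ' τ D : ℝ)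
    (ξ : ℕ → Ξ) (s : ℕ → ℝ) (u : ℕ → Metric.sphere (0 : E d) 1) (k : ℕ) : E d :=
  (T : ℝ)⁻¹ • ∑ t ∈ Finset.Icc 1 T, (iter F x₀ δ' τ D ξ s u ((k - 1) * T + t)).w

/-- The number of oracle calls of a whole run with `K` rounds of length `T`. -/
def oracleCalls {d : ℕ} {Ξ : Type*} (F : E d → Ξ → ℝ) (x₀ : E d) (K T : ℕ) (δ' τ D : ℝ)
    (ξ : ℕ → Ξ) (s : ℕ → ℝ) (u : ℕ → Metric.sphere (0 : E d) 1) : ℕ :=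
  (iter F x₀ δ' τ D ξ s u (K * T)).calls

/-! ### The randomness -/

/-- The uniform distribution on the unit sphere of `ℝ^d`. -/
def uniformSphere (d : ℕ) : Measure (Metric.sphere (0 : E d) 1) :=
  ((volume : Measure (E d)).toSphere Set.univ)⁻¹ • (volume : Measure (E d)).toSphere

/-- The samples of a run: `ξ n ∼ P`, `s n` uniform on `[0, 1]`, `u n` uniform on the unit sphere,
and the index `κ` of the returned average uniform on `{1, …, K}`; all of them independent. -/
structure IsSampling {d : ℕ} {Ξ Ω : Type*} [MeasurableSpace Ξ] [MeasurableSpace Ω]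
    (P : Measure Ξ) (K : ℕ) (μ : Measure Ω) (ξ : ℕ → Ω → Ξ) (s : ℕ → Ω → ℝ)
    (u : ℕ → Ω → Metric.sphere (0 : E d) 1) (κ : Ω → ℕ) : Prop where
  measurable_ξ : ∀ n, Measurable (ξ n)
  measurable_s : ∀ n, Measurable (s n)
  measurable_u : ∀ n, Measurable (u n)
  measurable_κ : Measurable κ
  /-- For each `n` the three samples are independent with the stated distributions. -/
  law : ∀ n, μ.map (fun ω => (ξ n ω, s n ω, u n ω)) =
    P.prod (((volume : Measure ℝ).restrict (Set.Icc 0 1)).prod (uniformSphere d))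
  /-- The samples of different iterations are independent. -/
  indep : iIndepFun (fun n ω => (ξ n ω, s n ω, u n ω)) μ
  law_κ : μ.map κ = uniformOn (Set.Icc 1 K)
  indep_κ : IndepFun (fun ω n => (ξ n ω, s n ω, u n ω)) κ μ

/-! ### The parameters -/

/-- `T = min(⌈(δ M L (d^{p/2} + 1)^{1/p} / (2 δ L + 2 Δ))^{p/(2p-1)}⌉, ⌊M / 2⌋)`. -/
def roundLength (p L Δ δ : ℝ) (d M : ℕ) : ℕ :=
  min ⌈(δ * M * L * ((d : ℝ) ^ (p / 2) + 1) ^ (1 / p) / (2 * δ * L + 2 * Δ)) ^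
    (p / (2 * p - 1))⌉₊ (M / 2)

/-- `τ = T^{1/p} L (d^{p/2} + 1)^{1/p}`. -/
def clipLevel (p L : ℝ) (d T : ℕ) : ℝ :=
  (T : ℝ) ^ (1 / p) * L * ((d : ℝ) ^ (p / 2) + 1) ^ (1 / p)

/-- `(Δ + δ L) d^{p/(2(p-1))} L^{p/(p-1)} / (δ ε^{(2p-1)/(p-1)})`. -/
def sampleSize (p L Δ δ ε : ℝ) (d : ℕ) : ℝ :=
  (Δ + δ * L) * (d : ℝ) ^ (p / (2 * (p - 1))) * L ^ (p / (p - 1)) /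
    (δ * ε ^ ((2 * p - 1) / (p - 1)))

end ZOCOON

end

open ZOCOON

noncomputable section

namespace ZOCOON

/-! ### Polar coordinates and the uniform distribution on the sphere -/

section Polar

variable {d : ℕ}

/-! The argument is an online-to-nonconvex conversion applied to the smoothed objective `smoothed f
ρ`, the average of `f` over balls of radius `ρ = δ/2`. Its gradient `smoothedGradient f ρ w` is an
average of gradients of `f` over the ball around `w`, so it lies in the closed Goldstein set of
radius `δ/2`. Rademacher's theorem supplies the differentiability that this needs.

Two facts about the two-point estimator carry the stochastic part. It is unbiased for
`smoothedGradient` (`integral_two_point`, from the divergence theorem on the ball). Its `p`-th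
moment is at most `8/5 (d^{p/2} + 1) L^p` (`integral_norm_estimator_rpow_le`). The dimension enters
as `d^{p/2}` rather than `d^p` because the symmetric difference is odd in the direction `u`, and an
odd Lipschitz function on the sphere has variance `O(1/d)`. This concentration is proved by a
Gaussian Poincaré inequality for the homogeneous extension of the function, using that norm and
direction of a Gaussian vector are independent.

Clipping turns the `p`-th moment into a bias `τ^{1-p} E‖g‖^p` and a second moment `τ^{2-p} E‖g‖^p`.
Since `τ^p = T (d^{p/2} + 1) L^p`, these are at most `8/5 τ/T` and `8/5 τ²/T`: over a round of `T`
steps the accumulated bias is of order `τ`, and so is the root mean square of the accumulated noise.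

The uniform `s_n` makes `E⟨∇f_ρ(w_n), Δ_n⟩` exactly the expected progress `E[f_ρ(x_n) -
f_ρ(x_{n-1})]`. Each round is projected online gradient descent on the ball of radius `D`. Comparing
it with the point of that ball opposite to the sum `S` of the round's smoothed gradients gives `D
E‖S‖ ≤ progress + 7.3 D τ` (`integral_norm_roundGradient_le`). The progress telescopes over the
rounds. All query points of a round lie within `T D = δ/2` of their average, so `S/T` belongs to the
closed Goldstein set of radius `δ` there. The result is the bound `(2Δ + 2δL)/(δK) + 7.3 τ/T` for
the random output (`integral_goldsteinNorm_le`).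

It remains to balance the two terms in `T` (`round_error_le`) and to solve for `M`
(`balanced_error_le`). Selecting the output by an independent index also requires the Goldstein norm
to be a measurable function of the point; its strict sublevel sets are countable unions of
projections of closed sets along compact spaces. -/

instance [NeZero d] : Nontrivial (E d) := by
  have : Nonempty (Fin d) := ⟨0⟩
  infer_instance

theorem integral_eq_integral_sphere_prod [NeZero d] {V : Type*} [NormedAddCommGroup V]
    [NormedSpace ℝ V] (φ : E d → V) :
    ∫ x, φ x = ∫ q : Metric.sphere (0 : E d) 1 × Set.Ioi (0 : ℝ), φ (q.2.1 • q.1.1)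
      ∂((volume : Measure (E d)).toSphere.prod (.volumeIoiPow (d - 1))) := by
  have h := (volume : Measure (E d)).measurePreserving_homeomorphUnitSphereProd.integral_comp
    (Homeomorph.measurableEmbedding _) (fun q => φ (q.2.1 • q.1.1))
  rw [finrank_euclideanSpace_fin] at h
  have h0 : ∫ x, φ x = ∫ x : ({0}ᶜ : Set (E d)), φ x ∂(volume : Measure (E d)).comap (↑) := by
    rw [integral_subtype_comap (measurableSet_singleton _).compl φ, restrict_compl_singleton]
  rw [← h, h0]
  refine integral_congr_ae (.of_forall fun x => ?_)
  have hx : ‖(x : E d)‖ ≠ 0 := norm_ne_zero_iff.2 x.2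
  simp only [homeomorphUnitSphereProd_apply_snd_coe, homeomorphUnitSphereProd_apply_fst_coe]
  rw [smul_smul, mul_inv_cancel₀ hx, one_smul]

theorem integrable_sphere_prod [NeZero d] {V : Type*} [NormedAddCommGroup V]
    {φ : E d → V} (hφ : Integrable φ) :
    Integrable (fun q : Metric.sphere (0 : E d) 1 × Set.Ioi (0 : ℝ) => φ (q.2.1 • q.1.1))
      ((volume : Measure (E d)).toSphere.prod (.volumeIoiPow (d - 1))) := by
  have h := (volume : Measure (E d)).measurePreserving_homeomorphUnitSphereProd.integrable_comp_emb
    (Homeomorph.measurableEmbedding _) (g := fun q => φ (q.2.1 • q.1.1))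
  rw [finrank_euclideanSpace_fin] at h
  rw [← h]
  rw [← restrict_compl_singleton (μ := (volume : Measure (E d))) 0, ← IntegrableOn,
    integrableOn_iff_comap_subtypeVal (measurableSet_singleton _).compl] at hφ
  convert! hφ using 1
  ext x
  have hx : ‖(x : E d)‖ ≠ 0 := norm_ne_zero_iff.2 x.2
  simp only [Function.comp_apply, homeomorphUnitSphereProd_apply_snd_coe,
    homeomorphUnitSphereProd_apply_fst_coe]
  rw [smul_smul, mul_inv_cancel₀ hx, one_smul]

theorem integral_volumeIoiPow (n : ℕ) (ψ : ℝ → ℝ) :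
    ∫ r : Set.Ioi (0 : ℝ), ψ r ∂(Measure.volumeIoiPow n) = ∫ r in Set.Ioi (0 : ℝ), r ^ n * ψ r := by
  simp only [Measure.volumeIoiPow, ENNReal.ofReal]
  rw [integral_withDensity_eq_integral_smul,
    integral_subtype_comap measurableSet_Ioi fun a ↦ Real.toNNReal (a ^ n) • ψ a,
    setIntegral_congr_fun measurableSet_Ioi fun x hx ↦ ?_]
  · rw [NNReal.smul_def, Real.coe_toNNReal _ (pow_nonneg hx.out.le _), smul_eq_mul]
  · exact (measurable_subtype_coe.pow_const _).real_toNNReal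

/-- Integration in polar coordinates. -/
theorem integral_eq_integral_Ioi_sphere [NeZero d] {φ : E d → ℝ} (hφ : Integrable φ) :
    ∫ x, φ x = ∫ r in Set.Ioi (0 : ℝ),
      r ^ (d - 1) * ∫ u : Metric.sphere (0 : E d) 1, φ (r • u.1)
        ∂(volume : Measure (E d)).toSphere := by
  rw [integral_eq_integral_sphere_prod, integral_prod_symm _ (integrable_sphere_prod hφ)]
  exact integral_volumeIoiPow (d - 1) fun r => ∫ u : Metric.sphere (0 : E d) 1, φ (r • u.1)
        ∂(volume : Measure (E d)).toSphere

theorem toSphere_univ_ne_zero [NeZero d] :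
    (volume : Measure (E d)).toSphere Set.univ ≠ 0 := by
  simpa only [ne_eq, Measure.measure_univ_eq_zero] using Measure.toSphere_ne_zero _

theorem toSphere_real_univ_pos [NeZero d] :
    0 < (volume : Measure (E d)).toSphere.real Set.univ :=
  ENNReal.toReal_pos toSphere_univ_ne_zero (measure_ne_top _ _)

instance [NeZero d] : IsProbabilityMeasure (uniformSphere d) := by
  refine ⟨?_⟩
  rw [uniformSphere, Measure.smul_apply, smul_eq_mul]
  exact ENNReal.inv_mul_cancel toSphere_univ_ne_zero (measure_ne_top _ _)

theorem integral_uniformSphere {V : Type*} [NormedAddCommGroup V]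
    [NormedSpace ℝ V] (q : Metric.sphere (0 : E d) 1 → V) :
    ∫ u, q u ∂(uniformSphere d) = ((volume : Measure (E d)).toSphere.real Set.univ)⁻¹ •
      ∫ u, q u ∂(volume : Measure (E d)).toSphere := by
  rw [uniformSphere, integral_smul_measure, ENNReal.toReal_inv]
  rfl

/-- A radial weight integrates independently of the direction. -/
theorem integral_norm_mul_direction [NeZero d] (φ : ℝ → ℝ) (q : E d → ℝ) :
    ∫ x : E d, φ ‖x‖ * q (‖x‖⁻¹ • x) =
      (∫ x : E d, φ ‖x‖) * ∫ u : Metric.sphere (0 : E d) 1, q u ∂(uniformSphere d) := by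
  have key : ∀ q : E d → ℝ, ∫ x : E d, φ ‖x‖ * q (‖x‖⁻¹ • x) =
      (∫ u : Metric.sphere (0 : E d) 1, q u ∂(volume : Measure (E d)).toSphere) *
        ∫ r : Set.Ioi (0 : ℝ), φ r ∂(Measure.volumeIoiPow (d - 1)) := by
    intro q
    rw [integral_eq_integral_sphere_prod, ← integral_prod_mul]
    refine integral_congr_ae (.of_forall fun x => ?_)
    have h1 : ‖x.2.1 • (x.1.1 : E d)‖ = x.2.1 := by
      rw [norm_smul, Real.norm_of_nonneg x.2.2.out.le, norm_eq_of_mem_sphere, mul_one]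
    simp only [h1]
    rw [smul_smul, inv_mul_cancel₀ x.2.2.out.ne', one_smul, mul_comm]
  -- The choice `q = 1` expresses the radial integral through `∫ φ ‖x‖`. The factorization needs no
  -- integrability, since both sides take the default value `0` together.
  have h1 := key fun _ => 1
  simp only [mul_one, integral_const, smul_eq_mul] at h1
  rw [key, h1, integral_uniformSphere, smul_eq_mul]
  have := (toSphere_real_univ_pos (d := d)).ne'
  field_simp

end Polar

/-! ### The standard Gaussian in polar coordinates -/

section Gaussian

variable {d : ℕ}

/-- The density of the standard Gaussian distribution as a function of the norm. -/
def gaussianProfile (d : ℕ) (r : ℝ) : ℝ :=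
  (2 * Real.pi) ^ (-(d : ℝ) / 2) * Real.exp (-r ^ 2 / 2)

theorem gaussianProfile_nonneg (r : ℝ) : 0 ≤ gaussianProfile d r := by
  unfold gaussianProfile; positivity

theorem continuous_gaussianProfile : Continuous (gaussianProfile d) := by
  unfold gaussianProfile; fun_prop

/-- The explicit Fourier transform does two jobs: at `t = 0` it gives the total mass, and for
general `t` it identifies the measure. -/
theorem integral_gaussianProfile_mul_cexp (t : E d) :
    ∫ x : E d, (gaussianProfile d ‖x‖ : ℂ) * Complex.exp (inner ℝ x t * Complex.I) =
      Complex.exp (-‖t‖ ^ 2 / 2) := by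
  have h := GaussianFourier.integral_cexp_neg_mul_sq_norm_add (V := E d) (b := 1 / 2)
    (by norm_num) Complex.I t
  have h2 : ((Real.pi : ℂ) / (1 / 2)) ^ ((d : ℂ) / 2) = ((2 * Real.pi) ^ ((d : ℝ) / 2) : ℝ) := by
    rw [Complex.ofReal_cpow (by positivity)]; push_cast; congr 1; ring
  rw [finrank_euclideanSpace_fin, h2] at h
  have h3 : ∀ x : E d, (gaussianProfile d ‖x‖ : ℂ) * Complex.exp (inner ℝ x t * Complex.I) =
      ((2 * Real.pi) ^ (-(d : ℝ) / 2) : ℝ) *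
        Complex.exp (-(1 / 2) * ‖x‖ ^ 2 + Complex.I * inner ℝ t x) := by
    intro x
    rw [gaussianProfile, Complex.ofReal_mul, Complex.ofReal_exp, mul_assoc, ← Complex.exp_add,
      real_inner_comm]
    congr 2; push_cast; ring
  simp_rw [h3]
  rw [integral_const_mul, h, ← mul_assoc, ← Complex.ofReal_mul, ← Real.rpow_add (by positivity)]
  have : -(d : ℝ) / 2 + d / 2 = 0 := by ring
  rw [this, Real.rpow_zero, Complex.ofReal_one, one_mul, Complex.I_sq]
  congr 1; ring

theorem integrable_gaussianProfile : Integrable fun x : E d => gaussianProfile d ‖x‖ := by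
  -- A non-integrable profile would have integral `0` by convention, but the Fourier transform at
  -- `0` equals `1`.
  by_contra h
  have h1 := integral_gaussianProfile_mul_cexp (0 : E d)
  simp only [inner_zero_right, Complex.ofReal_zero, zero_mul, Complex.exp_zero, mul_one] at h1
  rw [integral_complex_ofReal, integral_undef h] at h1
  simp at h1

theorem stdGaussian_eq_withDensity : stdGaussian (E d) =
    (volume : Measure (E d)).withDensity fun x => ENNReal.ofReal (gaussianProfile d ‖x‖) := by
  have hfin : IsFiniteMeasure ((volume : Measure (E d)).withDensity
      fun x => ENNReal.ofReal (gaussianProfile d ‖x‖)) :=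
    isFiniteMeasure_withDensity_ofReal integrable_gaussianProfile.2
  apply Measure.ext_of_charFun
  ext t
  rw [charFun_stdGaussian, charFun_apply, ← integral_gaussianProfile_mul_cexp]
  simp only [ENNReal.ofReal]
  rw [integral_withDensity_eq_integral_smul]
  · refine integral_congr_ae (.of_forall fun x => ?_)
    simp only [NNReal.smul_def, Real.coe_toNNReal _ (gaussianProfile_nonneg _), Complex.real_smul]
  · exact (continuous_gaussianProfile.comp continuous_norm).measurable.real_toNNReal

theorem stdGaussian_absolutelyContinuous : stdGaussian (E d) ≪ (volume : Measure (E d)) := by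
  rw [stdGaussian_eq_withDensity]; exact withDensity_absolutelyContinuous _ _

theorem integral_stdGaussian (φ : E d → ℝ) :
    ∫ x, φ x ∂(stdGaussian (E d)) = ∫ x, gaussianProfile d ‖x‖ * φ x := by
  rw [stdGaussian_eq_withDensity]
  simp only [ENNReal.ofReal]
  rw [integral_withDensity_eq_integral_smul]
  · refine integral_congr_ae (.of_forall fun x => ?_)
    simp only [NNReal.smul_def, Real.coe_toNNReal _ (gaussianProfile_nonneg _), smul_eq_mul]
  · exact (continuous_gaussianProfile.comp continuous_norm).measurable.real_toNNReal

/-- Under the standard Gaussian distribution the norm and the direction are independent, and the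
direction is uniformly distributed. -/
theorem integral_stdGaussian_norm_mul_direction [NeZero d] (φ : ℝ → ℝ) (q : E d → ℝ) :
    ∫ x : E d, φ ‖x‖ * q (‖x‖⁻¹ • x) ∂(stdGaussian (E d)) =
      (∫ x : E d, φ ‖x‖ ∂(stdGaussian (E d))) *
        ∫ u : Metric.sphere (0 : E d) 1, q u ∂(uniformSphere d) := by
  simp_rw [integral_stdGaussian, ← mul_assoc]
  exact integral_norm_mul_direction (fun r => gaussianProfile d r * φ r) q

theorem integral_inner_sq_stdGaussian (a : E d) :
    ∫ y, inner ℝ a y ^ 2 ∂(stdGaussian (E d)) = ‖a‖ ^ 2 := by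
  have h := variance_dual_stdGaussian (E := E d) (innerSL ℝ a)
  rw [innerSL_apply_norm, variance_of_integral_eq_zero] at h
  · simpa using h
  · exact (innerSL ℝ a).continuous.aemeasurable
  · exact integral_strongDual_stdGaussian _

theorem memLp_id_stdGaussian : MemLp (fun x : E d => x) 2 (stdGaussian (E d)) :=
  IsGaussian.memLp_two_id

theorem integrable_norm_sq_stdGaussian :
    Integrable (fun x : E d => ‖x‖ ^ 2) (stdGaussian (E d)) :=
  memLp_id_stdGaussian.integrable_norm_pow (by norm_num)

theorem integral_norm_sq_stdGaussian : ∫ x, ‖x‖ ^ 2 ∂(stdGaussian (E d)) = d := by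
  have h : ∀ x : E d, ‖x‖ ^ 2 = ∑ i : Fin d, inner ℝ (EuclideanSpace.single i (1 : ℝ)) x ^ 2 := by
    intro x
    rw [EuclideanSpace.real_norm_sq_eq]
    simp [EuclideanSpace.inner_single_left]
  simp_rw [h]
  rw [integral_finsetSum]
  · simp_rw [integral_inner_sq_stdGaussian]; simp
  · intro i _
    exact (memLp_id_stdGaussian.const_inner _).integrable_sq

end Gaussian

/-! ### A Poincaré inequality for odd Lipschitz functions on the sphere -/

section Poincare

variable {d : ℕ}

/-- The positively homogeneous extension of degree one of the restriction of `h` to the sphere. -/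
def homogeneousExtension (h : E d → ℝ) (x : E d) : ℝ :=
  ‖x‖ * h (‖x‖⁻¹ • x)

theorem abs_le_of_odd_of_lipschitz {h : E d → ℝ} {K : ℝ} (hK : ∀ x y, |h x - h y| ≤ K * ‖x - y‖)
    (hodd : ∀ x, h (-x) = -h x) (x : E d) : |h x| ≤ K * ‖x‖ := by
  have h1 := hK x (-x)
  rw [hodd, sub_neg_eq_add, sub_neg_eq_add, ← two_mul, ← two_smul ℝ x, norm_smul, abs_mul] at h1
  norm_num at h1
  linarith

theorem norm_inv_norm_smul {x : E d} (hx : x ≠ 0) : ‖‖x‖⁻¹ • x‖ = 1 := by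
  rw [norm_smul, norm_inv, norm_norm, inv_mul_cancel₀ (norm_ne_zero_iff.2 hx)]

theorem homogeneousExtension_neg {h : E d → ℝ} (hodd : ∀ x, h (-x) = -h x) (x : E d) :
    homogeneousExtension h (-x) = -homogeneousExtension h x := by
  simp [homogeneousExtension, hodd]

theorem homogeneousExtension_smul (h : E d → ℝ) {t : ℝ} (ht : 0 < t) (x : E d) :
    homogeneousExtension h (t • x) = t * homogeneousExtension h x := by
  simp only [homogeneousExtension, norm_smul, Real.norm_of_nonneg ht.le, mul_inv, smul_smul]
  rw [mul_assoc, mul_right_comm t⁻¹, inv_mul_cancel₀ ht.ne', one_mul]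

/-- One `K` comes from changing the norm and two from changing the direction. The crude factor `3`
is harmless: this constant only serves integrability, almost everywhere differentiability and
absolute continuity, and does not appear in the Poincaré bound. -/
theorem abs_homogeneousExtension_sub_le {h : E d → ℝ} {K : ℝ} (hK0 : 0 ≤ K)
    (hK : ∀ x y, |h x - h y| ≤ K * ‖x - y‖) (hodd : ∀ x, h (-x) = -h x) (x y : E d) :
    |homogeneousExtension h x - homogeneousExtension h y| ≤ 3 * K * ‖x - y‖ := by
  have hb : ∀ x : E d, |homogeneousExtension h x| ≤ K * ‖x‖ := by
    intro x
    rcases eq_or_ne x 0 with rfl | hx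
    · simp [homogeneousExtension]
    · have := abs_le_of_odd_of_lipschitz hK hodd (‖x‖⁻¹ • x)
      rw [norm_inv_norm_smul hx, mul_one] at this
      rw [homogeneousExtension, abs_mul, abs_norm, mul_comm]
      gcongr
  rcases eq_or_ne x 0 with rfl | hx
  · have := hb y
    have h0 : homogeneousExtension h (0 : E d) = 0 := by simp [homogeneousExtension]
    rw [h0, zero_sub, zero_sub, abs_neg, norm_neg]
    nlinarith [norm_nonneg y]
  rcases eq_or_ne y 0 with rfl | hy
  · have := hb x
    have h0 : homogeneousExtension h (0 : E d) = 0 := by simp [homogeneousExtension]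
    rw [h0, sub_zero, sub_zero]
    nlinarith [norm_nonneg x]
  have hx' : ‖x‖ ≠ 0 := norm_ne_zero_iff.2 hx
  have hy' : ‖y‖ ≠ 0 := norm_ne_zero_iff.2 hy
  have h1 : ‖y‖ * ‖‖x‖⁻¹ • x - ‖y‖⁻¹ • y‖ ≤ 2 * ‖x - y‖ := by
    rw [← norm_norm y, ← norm_smul, norm_norm, smul_sub, smul_smul, smul_smul,
      mul_inv_cancel₀ hy', one_smul]
    have h2 : (‖y‖ * ‖x‖⁻¹) • x - y = (‖y‖ - ‖x‖) • (‖x‖⁻¹ • x) + (x - y) := by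
      rw [sub_smul, smul_smul, smul_smul, mul_inv_cancel₀ hx', one_smul]; abel
    rw [h2]
    refine (norm_add_le _ _).trans ?_
    rw [norm_smul, norm_inv_norm_smul hx, mul_one, Real.norm_eq_abs]
    have := abs_norm_sub_norm_le y x
    rw [norm_sub_rev y x] at this
    linarith
  have h3 : homogeneousExtension h x - homogeneousExtension h y =
      (‖x‖ - ‖y‖) * h (‖x‖⁻¹ • x) + ‖y‖ * (h (‖x‖⁻¹ • x) - h (‖y‖⁻¹ • y)) := by
    simp only [homogeneousExtension]; ring
  rw [h3]
  refine (abs_add_le _ _).trans ?_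
  rw [abs_mul, abs_mul, abs_norm]
  have h4 := abs_le_of_odd_of_lipschitz hK hodd (‖x‖⁻¹ • x)
  rw [norm_inv_norm_smul hx, mul_one] at h4
  have h5 := hK (‖x‖⁻¹ • x) (‖y‖⁻¹ • y)
  calc |‖x‖ - ‖y‖| * |h (‖x‖⁻¹ • x)| + ‖y‖ * |h (‖x‖⁻¹ • x) - h (‖y‖⁻¹ • y)|
      ≤ ‖x - y‖ * K + ‖y‖ * (K * ‖‖x‖⁻¹ • x - ‖y‖⁻¹ • y‖) := by
        gcongr
        exact abs_norm_sub_norm_le x y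
    _ = ‖x - y‖ * K + K * (‖y‖ * ‖‖x‖⁻¹ • x - ‖y‖⁻¹ • y‖) := by ring
    _ ≤ ‖x - y‖ * K + K * (2 * ‖x - y‖) := by gcongr
    _ = 3 * K * ‖x - y‖ := by ring

theorem lipschitzWith_of_abs_sub_le {h : E d → ℝ} {K : ℝ} (hK0 : 0 ≤ K)
    (hK : ∀ x y, |h x - h y| ≤ K * ‖x - y‖) : LipschitzWith K.toNNReal h :=
  LipschitzWith.of_dist_le_mul fun x y => by
    rw [Real.dist_eq, dist_eq_norm, Real.coe_toNNReal _ hK0]; exact hK x y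

theorem norm_gradient_le {h : E d → ℝ} {K : ℝ} (hK0 : 0 ≤ K)
    (hK : ∀ x y, |h x - h y| ≤ K * ‖x - y‖) (x : E d) : ‖gradient h x‖ ≤ K := by
  have := norm_fderiv_le_of_lipschitz ℝ (lipschitzWith_of_abs_sub_le hK0 hK) (x₀ := x)
  rwa [Real.coe_toNNReal _ hK0, ← (InnerProductSpace.toDual ℝ (E d)).symm.norm_map] at this

theorem measurable_gradient (h : E d → ℝ) : Measurable (gradient h) := by
  unfold gradient
  exact (InnerProductSpace.toDual ℝ (E d)).symm.continuous.measurable.comp (measurable_fderiv ℝ h)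

/-- Euler's identity: differentiate `t ↦ H (t x) = t H x` at `t = 1`. -/
theorem inner_gradient_self {h : E d → ℝ} {x : E d}
    (hd : DifferentiableAt ℝ (homogeneousExtension h) x) :
    inner ℝ (gradient (homogeneousExtension h) x) x = homogeneousExtension h x := by
  have hg := hd.hasGradientAt.hasFDerivAt
  have h1 : HasDerivAt (fun t : ℝ => homogeneousExtension h (t • x))
      (inner ℝ (gradient (homogeneousExtension h) x) x) 1 := by
    have h2 : HasDerivAt (fun t : ℝ => t • x) x 1 := by
      simpa using (hasDerivAt_id (1 : ℝ)).smul_const x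
    have h3 := (show HasFDerivAt (homogeneousExtension h) _ ((1 : ℝ) • x) by
      rw [one_smul]; exact hg).comp_hasDerivAt (1 : ℝ) h2
    exact h3
  have h4 : HasDerivAt (fun t : ℝ => homogeneousExtension h (t • x))
      (homogeneousExtension h x) 1 := by
    have h5 : HasDerivAt (fun t : ℝ => t * homogeneousExtension h x)
        (homogeneousExtension h x) 1 := by
      simpa using (hasDerivAt_id (1 : ℝ)).mul_const (homogeneousExtension h x)
    refine h5.congr_of_eventuallyEq ?_
    filter_upwards [lt_mem_nhds (zero_lt_one' ℝ)] with t ht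
    exact homogeneousExtension_smul h ht x
  exact h1.unique h4

/-- Move along the great circle through `x` with velocity `v`. The norm stays constant there, so
only the variation of `h` counts, and it is controlled by the chord, which is at most `‖x‖ |t|`.
This gives the sharp tangential constant `K` instead of `3 K`. -/
theorem abs_inner_gradient_le_of_orthogonal {h : E d → ℝ} {K : ℝ} (hK0 : 0 ≤ K)
    (hK : ∀ x y, |h x - h y| ≤ K * ‖x - y‖) {x v : E d} (hx : x ≠ 0)
    (hd : DifferentiableAt ℝ (homogeneousExtension h) x) (hv : inner ℝ x v = 0)
    (hvx : ‖v‖ = ‖x‖) :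
    |inner ℝ (gradient (homogeneousExtension h) x) v| ≤ K * ‖x‖ := by
  have hx' : ‖x‖ ≠ 0 := norm_ne_zero_iff.2 hx
  set γ : ℝ → E d := fun t => Real.cos t • x + Real.sin t • v with hγ
  have hγ0 : γ 0 = x := by simp [γ]
  have hg := hd.hasGradientAt.hasFDerivAt
  have h2 : HasDerivAt γ v 0 := by
    have := ((Real.hasDerivAt_cos 0).smul_const x).add ((Real.hasDerivAt_sin 0).smul_const v)
    simp only [Real.sin_zero, neg_zero, zero_smul, Real.cos_zero, one_smul, zero_add] at this
    exact this
  have h3 : HasDerivAt (fun t => homogeneousExtension h (γ t))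
      (inner ℝ (gradient (homogeneousExtension h) x) v) 0 := by
    have := (show HasFDerivAt (homogeneousExtension h) _ (γ 0) by
      rw [hγ0]; exact hg).comp_hasDerivAt (0 : ℝ) h2
    exact this
  have hn : ∀ t, ‖γ t‖ = ‖x‖ := by
    intro t
    rw [← sq_eq_sq₀ (norm_nonneg _) (norm_nonneg _)]
    simp only [γ]
    rw [norm_add_sq_real, inner_smul_left, inner_smul_right, hv, norm_smul, norm_smul, hvx,
      mul_pow, mul_pow, Real.norm_eq_abs, Real.norm_eq_abs, sq_abs, sq_abs]
    linear_combination ‖x‖ ^ 2 * Real.sin_sq_add_cos_sq t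
  have hdist : ∀ t, ‖γ t - x‖ ≤ ‖x‖ * |t| := by
    intro t
    rw [← sq_le_sq₀ (norm_nonneg _) (by positivity)]
    have h4 : inner ℝ (γ t) x = Real.cos t * ‖x‖ ^ 2 := by
      simp only [γ]
      rw [inner_add_left, inner_smul_left, inner_smul_left, real_inner_comm x v, hv,
        real_inner_self_eq_norm_sq]
      simp
    rw [norm_sub_sq_real, hn, h4, mul_pow, sq_abs]
    nlinarith [Real.one_sub_sq_div_two_le_cos (x := t), sq_nonneg ‖x‖]
  refine h3.le_of_lip' (by positivity) (.of_forall fun t => ?_)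
  rw [hγ0, sub_zero, Real.norm_eq_abs, Real.norm_eq_abs, homogeneousExtension,
    homogeneousExtension, hn, ← mul_sub, abs_mul, abs_norm]
  calc ‖x‖ * |h (‖x‖⁻¹ • γ t) - h (‖x‖⁻¹ • x)|
      ≤ ‖x‖ * (K * ‖‖x‖⁻¹ • γ t - ‖x‖⁻¹ • x‖) := by gcongr; exact hK _ _
    _ = K * ‖γ t - x‖ := by
      rw [← smul_sub, norm_smul, norm_inv, norm_norm]; field_simp
    _ ≤ K * (‖x‖ * |t|) := by gcongr; exact hdist t
    _ = K * ‖x‖ * |t| := by ring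

/-- Split the gradient into its radial part, which is `h e` by Euler's identity, and its tangential
part `w`, of norm at most `K`. -/
theorem norm_gradient_homogeneousExtension_sq_le {h : E d → ℝ} {K : ℝ} (hK0 : 0 ≤ K)
    (hK : ∀ x y, |h x - h y| ≤ K * ‖x - y‖) {x : E d} (hx : x ≠ 0)
    (hd : DifferentiableAt ℝ (homogeneousExtension h) x) :
    ‖gradient (homogeneousExtension h) x‖ ^ 2 ≤ h (‖x‖⁻¹ • x) ^ 2 + K ^ 2 := by
  have hx' : 0 < ‖x‖ := norm_pos_iff.2 hx
  set g := gradient (homogeneousExtension h) x with hg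
  set e := ‖x‖⁻¹ • x with he
  have hen : ‖e‖ = 1 := norm_inv_norm_smul hx
  have h1 : inner ℝ g e = h e := by
    rw [he, inner_smul_right, inner_gradient_self hd, homogeneousExtension, ← mul_assoc,
      inv_mul_cancel₀ hx'.ne', one_mul]
  set w := g - h e • e with hw
  have hwe : inner ℝ e w = 0 := by
    rw [hw, inner_sub_right, inner_smul_right, real_inner_self_eq_norm_sq, hen, real_inner_comm, h1]
    ring
  have hgw : g = h e • e + w := by rw [hw]; abel
  have hgn : ‖g‖ ^ 2 = h e ^ 2 + ‖w‖ ^ 2 := by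
    rw [hgw, norm_add_sq_real, inner_smul_left, hwe, norm_smul, hen, Real.norm_eq_abs, mul_one,
      sq_abs]
    ring
  have hwK : ‖w‖ ≤ K := by
    rcases eq_or_ne w 0 with h0 | h0
    · rw [h0, norm_zero]; exact hK0
    have hw0 : 0 < ‖w‖ := norm_pos_iff.2 h0
    have hxe : x = ‖x‖ • e := by rw [he, smul_smul, mul_inv_cancel₀ hx'.ne', one_smul]
    -- The tangential part is tested against itself, rescaled to the norm of `x`.
    have h2 := abs_inner_gradient_le_of_orthogonal hK0 hK (v := (‖x‖ * ‖w‖⁻¹) • w) hx hd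
      (by rw [inner_smul_right, hxe, inner_smul_left, hwe]; simp)
      (by rw [norm_smul, norm_mul, norm_norm, norm_inv, norm_norm, mul_assoc,
        inv_mul_cancel₀ hw0.ne', mul_one])
    have h3 : inner ℝ g w = ‖w‖ ^ 2 := by
      rw [hgw, inner_add_left, inner_smul_left, hwe, real_inner_self_eq_norm_sq]; simp
    rw [← hg, inner_smul_right, h3, abs_of_nonneg (by positivity)] at h2
    have h4 : ‖x‖ * ‖w‖⁻¹ * ‖w‖ ^ 2 = ‖w‖ * ‖x‖ := by field_simp
    rw [h4] at h2
    exact le_of_mul_le_mul_right h2 hx'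
  rw [hgn]
  gcongr

/-- Cauchy–Schwarz, obtained from `∫ (ψ - m)² ≥ 0` with `m` the mean of `ψ` on the interval. -/
theorem sq_intervalIntegral_le {ψ : ℝ → ℝ} {a b C : ℝ} (hab : a ≤ b) (hψ : Measurable ψ)
    (hC : ∀ t, |ψ t| ≤ C) :
    (∫ t in a..b, ψ t) ^ 2 ≤ (b - a) * ∫ t in a..b, ψ t ^ 2 := by
  rcases hab.eq_or_lt with rfl | hlt
  · simp
  have hb : ∀ {φ : ℝ → ℝ} (_ : Measurable φ) {B : ℝ} (_ : ∀ t, |φ t| ≤ B),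
      IntervalIntegrable φ volume a b := fun {φ} hφ {B} hB => by
    rw [intervalIntegrable_iff]
    exact Measure.integrableOn_of_bounded (M := B) (by simp) hφ.aestronglyMeasurable
      (.of_forall hB)
  have h1 : IntervalIntegrable ψ volume a b := hb hψ hC
  have h2 : IntervalIntegrable (fun t => ψ t ^ 2) volume a b :=
    hb (B := C ^ 2) (hψ.pow_const 2) fun t => by
      rw [abs_pow]; exact pow_le_pow_left₀ (abs_nonneg _) (hC t) 2
  set I := ∫ t in a..b, ψ t
  set m := I / (b - a)
  have hba : 0 < b - a := sub_pos.2 hlt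
  have h3 : 0 ≤ ∫ t in a..b, (ψ t ^ 2 - (2 * m) * ψ t + m ^ 2) :=
    intervalIntegral.integral_nonneg hab fun t _ => by nlinarith [sq_nonneg (ψ t - m)]
  rw [intervalIntegral.integral_add (h2.sub (h1.const_mul _)) intervalIntegrable_const,
    intervalIntegral.integral_sub h2 (h1.const_mul _), intervalIntegral.integral_const_mul,
    intervalIntegral.integral_const, smul_eq_mul] at h3
  have h4 : m * (b - a) = I := div_mul_cancel₀ _ hba.ne'
  have h5 : 0 ≤ (b - a) * (∫ t in a..b, ψ t ^ 2) - 2 * (m * (b - a)) * I + (m * (b - a)) ^ 2 := by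
    have := mul_nonneg hba.le h3
    nlinarith
  rw [h4] at h5
  nlinarith

end Poincare

/-! ### The Gaussian Poincaré inequality by rotation, and its transfer to the sphere. -/

section Poincare

variable {d : ℕ}

/-- The derivative of `H` along the path `θ ↦ cos θ • x + sin θ • y`. -/
def rotationDeriv (H : E d → ℝ) (θ : ℝ) (q : E d × E d) : ℝ :=
  inner ℝ (gradient H (ContinuousLinearMap.rotation θ q).1) (ContinuousLinearMap.rotation θ q).2

theorem continuous_rotation :
    Continuous fun r : ℝ × (E d × E d) => ContinuousLinearMap.rotation r.1 r.2 := by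
  simp only [ContinuousLinearMap.rotation_apply]
  fun_prop

theorem measurable_rotationDeriv (H : E d → ℝ) :
    Measurable fun r : ℝ × (E d × E d) => rotationDeriv H r.1 r.2 := by
  unfold rotationDeriv
  have h := continuous_rotation (d := d)
  exact ((measurable_gradient H).comp h.fst.measurable).inner h.snd.measurable

theorem abs_rotationDeriv_le {H : E d → ℝ} {K : ℝ} (hK0 : 0 ≤ K)
    (hK : ∀ x y, |H x - H y| ≤ K * ‖x - y‖) (θ : ℝ) (q : E d × E d) :
    |rotationDeriv H θ q| ≤ K * (‖q.1‖ + ‖q.2‖) := by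
  unfold rotationDeriv
  refine (abs_real_inner_le_norm _ _).trans ?_
  refine mul_le_mul (norm_gradient_le hK0 hK _) ?_ (norm_nonneg _) hK0
  rw [ContinuousLinearMap.rotation_apply]
  refine (norm_add_le _ _).trans ?_
  rw [norm_smul, norm_smul, norm_neg, Real.norm_eq_abs, Real.norm_eq_abs]
  nlinarith [Real.abs_sin_le_one θ, Real.abs_cos_le_one θ, norm_nonneg q.1, norm_nonneg q.2]

theorem hasDerivAt_rotation_fst (θ : ℝ) (q : E d × E d) :
    HasDerivAt (fun t => (ContinuousLinearMap.rotation t q).1)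
      (ContinuousLinearMap.rotation θ q).2 θ := by
  simp only [ContinuousLinearMap.rotation_apply]
  exact ((Real.hasDerivAt_cos θ).smul_const q.1).add ((Real.hasDerivAt_sin θ).smul_const q.2)

theorem hasDerivAt_comp_rotation {H : E d → ℝ} {θ : ℝ} {q : E d × E d}
    (hH : DifferentiableAt ℝ H (ContinuousLinearMap.rotation θ q).1) :
    HasDerivAt (fun t => H (ContinuousLinearMap.rotation t q).1) (rotationDeriv H θ q) θ := by
  have h := HasFDerivAt.comp_hasDerivAt (f := fun t => (ContinuousLinearMap.rotation t q).1) θ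
    hH.hasGradientAt.hasFDerivAt (hasDerivAt_rotation_fst θ q)
  rw [InnerProductSpace.toDual_apply_apply] at h
  exact h

theorem map_rotation_stdGaussian (θ : ℝ) :
    ((stdGaussian (E d)).prod (stdGaussian (E d))).map (ContinuousLinearMap.rotation θ) =
      (stdGaussian (E d)).prod (stdGaussian (E d)) :=
  IsGaussian.map_rotation_eq_self (by simp) θ

/-- For each fixed angle this is Rademacher's theorem, because the rotated pair is again a pair of
independent Gaussians. Fubini then exchanges "for all `θ`, almost every `q`" with "for almost every
`q`, almost every `θ`". -/
theorem ae_differentiableAt_rotation {H : E d → ℝ} {K : ℝ} (hK0 : 0 ≤ K)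
    (hK : ∀ x y, |H x - H y| ≤ K * ‖x - y‖) :
    ∀ᵐ q ∂((stdGaussian (E d)).prod (stdGaussian (E d))), ∀ᵐ θ : ℝ,
      DifferentiableAt ℝ H (ContinuousLinearMap.rotation θ q).1 := by
  have h1 : ∀ᵐ x ∂(stdGaussian (E d)), DifferentiableAt ℝ H x :=
    stdGaussian_absolutelyContinuous.ae_le
      (lipschitzWith_of_abs_sub_le hK0 hK).ae_differentiableAt
  have hm : MeasurableSet {x | DifferentiableAt ℝ H x} := measurableSet_of_differentiableAt ℝ H
  have h2 := Measure.ae_ae_comm (μ := (volume : Measure ℝ))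
    (ν := (stdGaussian (E d)).prod (stdGaussian (E d)))
    (p := fun θ q => DifferentiableAt ℝ H (ContinuousLinearMap.rotation θ q).1)
    (hm.preimage continuous_rotation.fst.measurable)
  rw [← h2]
  refine .of_forall fun θ => ?_
  have h3 : ∀ᵐ q ∂((stdGaussian (E d)).prod (stdGaussian (E d))), DifferentiableAt ℝ H q.1 :=
    Measure.quasiMeasurePreserving_fst.ae h1
  rw [← map_rotation_stdGaussian θ] at h3
  exact ae_of_ae_map (ContinuousLinearMap.rotation θ).continuous.aemeasurable h3

theorem lipschitzWith_comp_rotation {H : E d → ℝ} {K : ℝ} (hK0 : 0 ≤ K)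
    (hK : ∀ x y, |H x - H y| ≤ K * ‖x - y‖) (q : E d × E d) :
    LipschitzWith (K * (‖q.1‖ + ‖q.2‖)).toNNReal
      fun θ => H (ContinuousLinearMap.rotation θ q).1 := by
  refine LipschitzWith.of_dist_le_mul fun s t => ?_
  rw [Real.coe_toNNReal _ (by positivity), Real.dist_eq, Real.dist_eq]
  refine (hK _ _).trans ?_
  rw [mul_assoc]
  refine mul_le_mul_of_nonneg_left ?_ hK0
  simp only [ContinuousLinearMap.rotation_apply]
  rw [add_sub_add_comm, ← sub_smul, ← sub_smul]
  refine (norm_add_le _ _).trans ?_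
  rw [norm_smul, norm_smul]
  have h1 := Real.lipschitzWith_cos.dist_le_mul s t
  have h2 := Real.lipschitzWith_sin.dist_le_mul s t
  simp only [NNReal.coe_one, one_mul, Real.dist_eq] at h1 h2
  rw [Real.norm_eq_abs, Real.norm_eq_abs]
  nlinarith [norm_nonneg q.1, norm_nonneg q.2]

/-- Along the path `H` is Lipschitz, hence absolutely continuous, so the fundamental theorem of
calculus holds with the almost everywhere derivative. -/
theorem integral_rotationDeriv {H : E d → ℝ} {K : ℝ} (hK0 : 0 ≤ K)
    (hK : ∀ x y, |H x - H y| ≤ K * ‖x - y‖) {q : E d × E d}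
    (hq : ∀ᵐ θ : ℝ, DifferentiableAt ℝ H (ContinuousLinearMap.rotation θ q).1) (a b : ℝ) :
    ∫ θ in a..b, rotationDeriv H θ q =
      H (ContinuousLinearMap.rotation b q).1 - H (ContinuousLinearMap.rotation a q).1 := by
  have hac := ((lipschitzWith_comp_rotation hK0 hK q).lipschitzOnWith
    (s := Set.uIcc a b)).absolutelyContinuousOnInterval
  rw [← hac.integral_deriv_eq_sub]
  refine intervalIntegral.integral_congr_ae ?_
  filter_upwards [hq] with θ hθ _
  exact (hasDerivAt_comp_rotation hθ).deriv.symm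

theorem sq_sub_rotation_le {H : E d → ℝ} {K : ℝ} (hK0 : 0 ≤ K)
    (hK : ∀ x y, |H x - H y| ≤ K * ‖x - y‖) {q : E d × E d}
    (hq : ∀ᵐ θ : ℝ, DifferentiableAt ℝ H (ContinuousLinearMap.rotation θ q).1) {a b : ℝ}
    (hab : a ≤ b) :
    (H (ContinuousLinearMap.rotation b q).1 - H (ContinuousLinearMap.rotation a q).1) ^ 2 ≤
      (b - a) * ∫ θ in a..b, rotationDeriv H θ q ^ 2 := by
  have h : Measurable fun θ : ℝ => rotationDeriv H θ q :=
    (measurable_rotationDeriv H).of_uncurry_right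
  have h2 := sq_intervalIntegral_le hab h (abs_rotationDeriv_le hK0 hK · q)
  rwa [integral_rotationDeriv hK0 hK hq] at h2

theorem integrable_add_norm_sq :
    Integrable (fun q : E d × E d => (‖q.1‖ + ‖q.2‖) ^ 2)
      ((stdGaussian (E d)).prod (stdGaussian (E d))) := by
  have h1 : MemLp (fun q : E d × E d => ‖q.1‖) 2 ((stdGaussian (E d)).prod (stdGaussian (E d))) :=
    (memLp_id_stdGaussian.comp_fst _).norm
  have h2 : MemLp (fun q : E d × E d => ‖q.2‖) 2 ((stdGaussian (E d)).prod (stdGaussian (E d))) :=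
    (memLp_id_stdGaussian.comp_snd _).norm
  exact (h1.add h2).integrable_sq

/-- Rotation invariance reduces to `θ = 0`, where the integrand is `⟨∇H(x), y⟩²` with `y`
independent of `x`; the integral over `y` is `‖∇H(x)‖²`. -/
theorem integral_rotationDeriv_sq {H : E d → ℝ} {K : ℝ} (hK0 : 0 ≤ K)
    (hK : ∀ x y, |H x - H y| ≤ K * ‖x - y‖) (θ : ℝ) :
    ∫ q, rotationDeriv H θ q ^ 2 ∂((stdGaussian (E d)).prod (stdGaussian (E d))) =
      ∫ x, ‖gradient H x‖ ^ 2 ∂(stdGaussian (E d)) := by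
  have hm : Measurable fun q : E d × E d => inner ℝ (gradient H q.1) q.2 ^ 2 :=
    (((measurable_gradient H).comp measurable_fst).inner measurable_snd).pow_const 2
  have h1 : ∫ q, rotationDeriv H θ q ^ 2 ∂((stdGaussian (E d)).prod (stdGaussian (E d))) =
      ∫ q : E d × E d, inner ℝ (gradient H q.1) q.2 ^ 2
        ∂((stdGaussian (E d)).prod (stdGaussian (E d))) := by
    conv_rhs => rw [← map_rotation_stdGaussian θ]
    rw [integral_map (ContinuousLinearMap.rotation θ).continuous.aemeasurable
      hm.aestronglyMeasurable]
    rfl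
  rw [h1, integral_prod]
  · simp_rw [integral_inner_sq_stdGaussian]
  · refine (integrable_add_norm_sq.const_mul (K ^ 2)).mono' hm.aestronglyMeasurable
      (.of_forall fun q => ?_)
    rw [Real.norm_of_nonneg (sq_nonneg _), ← mul_pow, ← sq_abs]
    gcongr
    refine (abs_real_inner_le_norm _ _).trans ?_
    refine mul_le_mul (norm_gradient_le hK0 hK _) ?_ (norm_nonneg _) hK0
    linarith [norm_nonneg q.1]

/-- The Gaussian Poincaré inequality for odd Lipschitz functions, up to the factor `π ^ 2 / 8`. -/
theorem integral_sq_stdGaussian_le_of_odd {H : E d → ℝ} {K : ℝ} (hK0 : 0 ≤ K)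
    (hK : ∀ x y, |H x - H y| ≤ K * ‖x - y‖) (hodd : ∀ x, H (-x) = -H x) :
    ∫ x, H x ^ 2 ∂(stdGaussian (E d)) ≤
      Real.pi ^ 2 / 8 * ∫ x, ‖gradient H x‖ ^ 2 ∂(stdGaussian (E d)) := by
  set γ := (stdGaussian (E d)).prod (stdGaussian (E d)) with hγ
  set J := ∫ x, ‖gradient H x‖ ^ 2 ∂(stdGaussian (E d)) with hJ
  have hHm : Measurable H := (lipschitzWith_of_abs_sub_le hK0 hK).continuous.measurable
  have hHi : Integrable (fun x => H x ^ 2) (stdGaussian (E d)) := by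
    refine (integrable_norm_sq_stdGaussian.const_mul (K ^ 2)).mono'
      (hHm.pow_const 2).aestronglyMeasurable (.of_forall fun x => ?_)
    rw [Real.norm_of_nonneg (sq_nonneg _), ← mul_pow, ← sq_abs]
    gcongr
    exact abs_le_of_odd_of_lipschitz hK hodd x
  have hI : ∀ a b : ℝ, Integrable (fun r : ℝ × (E d × E d) => rotationDeriv H r.1 r.2 ^ 2)
      ((volume.restrict (Set.Ioc a b)).prod γ) := by
    intro a b
    refine ((integrable_add_norm_sq.const_mul (K ^ 2)).comp_snd
      (volume.restrict (Set.Ioc a b))).mono'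
      ((measurable_rotationDeriv H).pow_const 2).aestronglyMeasurable (.of_forall fun r => ?_)
    rw [Real.norm_of_nonneg (sq_nonneg _), ← mul_pow, ← sq_abs]
    gcongr
    exact abs_rotationDeriv_le hK0 hK _ _
  have hF : ∀ {a b : ℝ}, a ≤ b →
      Integrable (fun q => ∫ θ in a..b, rotationDeriv H θ q ^ 2) γ ∧
      ∫ q, (∫ θ in a..b, rotationDeriv H θ q ^ 2) ∂γ = (b - a) * J := by
    intro a b hab
    simp_rw [intervalIntegral.integral_of_le hab]
    refine ⟨(hI a b).swap.integral_prod_left, ?_⟩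
    rw [integral_integral_swap (f := fun q θ => rotationDeriv H θ q ^ 2) (hI a b).swap]
    simp_rw [hγ, integral_rotationDeriv_sq hK0 hK]
    rw [integral_const, smul_eq_mul]
    simp [hab, hJ]
  have hpi := Real.pi_pos
  obtain ⟨hi1, he1⟩ := hF (a := 0) (b := Real.pi / 2) (by positivity)
  obtain ⟨hi2, he2⟩ := hF (a := -(Real.pi / 2)) (b := 0) (by linarith)
  have hle : ∫ q, (2 * H q.1 ^ 2 + 2 * H q.2 ^ 2) ∂γ ≤
      ∫ q, (Real.pi / 2 * (∫ θ in (0 : ℝ)..(Real.pi / 2), rotationDeriv H θ q ^ 2) +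
        Real.pi / 2 * ∫ θ in (-(Real.pi / 2))..(0 : ℝ), rotationDeriv H θ q ^ 2) ∂γ := by
    refine integral_mono_ae (((hHi.comp_fst _).const_mul 2).add ((hHi.comp_snd _).const_mul 2))
      ((hi1.const_mul _).add (hi2.const_mul _)) ?_
    filter_upwards [ae_differentiableAt_rotation hK0 hK] with q hq
    -- The two quarter turns end at `y` and start at `-y`, so by oddness their increments are `H y -
    -- H x` and `H x + H y`. The squares add up to `2 H(x)² + 2 H(y)²`, and no mean has to be
    -- subtracted.
    have h1 := sq_sub_rotation_le hK0 hK hq (a := 0) (b := Real.pi / 2) (by positivity)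
    have h2 := sq_sub_rotation_le hK0 hK hq (a := -(Real.pi / 2)) (b := 0) (by linarith)
    simp only [ContinuousLinearMap.rotation_apply, Real.cos_zero, Real.sin_zero,
      Real.cos_pi_div_two, Real.sin_pi_div_two, Real.cos_neg, Real.sin_neg, one_smul, zero_smul,
      neg_smul, add_zero, zero_add, hodd] at h1 h2
    nlinarith
  have hHs : ∫ q : E d × E d, (2 * H q.1 ^ 2 + 2 * H q.2 ^ 2) ∂γ =
      4 * ∫ x, H x ^ 2 ∂(stdGaussian (E d)) := by
    rw [integral_add ((hHi.comp_fst _).const_mul 2) ((hHi.comp_snd _).const_mul 2),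
      integral_const_mul, integral_const_mul,
      integral_fun_fst (fun x => H x ^ 2), integral_fun_snd (fun x => H x ^ 2)]
    simp
    ring
  rw [hHs, integral_add (hi1.const_mul _) (hi2.const_mul _), integral_const_mul,
    integral_const_mul, he1, he2] at hle
  nlinarith

/-- Odd `K`-Lipschitz functions on the sphere have variance of order `K ^ 2 / d`. -/
theorem sq_mul_integral_sq_uniformSphere_le [NeZero d] {h : E d → ℝ} {K : ℝ} (hK0 : 0 ≤ K)
    (hK : ∀ x y, |h x - h y| ≤ K * ‖x - y‖) (hodd : ∀ x, h (-x) = -h x) :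
    (d : ℝ) ^ 2 * ∫ u : Metric.sphere (0 : E d) 1, h u ^ 2 ∂(uniformSphere d) ≤
      8 / 5 * (d + 1) * K ^ 2 := by
  set A := ∫ u : Metric.sphere (0 : E d) 1, h u ^ 2 ∂(uniformSphere d) with hA
  have hH := abs_homogeneousExtension_sub_le hK0 hK hodd
  have hm : Measurable h := (lipschitzWith_of_abs_sub_le hK0 hK).continuous.measurable
  have hu : ∀ x : E d, h (‖x‖⁻¹ • x) ^ 2 ≤ K ^ 2 := by
    intro x
    rw [← sq_abs]
    gcongr
    refine (abs_le_of_odd_of_lipschitz hK hodd _).trans ?_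
    rcases eq_or_ne x 0 with rfl | hx
    · simpa using hK0
    · rw [norm_inv_norm_smul hx, mul_one]
  have h1 := integral_sq_stdGaussian_le_of_odd (mul_nonneg (by norm_num) hK0) hH
    (homogeneousExtension_neg hodd)
  have h2 : ∫ x, homogeneousExtension h x ^ 2 ∂(stdGaussian (E d)) = d * A := by
    have := integral_stdGaussian_norm_mul_direction (d := d) (fun r => r ^ 2) (fun x => h x ^ 2)
    rw [integral_norm_sq_stdGaussian] at this
    simpa only [homogeneousExtension, mul_pow] using this
  have hi : Integrable (fun x : E d => h (‖x‖⁻¹ • x) ^ 2) (stdGaussian (E d)) := by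
    refine Integrable.of_bound (C := K ^ 2) (Measurable.aestronglyMeasurable ?_)
      (.of_forall fun x => ?_)
    · exact (hm.comp (measurable_norm.inv.smul measurable_id)).pow_const 2
    · rw [Real.norm_of_nonneg (sq_nonneg _)]; exact hu x
  have h3 : ∫ x : E d, h (‖x‖⁻¹ • x) ^ 2 ∂(stdGaussian (E d)) = A := by
    have := integral_stdGaussian_norm_mul_direction (d := d) (fun _ => 1) (fun x => h x ^ 2)
    simpa using this
  have hne : ∀ᵐ x ∂(stdGaussian (E d)), x ≠ 0 :=
    stdGaussian_absolutelyContinuous.ae_le (Measure.ae_ne volume 0)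
  have hdf : ∀ᵐ x ∂(stdGaussian (E d)), DifferentiableAt ℝ (homogeneousExtension h) x :=
    stdGaussian_absolutelyContinuous.ae_le
      (lipschitzWith_of_abs_sub_le (mul_nonneg (by norm_num) hK0) hH).ae_differentiableAt
  have h4 : ∫ x, ‖gradient (homogeneousExtension h) x‖ ^ 2 ∂(stdGaussian (E d)) ≤ A + K ^ 2 := by
    have h5 : ∫ x : E d, (h (‖x‖⁻¹ • x) ^ 2 + K ^ 2) ∂(stdGaussian (E d)) = A + K ^ 2 := by
      rw [integral_add hi (integrable_const _), h3]; simp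
    rw [← h5]
    refine integral_mono_of_nonneg (.of_forall fun x => sq_nonneg _)
      (hi.add (integrable_const _)) ?_
    filter_upwards [hne, hdf] with x hx hx'
    exact norm_gradient_homogeneousExtension_sq_le hK0 hK hx hx'
  have hAK : A ≤ K ^ 2 := by
    rw [← h3]
    refine (integral_mono hi (integrable_const (K ^ 2)) hu).trans ?_
    simp
  have hA0 : 0 ≤ A := integral_nonneg fun _ => sq_nonneg _
  -- Poincaré for the homogeneous extension reads `d A ≤ (π²/8)(A + K²)`. This is useful only when
  -- `d > π²/8`; in dimensions one and two the trivial bound `A ≤ K²` suffices. The factor `8/5` is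
  -- chosen to cover all dimensions, `d = 3` being nearly tight.
  have hpi : Real.pi ^ 2 / 8 ≤ 1.2338 := by
    nlinarith [Real.pi_lt_d4, Real.pi_pos]
  have h6 : (d : ℝ) * A ≤ 1.2338 * (A + K ^ 2) := by
    rw [h2] at h1
    refine h1.trans (mul_le_mul hpi h4 (integral_nonneg fun _ => sq_nonneg _) (by norm_num))
  have hd1 : 1 ≤ d := NeZero.one_le
  have hK2 := sq_nonneg K
  rcases Nat.lt_or_ge d 3 with hd | hd
  · obtain h | h : (d : ℝ) = 1 ∨ (d : ℝ) = 2 := by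
      have : d = 1 ∨ d = 2 := by omega
      exact_mod_cast this
    all_goals rw [h]; linarith
  · have hd' : (3 : ℝ) ≤ d := by exact_mod_cast hd
    have h7 : A * (d - 1.2338) ≤ 1.2338 * K ^ 2 := by linarith
    have h8 : (d : ℝ) ^ 2 * 1.2338 ≤ 8 / 5 * (d + 1) * (d - 1.2338) := by nlinarith
    have h9 : (d : ℝ) ^ 2 * A * (d - 1.2338) ≤ 8 / 5 * (d + 1) * K ^ 2 * (d - 1.2338) := by
      calc (d : ℝ) ^ 2 * A * (d - 1.2338) = (d : ℝ) ^ 2 * (A * (d - 1.2338)) := by ring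
        _ ≤ (d : ℝ) ^ 2 * (1.2338 * K ^ 2) := by gcongr
        _ = (d : ℝ) ^ 2 * 1.2338 * K ^ 2 := by ring
        _ ≤ 8 / 5 * (d + 1) * (d - 1.2338) * K ^ 2 := by gcongr
        _ = _ := by ring
    exact le_of_mul_le_mul_right h9 (by linarith)

end Poincare

/-! ### The divergence theorem on the unit ball for Lipschitz functions -/

section Divergence

variable {d : ℕ}

/-- A Lipschitz cutoff which is `1` on the ball of radius `1 - ε` and `0` outside the unit ball. -/
def radialCutoff (ε : ℝ) (x : E d) : ℝ :=
  max 0 (min 1 ((1 - ‖x‖) / ε))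

theorem radialCutoff_nonneg (ε : ℝ) (x : E d) : 0 ≤ radialCutoff ε x := le_max_left _ _

theorem radialCutoff_le_one (ε : ℝ) (x : E d) : radialCutoff ε x ≤ 1 :=
  max_le zero_le_one (min_le_left _ _)

theorem radialCutoff_of_one_le {ε : ℝ} (hε : 0 < ε) {x : E d} (hx : 1 ≤ ‖x‖) :
    radialCutoff ε x = 0 :=
  max_eq_left ((min_le_right _ _).trans (div_nonpos_of_nonpos_of_nonneg (by linarith) hε.le))

theorem radialCutoff_of_le {ε : ℝ} (hε : 0 < ε) {x : E d} (hx : ‖x‖ ≤ 1 - ε) :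
    radialCutoff ε x = 1 := by
  have : 1 ≤ (1 - ‖x‖) / ε := by rw [le_div_iff₀ hε]; linarith
  rw [radialCutoff, min_eq_left this, max_eq_right zero_le_one]

theorem radialCutoff_of_mem {ε : ℝ} (hε : 0 < ε) {x : E d} (h1 : 1 - ε ≤ ‖x‖) (h2 : ‖x‖ ≤ 1) :
    radialCutoff ε x = (1 - ‖x‖) / ε := by
  have : (1 - ‖x‖) / ε ≤ 1 := by rw [div_le_one hε]; linarith
  rw [radialCutoff, min_eq_right this, max_eq_right (div_nonneg (by linarith) hε.le)]

theorem lipschitzWith_radialCutoff {ε : ℝ} (hε : 0 < ε) :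
    LipschitzWith (ε⁻¹).toNNReal (radialCutoff (d := d) ε) := by
  refine LipschitzWith.const_max (LipschitzWith.const_min ?_ _) _
  refine LipschitzWith.of_dist_le_mul fun x y => ?_
  rw [Real.coe_toNNReal _ (by positivity), Real.dist_eq, dist_eq_norm, ← sub_div, abs_div,
    abs_of_pos hε, div_eq_inv_mul]
  gcongr
  rw [sub_sub_sub_cancel_left, norm_sub_rev]
  exact abs_norm_sub_norm_le y x

theorem hasCompactSupport_radialCutoff {ε : ℝ} (hε : 0 < ε) :
    HasCompactSupport (radialCutoff (d := d) ε) := by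
  refine HasCompactSupport.of_support_subset_isCompact (isCompact_closedBall (0 : E d) 1) ?_
  intro x hx
  by_contra h
  rw [mem_closedBall_zero_iff, not_le] at h
  exact hx (radialCutoff_of_one_le hε h.le)

theorem hasDerivAt_norm_line {x : E d} (hx : x ≠ 0) (v : E d) :
    HasDerivAt (fun t : ℝ => ‖x + t • v‖) (inner ℝ (‖x‖⁻¹ • x) v) 0 := by
  have h1 : HasDerivAt (fun t : ℝ => x + t • v) v 0 := by
    simpa using ((hasDerivAt_id (0 : ℝ)).smul_const v).const_add x
  have h2 := h1.norm_sq
  have h3 := h2.sqrt (by simpa using hx)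
  simp only [zero_smul, add_zero, Real.sqrt_sq (norm_nonneg _)] at h3
  convert! h3 using 1
  rw [real_inner_smul_left]
  have := norm_ne_zero_iff.2 hx
  field_simp

/-- The derivative lives on the shell `1 - ε < ‖x‖ < 1`, where it is `1/ε` times the outer normal
component. The two excluded spheres are null sets. -/
theorem lineDeriv_radialCutoff {ε : ℝ} (hε : 0 < ε) (hε1 : ε < 1) {x : E d} (h1 : ‖x‖ ≠ 1)
    (h2 : ‖x‖ ≠ 1 - ε) (v : E d) :
    lineDeriv ℝ (radialCutoff ε) x (-v) =
      (Set.Ioo (1 - ε) 1).indicator (fun _ => ε⁻¹) ‖x‖ * inner ℝ (‖x‖⁻¹ • x) v := by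
  have hc : Tendsto (fun t : ℝ => ‖x + t • (-v)‖) (𝓝 0) (𝓝 ‖x‖) := by
    have : Continuous fun t : ℝ => ‖x + t • (-v)‖ := by fun_prop
    simpa using this.tendsto 0
  refine HasLineDerivAt.lineDeriv ?_
  unfold HasLineDerivAt
  rcases lt_or_gt_of_ne h1 with h1 | h1
  · rcases lt_or_gt_of_ne h2 with h2 | h2
    · rw [Set.indicator_of_notMem (fun h => h2.not_gt h.1), zero_mul]
      refine (hasDerivAt_const (0 : ℝ) (1 : ℝ)).congr_of_eventuallyEq ?_
      filter_upwards [hc.eventually (gt_mem_nhds h2)] with t ht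
      exact radialCutoff_of_le hε ht.le
    · rw [Set.indicator_of_mem (Set.mem_Ioo.2 ⟨h2, h1⟩)]
      have hx : x ≠ 0 := by
        rintro rfl; rw [norm_zero] at h2; linarith
      have h3 := ((hasDerivAt_norm_line hx (-v)).const_sub 1).div_const ε
      have h4 : HasDerivAt (fun t : ℝ => (1 - ‖x + t • (-v)‖) / ε)
          (ε⁻¹ * inner ℝ (‖x‖⁻¹ • x) v) 0 := by
        convert! h3 using 1
        rw [inner_neg_right, neg_neg, div_eq_inv_mul]
      refine h4.congr_of_eventuallyEq ?_
      filter_upwards [hc.eventually (gt_mem_nhds h1), hc.eventually (lt_mem_nhds h2)] with t ht ht'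
      exact radialCutoff_of_mem hε ht'.le ht.le
  · rw [Set.indicator_of_notMem (fun h => h1.not_gt h.2), zero_mul]
    refine (hasDerivAt_const (0 : ℝ) (0 : ℝ)).congr_of_eventuallyEq ?_
    filter_upwards [hc.eventually (lt_mem_nhds h1)] with t ht
    exact radialCutoff_of_one_le hε ht.le

theorem integral_lineDeriv_radialCutoff_mul [NeZero d] {f : E d → ℝ} (hf : Continuous f) {ε : ℝ}
    (hε : 0 < ε) (hε1 : ε < 1) (v : E d) :
    ∫ x, lineDeriv ℝ (radialCutoff ε) x (-v) * f x = ε⁻¹ * ∫ r in (1 - ε)..1,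
      r ^ (d - 1) * ∫ u : Metric.sphere (0 : E d) 1, f (r • u.1) * inner ℝ u.1 v
        ∂(volume : Measure (E d)).toSphere := by
  have hi : Integrable (fun x => lineDeriv ℝ (radialCutoff ε) x (-v) * f x) := by
    have hcb : IsCompact (Metric.closedBall (0 : E d) 1) := isCompact_closedBall _ _
    obtain ⟨B, hB⟩ := hcb.exists_bound_of_continuousOn hf.continuousOn
    have hmeas : AEStronglyMeasurable (fun x => lineDeriv ℝ (radialCutoff ε) x (-v) * f x) :=
      (aestronglyMeasurable_lineDeriv (lipschitzWith_radialCutoff hε).continuous _).mul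
        hf.aestronglyMeasurable
    have hbd : IntegrableOn (fun x => lineDeriv ℝ (radialCutoff ε) x (-v) * f x)
        (Metric.closedBall (0 : E d) 1) := by
      refine Measure.integrableOn_of_bounded (M := (ε⁻¹).toNNReal * ‖-v‖ * B)
        hcb.measure_lt_top.ne hmeas ?_
      filter_upwards [ae_restrict_mem measurableSet_closedBall] with x hx
      rw [norm_mul]
      exact mul_le_mul (norm_lineDeriv_le_of_lipschitz ℝ (lipschitzWith_radialCutoff hε)) (hB x hx)
        (norm_nonneg _) (by positivity)
    rw [← integrableOn_univ]
    refine hbd.of_forall_sdiff_eq_zero MeasurableSet.univ fun x hx => ?_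
    have hx1 : 1 < ‖x‖ := by simpa using hx
    rw [lineDeriv_radialCutoff hε hε1 hx1.ne' (by linarith),
      Set.indicator_of_notMem (fun h => hx1.not_gt h.2), zero_mul, zero_mul]
  set φ : E d → ℝ := fun x =>
    (Set.Ioo (1 - ε) 1).indicator (fun _ => ε⁻¹) ‖x‖ * inner ℝ (‖x‖⁻¹ • x) v * f x with hφ
  have hae : (fun x => lineDeriv ℝ (radialCutoff ε) x (-v) * f x) =ᵐ[volume] φ := by
    have hs : ∀ r : ℝ, r ≠ 0 → ∀ᵐ x : E d, ‖x‖ ≠ r := by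
      intro r hr
      have := Measure.addHaar_sphere_of_ne_zero (volume : Measure (E d)) 0 hr
      rw [measure_eq_zero_iff_ae_notMem] at this
      filter_upwards [this] with x hx
      simpa using hx
    filter_upwards [hs 1 one_ne_zero, hs (1 - ε) (by linarith)] with x h1 h2
    rw [lineDeriv_radialCutoff hε hε1 h1 h2]
  rw [integral_congr_ae hae, integral_eq_integral_Ioi_sphere (hi.congr hae),
    intervalIntegral.integral_of_le (by linarith), integral_Ioc_eq_integral_Ioo,
    ← integral_const_mul, ← integral_indicator measurableSet_Ioo,
    ← integral_indicator measurableSet_Ioi]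
  refine integral_congr_ae (.of_forall fun r => ?_)
  by_cases hr : r ∈ Set.Ioo (1 - ε) 1
  · have hr0 : 0 < r := by linarith [hr.1]
    rw [Set.indicator_of_mem hr, Set.indicator_of_mem (Set.mem_Ioi.2 hr0), mul_left_comm,
      ← integral_const_mul ε⁻¹]
    congr 1
    refine integral_congr_ae (.of_forall fun u => ?_)
    have hn : ‖r • (u.1 : E d)‖ = r := by
      rw [norm_smul, Real.norm_of_nonneg hr0.le, norm_eq_of_mem_sphere, mul_one]
    simp only [hφ, hn, Set.indicator_of_mem hr, smul_smul, inv_mul_cancel₀ hr0.ne', one_smul]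
    ring
  · rw [Set.indicator_of_notMem hr]
    by_cases hr0 : 0 < r
    · rw [Set.indicator_of_mem (Set.mem_Ioi.2 hr0)]
      have : ∀ u : Metric.sphere (0 : E d) 1, φ (r • u.1) = 0 := by
        intro u
        have hn : ‖r • (u.1 : E d)‖ = r := by
          rw [norm_smul, Real.norm_of_nonneg hr0.le, norm_eq_of_mem_sphere, mul_one]
        simp only [hφ, hn, Set.indicator_of_notMem hr, zero_mul]
      simp [this]
    · rw [Set.indicator_of_notMem (by simpa using hr0)]

/-- The divergence theorem on the unit ball, tested against a fixed direction. -/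
theorem setIntegral_ball_lineDeriv [NeZero d] {f : E d → ℝ} {K : NNReal} (hf : LipschitzWith K f)
    (v : E d) :
    ∫ x in Metric.ball (0 : E d) 1, lineDeriv ℝ f x v =
      ∫ u : Metric.sphere (0 : E d) 1, f u.1 * inner ℝ u.1 v
        ∂(volume : Measure (E d)).toSphere := by
  set B : ℝ → ℝ := fun r => ∫ u : Metric.sphere (0 : E d) 1, f (r • u.1) * inner ℝ u.1 v
    ∂(volume : Measure (E d)).toSphere with hB
  have hfc := hf.continuous
  have hBc : Continuous B := by
    have h1 : Continuous fun q : ℝ × Metric.sphere (0 : E d) 1 =>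
        f (q.1 • q.2.1) * inner ℝ q.2.1 v := by fun_prop
    have := continuous_parametric_integral_of_continuous
      (μ := (volume : Measure (E d)).toSphere)
      (f := fun (r : ℝ) (u : Metric.sphere (0 : E d) 1) => f (r • u.1) * inner ℝ u.1 v)
      h1 isCompact_univ
    simpa only [Measure.restrict_univ] using this
  have hψc : Continuous fun r : ℝ => r ^ (d - 1) * B r := by fun_prop
  -- Boundary side: the shell average is a left difference quotient at `r = 1` and tends to the
  -- integral over the unit sphere.
  have hlim1 : Tendsto (fun ε : ℝ => ε⁻¹ * ∫ r in (1 - ε)..1, r ^ (d - 1) * B r) (𝓝[>] 0)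
      (𝓝 (B 1)) := by
    have h1 : HasDerivAt (fun t => ∫ r in (1 : ℝ)..t, r ^ (d - 1) * B r) (1 ^ (d - 1) * B 1) 1 :=
      intervalIntegral.integral_hasDerivAt_right (hψc.intervalIntegrable _ _)
        (hψc.stronglyMeasurableAtFilter _ _) hψc.continuousAt
    have h2 := h1.tendsto_slope_zero_left
    rw [one_pow, one_mul] at h2
    have h3 : Tendsto (fun ε : ℝ => -ε) (𝓝[>] 0) (𝓝[<] 0) := by
      have := tendsto_neg_nhdsGT (a := (0 : ℝ))
      rwa [neg_zero] at this
    refine (h2.comp h3).congr fun ε => ?_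
    simp only [Function.comp_apply, intervalIntegral.integral_same, sub_zero, smul_eq_mul,
      ← sub_eq_add_neg]
    rw [intervalIntegral.integral_symm, inv_neg, neg_mul_neg]
  -- Interior side: the cutoffs increase to the indicator of the open ball. Integration by parts
  -- makes the two sides equal for every `ε` in `(0, 1)`.
  have hlim2 : Tendsto (fun ε : ℝ => ∫ x, lineDeriv ℝ f x v * radialCutoff ε x) (𝓝[>] 0)
      (𝓝 (∫ x, (Metric.ball (0 : E d) 1).indicator (fun x => lineDeriv ℝ f x v) x)) := by
    refine tendsto_integral_filter_of_dominated_convergence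
      ((Metric.closedBall (0 : E d) 1).indicator fun _ => K * ‖v‖) ?_ ?_ ?_ ?_
    · filter_upwards [self_mem_nhdsWithin] with ε (hε : 0 < ε)
      exact (aestronglyMeasurable_lineDeriv hfc _).mul
        (lipschitzWith_radialCutoff hε).continuous.aestronglyMeasurable
    · filter_upwards [self_mem_nhdsWithin] with ε (hε : 0 < ε)
      refine .of_forall fun x => ?_
      rw [norm_mul, Real.norm_of_nonneg (radialCutoff_nonneg _ _)]
      by_cases hx : x ∈ Metric.closedBall (0 : E d) 1
      · rw [Set.indicator_of_mem hx]
        calc _ ≤ (K * ‖v‖) * 1 := mul_le_mul (norm_lineDeriv_le_of_lipschitz ℝ hf)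
              (radialCutoff_le_one _ _) (radialCutoff_nonneg _ _) (by positivity)
          _ = _ := mul_one _
      · rw [Set.indicator_of_notMem hx, radialCutoff_of_one_le hε
          (le_of_lt (by simpa using hx)), mul_zero]
    · rw [integrable_indicator_iff measurableSet_closedBall]
      exact integrableOn_const (isCompact_closedBall _ _).measure_lt_top.ne
    · refine .of_forall fun x => ?_
      by_cases hx : x ∈ Metric.ball (0 : E d) 1
      · rw [Set.indicator_of_mem hx]
        rw [mem_ball_zero_iff] at hx
        refine tendsto_const_nhds.congr' ?_
        filter_upwards [self_mem_nhdsWithin, mem_nhdsWithin_of_mem_nhds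
          (gt_mem_nhds (sub_pos.2 hx))] with ε (hε : 0 < ε) (hε' : ε < 1 - ‖x‖)
        rw [radialCutoff_of_le hε (by linarith), mul_one]
      · rw [Set.indicator_of_notMem hx]
        refine tendsto_const_nhds.congr' ?_
        filter_upwards [self_mem_nhdsWithin] with ε (hε : 0 < ε)
        rw [radialCutoff_of_one_le hε (by simpa using hx), mul_zero]
  rw [integral_indicator measurableSet_ball] at hlim2
  have hB1 : B 1 = ∫ u : Metric.sphere (0 : E d) 1, f u.1 * inner ℝ u.1 v
      ∂(volume : Measure (E d)).toSphere := by simp only [hB, one_smul]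
  rw [← hB1]
  refine tendsto_nhds_unique hlim2 (hlim1.congr' ?_)
  filter_upwards [self_mem_nhdsWithin, mem_nhdsWithin_of_mem_nhds
    (gt_mem_nhds (zero_lt_one' ℝ))] with ε (hε : 0 < ε) (hε' : ε < 1)
  rw [← integral_lineDeriv_radialCutoff_mul hfc hε hε',
    hf.integral_lineDeriv_mul_eq (lipschitzWith_radialCutoff hε)
      (hasCompactSupport_radialCutoff hε)]

/-- The uniform distribution on the open unit ball. -/
def uniformBall (d : ℕ) : Measure (E d) :=
  ((volume : Measure (E d)) (Metric.ball 0 1))⁻¹ • volume.restrict (Metric.ball 0 1)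

instance : IsProbabilityMeasure (uniformBall d) := by
  refine ⟨?_⟩
  rw [uniformBall, Measure.smul_apply, Measure.restrict_apply_univ, smul_eq_mul]
  exact ENNReal.inv_mul_cancel (Metric.measure_ball_pos _ _ one_pos).ne' measure_ball_lt_top.ne

theorem integral_uniformBall {V : Type*} [NormedAddCommGroup V] [NormedSpace ℝ V] (q : E d → V) :
    ∫ x, q x ∂(uniformBall d) = ((volume : Measure (E d)).real (Metric.ball 0 1))⁻¹ •
      ∫ x in Metric.ball (0 : E d) 1, q x := by
  rw [uniformBall, integral_smul_measure, ENNReal.toReal_inv]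
  rfl

theorem ae_uniformBall_mem : ∀ᵐ x ∂(uniformBall d), ‖x‖ ≤ 1 := by
  rw [uniformBall]
  refine Measure.ae_smul_measure ?_ _
  filter_upwards [ae_restrict_mem measurableSet_ball] with x hx
  exact (mem_ball_zero_iff.1 hx).le

theorem uniformBall_absolutelyContinuous : uniformBall d ≪ (volume : Measure (E d)) :=
  Measure.AbsolutelyContinuous.smul_left Measure.absolutelyContinuous_restrict _

theorem map_neg_uniformBall : (uniformBall d).map (fun x => -x) = uniformBall d := by
  have h : MeasurePreserving (fun x : E d => -x) (volume.restrict (Metric.ball 0 1))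
      (volume.restrict (Metric.ball 0 1)) := by
    have := (Measure.measurePreserving_neg (volume : Measure (E d))).restrict_preimage
      (s := Metric.ball 0 1) measurableSet_ball
    simpa using this
  rw [uniformBall, Measure.map_smul, h.map_eq]

/-- The divergence theorem on the unit ball. -/
theorem integral_uniformSphere_eq_integral_gradient [NeZero d] {f : E d → ℝ} {K : ℝ} (hK0 : 0 ≤ K)
    (hK : ∀ x y, |f x - f y| ≤ K * ‖x - y‖) (v : E d) :
    d * ∫ u : Metric.sphere (0 : E d) 1, f u.1 * inner ℝ u.1 v ∂(uniformSphere d) =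
      ∫ x, inner ℝ (gradient f x) v ∂(uniformBall d) := by
  have hf := lipschitzWith_of_abs_sub_le hK0 hK
  have h1 : ∫ x, inner ℝ (gradient f x) v ∂(uniformBall d) =
      ∫ x, lineDeriv ℝ f x v ∂(uniformBall d) := by
    refine integral_congr_ae ?_
    filter_upwards [uniformBall_absolutelyContinuous.ae_le hf.ae_differentiableAt] with x hx
    rw [hx.lineDeriv_eq_fderiv, hx.hasGradientAt.hasFDerivAt.fderiv,
      InnerProductSpace.toDual_apply_apply]
  -- The factor `d` arises from normalization: the surface measure has total mass `d` times the
  -- volume of the ball.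
  rw [h1, integral_uniformBall, setIntegral_ball_lineDeriv hf, integral_uniformSphere,
    Measure.toSphere_real_apply_univ, finrank_euclideanSpace_fin, smul_eq_mul, smul_eq_mul,
    mul_inv]
  have : (d : ℝ) ≠ 0 := NeZero.ne _
  field_simp

end Divergence

/-! ### Randomized smoothing -/

section Smoothing

variable {d : ℕ}

/-- The average of `f` over the ball of radius `ρ` around `w`. -/
def smoothed (f : E d → ℝ) (ρ : ℝ) (w : E d) : ℝ :=
  ∫ x, f (w + ρ • x) ∂(uniformBall d)

/-- The average of the gradient of `f` over the ball of radius `ρ` around `w`. -/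
def smoothedGradient (f : E d → ℝ) (ρ : ℝ) (w : E d) : E d :=
  ∫ x, gradient f (w + ρ • x) ∂(uniformBall d)

variable {f : E d → ℝ} {K ρ : ℝ}

theorem integrable_gradient_shift (hK0 : 0 ≤ K) (hK : ∀ x y, |f x - f y| ≤ K * ‖x - y‖) (w : E d) :
    Integrable (fun x => gradient f (w + ρ • x)) (uniformBall d) := by
  refine Integrable.of_bound (C := K) (Measurable.aestronglyMeasurable ?_)
    (.of_forall fun x => norm_gradient_le hK0 hK _)
  exact (measurable_gradient f).comp (by fun_prop)

theorem norm_smoothedGradient_le (hK0 : 0 ≤ K) (hK : ∀ x y, |f x - f y| ≤ K * ‖x - y‖) (w : E d) :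
    ‖smoothedGradient f ρ w‖ ≤ K := by
  refine (norm_integral_le_of_norm_le_const (C := K)
    (.of_forall fun x => norm_gradient_le hK0 hK _)).trans ?_
  simp

theorem integrable_shift (hK0 : 0 ≤ K) (hK : ∀ x y, |f x - f y| ≤ K * ‖x - y‖) (w : E d) :
    Integrable (fun x => f (w + ρ • x)) (uniformBall d) := by
  have hc := (lipschitzWith_of_abs_sub_le hK0 hK).continuous
  refine Integrable.of_bound (C := |f w| + K * |ρ|)
    (hc.comp (by fun_prop : Continuous fun x => w + ρ • x)).aestronglyMeasurable ?_
  filter_upwards [ae_uniformBall_mem] with x hx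
  have h1 := hK (w + ρ • x) w
  rw [add_sub_cancel_left, norm_smul, Real.norm_eq_abs] at h1
  have h2 : |f (w + ρ • x)| ≤ |f w| + |f (w + ρ • x) - f w| := by
    have := abs_add_le (f w) (f (w + ρ • x) - f w)
    rwa [add_sub_cancel] at this
  rw [Real.norm_eq_abs]
  have h3 : K * (|ρ| * ‖x‖) ≤ K * |ρ| := by
    have : |ρ| * ‖x‖ ≤ |ρ| := mul_le_of_le_one_right (abs_nonneg _) hx
    exact mul_le_mul_of_nonneg_left this hK0
  linarith

theorem abs_smoothed_sub_le (hK0 : 0 ≤ K) (hρ : 0 ≤ ρ) (hK : ∀ x y, |f x - f y| ≤ K * ‖x - y‖)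
    (w : E d) : |smoothed f ρ w - f w| ≤ K * ρ := by
  have h1 : smoothed f ρ w - f w = ∫ x, (f (w + ρ • x) - f w) ∂(uniformBall d) := by
    rw [integral_sub (integrable_shift hK0 hK w) (integrable_const _), smoothed]; simp
  rw [h1, ← Real.norm_eq_abs]
  refine (norm_integral_le_of_norm_le_const (C := K * ρ) ?_).trans ?_
  · filter_upwards [ae_uniformBall_mem] with x hx
    refine (hK _ _).trans ?_
    rw [add_sub_cancel_left, norm_smul, Real.norm_of_nonneg hρ]
    exact mul_le_mul_of_nonneg_left (mul_le_of_le_one_right hρ hx) hK0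
  · simp

theorem quasiMeasurePreserving_shift (hρ : ρ ≠ 0) (w : E d) :
    Measure.QuasiMeasurePreserving (fun x : E d => w + ρ • x) volume volume := by
  refine ⟨by fun_prop, ?_⟩
  have h1 : (fun x : E d => w + ρ • x) = (fun x => w + x) ∘ (fun x => ρ • x) := rfl
  rw [h1, ← Measure.map_map (by fun_prop) (by fun_prop), Measure.map_addHaar_smul volume hρ]
  rw [Measure.map_smul, map_add_left_eq_self]
  exact Measure.AbsolutelyContinuous.smul_left Measure.AbsolutelyContinuous.rfl _

theorem ae_differentiableAt_shift (hK0 : 0 ≤ K) (hρ : ρ ≠ 0)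
    (hK : ∀ x y, |f x - f y| ≤ K * ‖x - y‖) (w : E d) :
    ∀ᵐ x ∂(uniformBall d), DifferentiableAt ℝ f (w + ρ • x) :=
  uniformBall_absolutelyContinuous.ae_le ((quasiMeasurePreserving_shift hρ w).ae
    (lipschitzWith_of_abs_sub_le hK0 hK).ae_differentiableAt)

/-- Differentiation under the integral with the Lipschitz constant as dominating function; for fixed
`w`, almost every shifted point is a point of differentiability. -/
theorem hasGradientAt_smoothed (hK0 : 0 ≤ K) (hρ : ρ ≠ 0)
    (hK : ∀ x y, |f x - f y| ≤ K * ‖x - y‖) (w : E d) :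
    HasGradientAt (smoothed f ρ) (smoothedGradient f ρ w) w := by
  have hc := (lipschitzWith_of_abs_sub_le hK0 hK).continuous
  have h := hasFDerivAt_integral_of_dominated_loc_of_lip (𝕜 := ℝ) (μ := uniformBall d)
    (F := fun w x => f (w + ρ • x)) (x₀ := w) (bound := fun _ => K) (s := Set.univ)
    (F' := fun x => InnerProductSpace.toDual ℝ (E d) (gradient f (w + ρ • x)))
    univ_mem
    (.of_forall fun w => (integrable_shift hK0 hK w).aestronglyMeasurable)
    (integrable_shift hK0 hK w)
    ((InnerProductSpace.toDual ℝ (E d)).continuous.comp_aestronglyMeasurable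
      (integrable_gradient_shift hK0 hK w).aestronglyMeasurable)
    (.of_forall fun x => by
      refine LipschitzOnWith.of_dist_le_mul fun y _ z _ => ?_
      rw [Real.dist_eq, dist_eq_norm, Real.coe_nnabs, abs_of_nonneg hK0]
      have := hK (y + ρ • x) (z + ρ • x)
      rwa [add_sub_add_right_eq_sub] at this)
    (integrable_const _)
    (by
      filter_upwards [ae_differentiableAt_shift hK0 hρ hK w] with x hx
      exact (hasFDerivAt_comp_add_right (ρ • x)).2 hx.hasGradientAt.hasFDerivAt)
  have h2 : ∫ x, InnerProductSpace.toDual ℝ (E d) (gradient f (w + ρ • x)) ∂(uniformBall d) =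
      InnerProductSpace.toDual ℝ (E d) (smoothedGradient f ρ w) :=
    (InnerProductSpace.toDual ℝ (E d)).toContinuousLinearEquiv.integral_comp_comm _
  rw [h2] at h
  exact h.2

theorem hasGradientAt_comp_shift (w x : E d)
    (hf : DifferentiableAt ℝ f (w + ρ • x)) :
    HasGradientAt (fun x => f (w + ρ • x)) (ρ • gradient f (w + ρ • x)) x := by
  have h1 : HasFDerivAt (fun x : E d => w + ρ • x) (ρ • ContinuousLinearMap.id ℝ (E d)) x :=
    ((hasFDerivAt_id x).const_smul ρ).const_add w
  have h2 := HasFDerivAt.comp x hf.hasGradientAt.hasFDerivAt h1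
  rw [hasGradientAt_iff_hasFDerivAt]
  convert! h2 using 1
  ext y
  simp

/-- The two-point formula for the gradient of the smoothed function. -/
theorem integral_two_point [NeZero d] (hK0 : 0 ≤ K) (hρ : 0 < ρ)
    (hK : ∀ x y, |f x - f y| ≤ K * ‖x - y‖) (w : E d) :
    ∫ u : Metric.sphere (0 : E d) 1,
      ((d : ℝ) / (2 * ρ) * (f (w + ρ • u.1) - f (w - ρ • u.1))) • u.1 ∂(uniformSphere d) =
      smoothedGradient f ρ w := by
  have hc := (lipschitzWith_of_abs_sub_le hK0 hK).continuous
  have hL : ∀ r : ℝ, |r| = ρ → ∀ x y : E d,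
      |f (w + r • x) - f (w + r • y)| ≤ K * ρ * ‖x - y‖ := by
    intro r hr x y
    refine (hK _ _).trans_eq ?_
    rw [add_sub_add_left_eq_sub, ← smul_sub, norm_smul, Real.norm_eq_abs, hr, mul_assoc]
  have hint : ∀ q : Metric.sphere (0 : E d) 1 → ℝ, Continuous q →
      Integrable q (uniformSphere d) := by
    intro q hq
    obtain ⟨B, hB⟩ := isCompact_univ.exists_bound_of_continuousOn hq.continuousOn
    exact Integrable.of_bound hq.aestronglyMeasurable B (.of_forall fun u => hB u (Set.mem_univ _))
  have hside : ∀ (r : ℝ), |r| = ρ → ∀ v : E d,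
      d * ∫ u : Metric.sphere (0 : E d) 1, f (w + r • u.1) * inner ℝ u.1 v ∂(uniformSphere d) =
        r * ∫ x, inner ℝ (gradient f (w + r • x)) v ∂(uniformBall d) := by
    intro r hr v
    have hr0 : r ≠ 0 := by rintro rfl; simp at hr; linarith
    rw [integral_uniformSphere_eq_integral_gradient (f := fun x => f (w + r • x))
      (mul_nonneg hK0 hρ.le) (hL r hr), ← integral_const_mul]
    refine integral_congr_ae ?_
    filter_upwards [ae_differentiableAt_shift hK0 hr0 hK w] with x hx
    rw [(hasGradientAt_comp_shift w x hx).gradient, real_inner_smul_left]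
  -- By symmetry of the ball the `+ρ` and `-ρ` halves contribute the same amount, which the factor
  -- `1/(2ρ)` averages.
  have hsymm : ∀ v : E d, ∫ x, inner ℝ (gradient f (w + (-ρ) • x)) v ∂(uniformBall d) =
      ∫ x, inner ℝ (gradient f (w + ρ • x)) v ∂(uniformBall d) := by
    intro v
    conv_rhs => rw [← map_neg_uniformBall]
    rw [integral_map (by fun_prop)]
    · simp
    · refine Measurable.aestronglyMeasurable ?_
      exact ((measurable_gradient f).comp (by fun_prop)).inner measurable_const
  refine ext_inner_right ℝ fun v => ?_
  have hvi : Integrable (fun u : Metric.sphere (0 : E d) 1 =>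
      ((d : ℝ) / (2 * ρ) * (f (w + ρ • u.1) - f (w - ρ • u.1))) • u.1) (uniformSphere d) := by
    have hq : Continuous fun u : Metric.sphere (0 : E d) 1 =>
      ((d : ℝ) / (2 * ρ) * (f (w + ρ • u.1) - f (w - ρ • u.1))) • u.1 := by fun_prop
    obtain ⟨B, hB⟩ := isCompact_univ.exists_bound_of_continuousOn hq.continuousOn
    exact Integrable.of_bound hq.aestronglyMeasurable B (.of_forall fun u => hB u (Set.mem_univ _))
  rw [real_inner_comm, ← integral_inner hvi, smoothedGradient, real_inner_comm,
    ← integral_inner (integrable_gradient_shift hK0 hK w)]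
  have h1 := hside ρ (abs_of_pos hρ) v
  have h2 := hside (-ρ) (by rw [abs_neg, abs_of_pos hρ]) v
  rw [hsymm] at h2
  have h3 : ∀ u : Metric.sphere (0 : E d) 1,
      inner ℝ v (((d : ℝ) / (2 * ρ) * (f (w + ρ • u.1) - f (w - ρ • u.1))) • u.1) =
      (2 * ρ)⁻¹ * (d * (f (w + ρ • u.1) * inner ℝ u.1 v) -
        d * (f (w + (-ρ) • u.1) * inner ℝ u.1 v)) := by
    intro u
    rw [inner_smul_right, real_inner_comm, neg_smul, ← sub_eq_add_neg]; ring
  simp_rw [h3]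
  rw [integral_const_mul, integral_sub, integral_const_mul, integral_const_mul, h1, h2]
  · simp_rw [real_inner_comm v]
    field_simp
    ring
  · exact (hint _ (by fun_prop)).const_mul _
  · exact (hint _ (by fun_prop)).const_mul _

/-- The gradient of `f` need not be continuous, but the two-point formula rewrites its average as
the integral of a continuous function over the compact sphere. -/
theorem continuous_smoothedGradient [NeZero d] (hK0 : 0 ≤ K) (hρ : 0 < ρ)
    (hK : ∀ x y, |f x - f y| ≤ K * ‖x - y‖) : Continuous (smoothedGradient f ρ) := by
  have hc := (lipschitzWith_of_abs_sub_le hK0 hK).continuous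
  have h1 : Continuous fun q : E d × Metric.sphere (0 : E d) 1 =>
      ((d : ℝ) / (2 * ρ) * (f (q.1 + ρ • q.2.1) - f (q.1 - ρ • q.2.1))) • q.2.1 := by fun_prop
  have := continuous_parametric_integral_of_continuous (μ := uniformSphere d)
    (f := fun (w : E d) (u : Metric.sphere (0 : E d) 1) =>
      ((d : ℝ) / (2 * ρ) * (f (w + ρ • u.1) - f (w - ρ • u.1))) • u.1) h1 isCompact_univ
  simp only [Measure.restrict_univ] at this
  simpa only [integral_two_point hK0 hρ hK] using this

theorem integral_inner_smoothedGradient [NeZero d] (hK0 : 0 ≤ K) (hρ : 0 < ρ)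
    (hK : ∀ x y, |f x - f y| ≤ K * ‖x - y‖) (x v : E d) :
    ∫ t in (0 : ℝ)..1, inner ℝ (smoothedGradient f ρ (x + t • v)) v =
      smoothed f ρ (x + v) - smoothed f ρ x := by
  have hG := continuous_smoothedGradient hK0 hρ hK
  have h1 : ∀ t ∈ Set.uIcc (0 : ℝ) 1, HasDerivAt (fun t : ℝ => smoothed f ρ (x + t • v))
      (inner ℝ (smoothedGradient f ρ (x + t • v)) v) t := by
    intro t _
    have h2 : HasDerivAt (fun t : ℝ => x + t • v) v t := by
      simpa using ((hasDerivAt_id t).smul_const v).const_add x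
    have h3 := HasFDerivAt.comp_hasDerivAt (f := fun t : ℝ => x + t • v) t
      (hasGradientAt_smoothed hK0 hρ.ne' hK (x + t • v)).hasFDerivAt h2
    rw [InnerProductSpace.toDual_apply_apply] at h3
    exact h3
  rw [intervalIntegral.integral_eq_sub_of_hasDerivAt h1]
  · simp
  · exact Continuous.intervalIntegrable (by fun_prop) _ _

end Smoothing

/-! ### Clarke and Goldstein subdifferentials of Lipschitz functions -/

section Subdifferential

variable {d : ℕ} {f : E d → ℝ} {K : ℝ}

theorem eventually_abs_quotient_le (hK : ∀ x y, |f x - f y| ≤ K * ‖x - y‖) (x v : E d) :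
    ∀ᶠ q : E d × ℝ in 𝓝 x ×ˢ 𝓝[>] (0 : ℝ), |(f (q.1 + q.2 • v) - f q.1) / q.2| ≤ K * ‖v‖ := by
  have h : ∀ᶠ q : E d × ℝ in 𝓝 x ×ˢ 𝓝[>] (0 : ℝ), 0 < q.2 :=
    tendsto_snd.eventually self_mem_nhdsWithin
  filter_upwards [h] with q hq
  have h1 := hK (q.1 + q.2 • v) q.1
  rw [add_sub_cancel_left, norm_smul, Real.norm_of_nonneg hq.le] at h1
  rw [abs_div, abs_of_pos hq, div_le_iff₀ hq]
  linarith

theorem isBoundedUnder_quotient (hK : ∀ x y, |f x - f y| ≤ K * ‖x - y‖) (x v : E d) :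
    IsBoundedUnder (· ≤ ·) (𝓝 x ×ˢ 𝓝[>] (0 : ℝ))
      (fun q : E d × ℝ => (f (q.1 + q.2 • v) - f q.1) / q.2) :=
  ⟨K * ‖v‖, eventually_map.2 ((eventually_abs_quotient_le hK x v).mono
    fun _ h => (le_abs_self _).trans h)⟩

theorem isCoboundedUnder_quotient (hK : ∀ x y, |f x - f y| ≤ K * ‖x - y‖) (x v : E d)
    {l : Filter (E d × ℝ)} [l.NeBot] (hl : l ≤ 𝓝 x ×ˢ 𝓝[>] (0 : ℝ)) :
    IsCoboundedUnder (· ≤ ·) l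
      (fun q : E d × ℝ => (f (q.1 + q.2 • v) - f q.1) / q.2) := by
  refine IsBoundedUnder.isCoboundedUnder_le (u := fun q : E d × ℝ =>
    (f (q.1 + q.2 • v) - f q.1) / q.2) ⟨-(K * ‖v‖), eventually_map.2 ?_⟩
  exact ((eventually_abs_quotient_le hK x v).filter_mono hl).mono fun _ h => (abs_le.1 h).1

theorem clarkeDeriv_le (hK : ∀ x y, |f x - f y| ≤ K * ‖x - y‖) (x v : E d) :
    clarkeDeriv f x v ≤ K * ‖v‖ :=
  limsup_le_of_le (isCoboundedUnder_quotient hK x v le_rfl)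
    ((eventually_abs_quotient_le hK x v).mono fun _ h => (le_abs_self _).trans h)

/-- Test the defining inequality in the direction `v = g`. -/
theorem norm_le_of_mem_clarkeSubdiff (hK0 : 0 ≤ K) (hK : ∀ x y, |f x - f y| ≤ K * ‖x - y‖)
    {x g : E d} (hg : g ∈ clarkeSubdiff f x) : ‖g‖ ≤ K := by
  have h1 := (hg g).trans (clarkeDeriv_le hK x g)
  rw [real_inner_self_eq_norm_sq, sq] at h1
  rcases (norm_nonneg g).eq_or_lt with h | h
  · rw [← h]; exact hK0
  · exact le_of_mul_le_mul_right h1 h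

/-- The ordinary directional derivative is the limit with base point frozen at `x`; the Clarke
limsup runs over a larger filter. -/
theorem gradient_mem_clarkeSubdiff (hK : ∀ x y, |f x - f y| ≤ K * ‖x - y‖) {x : E d}
    (hx : DifferentiableAt ℝ f x) : gradient f x ∈ clarkeSubdiff f x := by
  intro v
  have hl : (pure x ×ˢ 𝓝[>] (0 : ℝ) : Filter (E d × ℝ)) ≤ 𝓝 x ×ˢ 𝓝[>] (0 : ℝ) :=
    prod_mono_left _ (pure_le_nhds x)
  have h1 : HasDerivAt (fun t : ℝ => f (x + t • v)) (inner ℝ (gradient f x) v) 0 := by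
    have h2 : HasDerivAt (fun t : ℝ => x + t • v) v 0 := by
      simpa using ((hasDerivAt_id (0 : ℝ)).smul_const v).const_add x
    have hx' : HasFDerivAt f (InnerProductSpace.toDual ℝ (E d) (gradient f x))
        ((fun t : ℝ => x + t • v) 0) := by
      simp only [zero_smul, add_zero]; exact hx.hasGradientAt.hasFDerivAt
    have h3 := HasFDerivAt.comp_hasDerivAt (0 : ℝ) hx' h2
    rw [InnerProductSpace.toDual_apply_apply] at h3
    exact h3
  have h2 : Tendsto (fun q : E d × ℝ => (f (q.1 + q.2 • v) - f q.1) / q.2)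
      (pure x ×ˢ 𝓝[>] (0 : ℝ)) (𝓝 (inner ℝ (gradient f x) v)) := by
    rw [pure_prod, tendsto_map'_iff]
    refine h1.tendsto_slope_zero_right.congr fun t => ?_
    simp [div_eq_inv_mul]
  rw [← h2.limsup_eq]
  exact limsup_le_limsup_of_le hl (isCoboundedUnder_quotient hK x v hl)
    (isBoundedUnder_quotient hK x v)

theorem upperSemicontinuous_clarkeDeriv (hK : ∀ x y, |f x - f y| ≤ K * ‖x - y‖) (v : E d) :
    UpperSemicontinuous fun x => clarkeDeriv f x v := by
  intro x c hc
  obtain ⟨c', hc1, hc2⟩ := exists_between hc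
  have h1 : ∀ᶠ q : E d × ℝ in 𝓝 x ×ˢ 𝓝[>] (0 : ℝ), (f (q.1 + q.2 • v) - f q.1) / q.2 < c' :=
    eventually_lt_of_limsup_lt hc1 (isBoundedUnder_quotient hK x v)
  obtain ⟨pa, hpa, pb, hpb, h2⟩ := eventually_prod_iff.1 h1
  filter_upwards [eventually_eventually_nhds.2 hpa] with y hy
  refine lt_of_le_of_lt (limsup_le_of_le (isCoboundedUnder_quotient hK y v le_rfl) ?_) hc2
  exact (hy.prod_mk hpb).mono fun q hq => (h2 hq.1 hq.2).le

/-- For each direction, upper semicontinuity of the Clarke derivative in the base point makes the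
defining inequality a closed condition. -/
theorem isClosed_clarkeGraph (hK : ∀ x y, |f x - f y| ≤ K * ‖x - y‖) :
    IsClosed {q : E d × E d | q.2 ∈ clarkeSubdiff f q.1} := by
  have h : {q : E d × E d | q.2 ∈ clarkeSubdiff f q.1} =
      ⋂ v : E d, {q : E d × E d | inner ℝ q.2 v ≤ clarkeDeriv f q.1 v} := by
    ext q; simp [clarkeSubdiff]
  rw [h]
  refine isClosed_iInter fun v => ?_
  have hu : UpperSemicontinuous fun q : E d × E d => clarkeDeriv f q.1 v - inner ℝ q.2 v := by
    have h1 : UpperSemicontinuous fun q : E d × E d => clarkeDeriv f q.1 v :=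
      fun q c hc => (continuous_fst.tendsto q).eventually
        (upperSemicontinuous_clarkeDeriv hK v q.1 c hc)
    have h2 : Continuous fun q : E d × E d => -inner ℝ q.2 v := by fun_prop
    simpa only [sub_eq_add_neg] using h1.add h2.upperSemicontinuous
  have := hu.isClosed_preimage 0
  convert! this using 1
  ext q
  simp

/-- The directions and subgradients, and the weights, of a convex combination. -/
abbrev CombinationData (d : ℕ) (K : ℝ) (m : ℕ) : Type :=
  (Fin m → Metric.closedBall (0 : E d) 1 × Metric.closedBall (0 : E d) K) × stdSimplex ℝ (Fin m)

/-- A convex combination of `m` Clarke subgradients at points `δ`-close to `x`, of norm at most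
`c`. -/
def HasSmallCombination (f : E d → ℝ) (K δ c : ℝ) (m : ℕ) (x : E d) : Prop :=
  ∃ q : CombinationData d K m,
    (∀ i, (q.1 i).2.1 ∈ clarkeSubdiff f (x + δ • (q.1 i).1.1)) ∧
      ‖∑ i, q.2.1 i • (q.1 i).2.1‖ ≤ c

/-- The set is the projection of a closed set along a compact factor. Offsets are rescaled to the
unit ball so that this factor does not depend on `x`. -/
theorem isClosed_hasSmallCombination (hK : ∀ x y, |f x - f y| ≤ K * ‖x - y‖) (δ c : ℝ) (m : ℕ) :
    IsClosed {x | HasSmallCombination f K δ c m x} := by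
  have : CompactSpace (stdSimplex ℝ (Fin m)) :=
    isCompact_iff_compactSpace.1 (isCompact_stdSimplex ℝ (Fin m))
  have hb : ∀ r : ℝ, CompactSpace (Metric.closedBall (0 : E d) r) := fun r =>
    isCompact_iff_compactSpace.1 (isCompact_closedBall _ _)
  have := hb 1
  have := hb K
  have hS : IsClosed {r : E d × CombinationData d K m |
      (∀ i, (r.2.1 i).2.1 ∈ clarkeSubdiff f (r.1 + δ • (r.2.1 i).1.1)) ∧
        ‖∑ i, r.2.2.1 i • (r.2.1 i).2.1‖ ≤ c} := by
    have h1 : IsClosed {r : E d × CombinationData d K m |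
        ∀ i, (r.2.1 i).2.1 ∈ clarkeSubdiff f (r.1 + δ • (r.2.1 i).1.1)} := by
      simp only [Set.ofPred_forall]
      refine isClosed_iInter fun i => ?_
      have hc : Continuous fun r : E d × CombinationData d K m =>
          ((r.1 + δ • (r.2.1 i).1.1 : E d), ((r.2.1 i).2.1 : E d)) := by fun_prop
      exact (isClosed_clarkeGraph hK).preimage hc
    have h2 : IsClosed {r : E d × CombinationData d K m | ‖∑ i, r.2.2.1 i • (r.2.1 i).2.1‖ ≤ c} := by
      refine isClosed_le ?_ continuous_const
      refine (continuous_finsetSum _ fun i _ => ?_).norm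
      have h3 : Continuous fun r : E d × CombinationData d K m => (r.2.2.1 : Fin m → ℝ) i :=
        (continuous_apply i).comp (continuous_subtype_val.comp (continuous_snd.comp continuous_snd))
      exact h3.smul (by fun_prop)
    exact h1.inter h2
  have := isClosedMap_fst_of_compactSpace (X := E d) (Y := CombinationData d K m) _ hS
  convert! this using 1
  ext x
  constructor
  · rintro ⟨q, hq⟩
    exact ⟨(x, q), hq, rfl⟩
  · rintro ⟨⟨y, q⟩, hq, rfl⟩
    exact ⟨q, hq⟩

theorem exists_mem_goldsteinSubdiff_iff (hK0 : 0 ≤ K) (hK : ∀ x y, |f x - f y| ≤ K * ‖x - y‖)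
    {δ : ℝ} (hδ : 0 < δ) (c : ℝ) (x : E d) :
    (∃ g ∈ goldsteinSubdiff f δ x, ‖g‖ ≤ c) ↔ ∃ m, HasSmallCombination f K δ c m x := by
  constructor
  · rintro ⟨g, hg, hgc⟩
    rw [goldsteinSubdiff, mem_convexHull_iff_exists_fintype] at hg
    obtain ⟨ι, _, w, z, hw0, hw1, hz, rfl⟩ := hg
    simp only [Set.mem_iUnion, exists_prop] at hz
    choose y hy hzy using hz
    let e := (Fintype.equivFin ι).symm
    have hb : ∀ i, δ⁻¹ • (y i - x) ∈ Metric.closedBall (0 : E d) 1 := by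
      intro i
      have := hy i
      rw [mem_closedBall_iff_norm] at this
      rw [mem_closedBall_zero_iff, norm_smul, norm_inv, Real.norm_of_nonneg hδ.le,
        inv_mul_le_iff₀ hδ, mul_one]
      exact this
    refine ⟨Fintype.card ι, (fun i => (⟨δ⁻¹ • (y (e i) - x), hb _⟩,
      ⟨z (e i), mem_closedBall_zero_iff.2 (norm_le_of_mem_clarkeSubdiff hK0 hK (hzy _))⟩),
      ⟨fun i => w (e i), fun i => hw0 _, ?_⟩), fun i => ?_, ?_⟩
    · rw [← hw1]; exact e.sum_comp w
    · simp only
      rw [smul_smul, mul_inv_cancel₀ hδ.ne', one_smul, add_sub_cancel]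
      exact hzy _
    · simp only
      rwa [e.sum_comp fun i => w i • z i]
  · rintro ⟨m, q, hq, hqc⟩
    refine ⟨_, mem_convexHull_of_exists_fintype q.2.1 (fun i => (q.1 i).2.1) q.2.2.1 q.2.2.2
      (fun i => ?_) rfl, hqc⟩
    refine Set.mem_iUnion₂.2 ⟨_, ?_, hq i⟩
    rw [mem_closedBall_iff_norm, add_sub_cancel_left, norm_smul, Real.norm_of_nonneg hδ.le]
    exact mul_le_of_le_one_right hδ.le (mem_closedBall_zero_iff.1 (q.1 i).1.2)

theorem goldsteinNorm_nonneg (f : E d → ℝ) (δ : ℝ) (x : E d) : 0 ≤ goldsteinNorm f δ x :=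
  Real.sInf_nonneg (by rintro _ ⟨g, _, rfl⟩; exact norm_nonneg g)

/-- The infimum of the norm is unchanged by taking closures, so membership in the closure is all
that the averaging arguments need. -/
theorem goldsteinNorm_le_of_mem_closure {δ : ℝ} {x g : E d}
    (hg : g ∈ closure (goldsteinSubdiff f δ x)) : goldsteinNorm f δ x ≤ ‖g‖ := by
  have hbdd : BddBelow ((fun g : E d => ‖g‖) '' goldsteinSubdiff f δ x) :=
    ⟨0, by rintro _ ⟨g, _, rfl⟩; exact norm_nonneg g⟩
  refine closure_minimal (t := {g | goldsteinNorm f δ x ≤ ‖g‖}) ?_ ?_ hg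
  · intro g hg
    exact csInf_le hbdd ⟨g, hg, rfl⟩
  · exact isClosed_le continuous_const continuous_norm

theorem convex_goldsteinSubdiff (f : E d → ℝ) (δ : ℝ) (x : E d) :
    Convex ℝ (goldsteinSubdiff f δ x) := convex_convexHull ℝ _

theorem goldsteinSubdiff_mono {δ δ' : ℝ} {x y : E d} (h : dist x y + δ ≤ δ') :
    goldsteinSubdiff f δ x ⊆ goldsteinSubdiff f δ' y := by
  refine convexHull_mono (Set.biUnion_subset_biUnion_left ?_)
  exact Metric.closedBall_subset_closedBall' (by rwa [add_comm])

/-- The mean of a probability measure carried by a closed convex set stays in that set, and almost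
every gradient being averaged is a Clarke subgradient in the ball. -/
theorem smoothedGradient_mem_closure (hK0 : 0 ≤ K) (hK : ∀ x y, |f x - f y| ≤ K * ‖x - y‖)
    {δ : ℝ} (hδ : 0 < δ) (x : E d) :
    smoothedGradient f δ x ∈ closure (goldsteinSubdiff f δ x) := by
  refine (convex_goldsteinSubdiff f δ x).closure.integral_mem isClosed_closure ?_
    (integrable_gradient_shift hK0 hK x)
  filter_upwards [ae_differentiableAt_shift hK0 hδ.ne' hK x, ae_uniformBall_mem] with y hy hy1
  refine subset_closure (subset_convexHull ℝ _ (Set.mem_iUnion₂.2 ⟨x + δ • y, ?_,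
    gradient_mem_clarkeSubdiff hK hy⟩))
  rw [mem_closedBall_iff_norm, add_sub_cancel_left, norm_smul, Real.norm_of_nonneg hδ.le]
  exact mul_le_of_le_one_right hδ.le hy1

theorem goldsteinNorm_le (hK0 : 0 ≤ K) (hK : ∀ x y, |f x - f y| ≤ K * ‖x - y‖)
    {δ : ℝ} (hδ : 0 < δ) (x : E d) : goldsteinNorm f δ x ≤ K :=
  (goldsteinNorm_le_of_mem_closure (smoothedGradient_mem_closure hK0 hK hδ x)).trans
    (norm_smoothedGradient_le hK0 hK x)

/-- Needed for the output to be integrable and for the values at the round averages to be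
independent of the selected index. -/
theorem measurable_goldsteinNorm (hK0 : 0 ≤ K) (hK : ∀ x y, |f x - f y| ≤ K * ‖x - y‖)
    {δ : ℝ} (hδ : 0 < δ) : Measurable (goldsteinNorm f δ) := by
  refine measurable_of_Iio fun c => ?_
  -- Nonemptiness is essential: `sInf ∅ = 0` would make the norm small without a witness.
  have hne : ∀ x, ((fun g : E d => ‖g‖) '' goldsteinSubdiff f δ x).Nonempty := fun x =>
    (closure_nonempty_iff.1 ⟨_, smoothedGradient_mem_closure hK0 hK hδ x⟩).image _
  -- The strict bound is written with slack `1/(n+1)` so that each piece is a closed condition; `m`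
  -- is the number of terms in the convex combination.
  have h : goldsteinNorm f δ ⁻¹' Set.Iio c = ⋃ (n : ℕ) (m : ℕ),
      {x | HasSmallCombination f K δ (c - 1 / ((n : ℝ) + 1)) m x} := by
    ext x
    simp only [Set.mem_iUnion]
    change goldsteinNorm f δ x < c ↔ ∃ n : ℕ, ∃ m, HasSmallCombination f K δ (c - 1 / ((n : ℝ) + 1)) m x
    simp_rw [← exists_mem_goldsteinSubdiff_iff hK0 hK hδ]
    constructor
    · intro hx
      obtain ⟨_, ⟨g, hg, rfl⟩, hgc⟩ := exists_lt_of_csInf_lt (hne x) hx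
      obtain ⟨n, hn⟩ := exists_nat_one_div_lt (sub_pos.2 hgc)
      exact ⟨n, g, hg, by linarith⟩
    · rintro ⟨n, g, hg, hgc⟩
      refine (goldsteinNorm_le_of_mem_closure (subset_closure hg)).trans_lt ?_
      have : 0 < 1 / ((n : ℝ) + 1) := by positivity
      linarith
  rw [h]
  exact MeasurableSet.iUnion fun n => MeasurableSet.iUnion fun m =>
    (isClosed_hasSmallCombination hK δ _ m).measurableSet

/-- The average of smoothed gradients at points close to `y` bounds the Goldstein norm at `y`. -/
theorem goldsteinNorm_le_norm_average (hK0 : 0 ≤ K) (hK : ∀ x y, |f x - f y| ≤ K * ‖x - y‖)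
    {ρ δ : ℝ} (hρ : 0 < ρ) {ι : Type*} {s : Finset ι} (hs : s.Nonempty) (w : ι → E d) (y : E d)
    (hw : ∀ i ∈ s, dist (w i) y + ρ ≤ δ) :
    goldsteinNorm f δ y ≤ ‖((s.card : ℝ)⁻¹) • ∑ i ∈ s, smoothedGradient f ρ (w i)‖ := by
  refine goldsteinNorm_le_of_mem_closure ?_
  rw [Finset.smul_sum]
  refine (convex_goldsteinSubdiff f δ y).closure.sum_mem (fun _ _ => by positivity) ?_
    fun i hi => closure_mono (goldsteinSubdiff_mono (hw i hi))
      (smoothedGradient_mem_closure hK0 hK hρ (w i))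
  have : (s.card : ℝ) ≠ 0 := by exact_mod_cast hs.card_pos.ne'
  rw [Finset.sum_const, nsmul_eq_mul, mul_inv_cancel₀ this]

end Subdifferential

/-! ### The stochastic oracle and the two-point estimator -/

section Oracle

set_option linter.unusedSectionVars false

variable {d : ℕ} {Ξ : Type*} [MeasurableSpace Ξ]

/-- The assumptions on the stochastic oracle, with an explicit random Lipschitz constant `ℓ`. -/
structure IsLipschitzOracle (P : Measure Ξ) (F : E d → Ξ → ℝ) (ℓ : Ξ → ℝ) (p L : ℝ) : Prop where
  one_lt : 1 < p
  le_two : p ≤ 2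
  pos : 0 < L
  measurable : ∀ x, Measurable (F x)
  integrable : ∀ x, Integrable (F x) P
  measurable_const : Measurable ℓ
  nonneg : ∀ ξ, 0 ≤ ℓ ξ
  abs_sub_le : ∀ ξ x y, |F x ξ - F y ξ| ≤ ℓ ξ * ‖x - y‖
  integrable_rpow : Integrable (fun ξ => ℓ ξ ^ p) P
  integral_rpow_le : ∫ ξ, ℓ ξ ^ p ∂P ≤ L ^ p

/-- The value of the two-point estimator. -/
def estimator (F : E d → Ξ → ℝ) (ρ : ℝ) (w : E d) (ξ : Ξ) (u : E d) : E d :=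
  (gradientEstimator F ρ w ξ u).1

theorem estimator_eq (F : E d → Ξ → ℝ) (ρ : ℝ) (w : E d) (ξ : Ξ) (u : E d) :
    estimator F ρ w ξ u = ((d : ℝ) / (2 * ρ) * (F (w + ρ • u) ξ - F (w - ρ • u) ξ)) • u := rfl

namespace IsLipschitzOracle

variable {P : Measure Ξ} [IsProbabilityMeasure P] {F : E d → Ξ → ℝ} {ℓ : Ξ → ℝ} {p L ρ : ℝ}

theorem integrable_const (h : IsLipschitzOracle P F ℓ p L) : Integrable ℓ P := by
  refine ((MeasureTheory.integrable_const (1 : ℝ)).add h.integrable_rpow).mono'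
    h.measurable_const.aestronglyMeasurable (.of_forall fun ξ => ?_)
  have h0 := h.nonneg ξ
  rw [Real.norm_of_nonneg h0]
  simp only [Pi.add_apply]
  rcases le_total (ℓ ξ) 1 with h1 | h1
  · have := Real.rpow_nonneg h0 p
    linarith
  · have := Real.rpow_le_rpow_of_exponent_le h1 h.one_lt.le
    rw [Real.rpow_one] at this
    linarith

theorem integral_const_le (h : IsLipschitzOracle P F ℓ p L) : ∫ ξ, ℓ ξ ∂P ≤ L := by
  have hp := h.one_lt
  have h1 := (convexOn_rpow hp.le).map_integral_le (μ := P) (f := ℓ)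
    (Real.continuous_rpow_const (by linarith)).continuousOn isClosed_Ici
    (.of_forall h.nonneg) h.integrable_const h.integrable_rpow
  exact (Real.rpow_le_rpow_iff (integral_nonneg h.nonneg) h.pos.le (by linarith)).1
    (h1.trans h.integral_rpow_le)

theorem abs_objective_sub_le (h : IsLipschitzOracle P F ℓ p L) (x y : E d) :
    |objective P F x - objective P F y| ≤ L * ‖x - y‖ := by
  rw [objective, objective, ← integral_sub (h.integrable x) (h.integrable y)]
  refine (abs_integral_le_integral_abs).trans ?_
  calc ∫ ξ, |F x ξ - F y ξ| ∂P ≤ ∫ ξ, ℓ ξ * ‖x - y‖ ∂P :=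
        integral_mono ((h.integrable x).sub (h.integrable y)).abs
          (h.integrable_const.mul_const _) fun ξ => h.abs_sub_le ξ x y
    _ = (∫ ξ, ℓ ξ ∂P) * ‖x - y‖ := integral_mul_const _ _
    _ ≤ L * ‖x - y‖ := by gcongr; exact h.integral_const_le

theorem continuous_oracle (h : IsLipschitzOracle P F ℓ p L) (ξ : Ξ) :
    Continuous fun x => F x ξ :=
  (lipschitzWith_of_abs_sub_le (h.nonneg ξ) (h.abs_sub_le ξ)).continuous

theorem measurable_uncurry (h : IsLipschitzOracle P F ℓ p L) :
    Measurable fun q : E d × Ξ => F q.1 q.2 :=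
  measurable_uncurry_of_continuous_of_measurable h.continuous_oracle h.measurable

theorem measurable_estimator (h : IsLipschitzOracle P F ℓ p L) :
    Measurable fun q : E d × (Ξ × Metric.sphere (0 : E d) 1) =>
      estimator F ρ q.1 q.2.1 q.2.2.1 := by
  simp only [estimator_eq]
  have h1 : Measurable fun q : E d × (Ξ × Metric.sphere (0 : E d) 1) =>
      F (q.1 + ρ • q.2.2.1) q.2.1 :=
    h.measurable_uncurry.comp (Measurable.prodMk (by fun_prop) (by fun_prop))
  have h2 : Measurable fun q : E d × (Ξ × Metric.sphere (0 : E d) 1) =>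
      F (q.1 - ρ • q.2.2.1) q.2.1 :=
    h.measurable_uncurry.comp (Measurable.prodMk (by fun_prop) (by fun_prop))
  exact ((h1.sub h2).const_mul _).smul (by fun_prop)

theorem measurable_estimator_sample (h : IsLipschitzOracle P F ℓ p L) (w : E d) :
    Measurable fun q : Ξ × Metric.sphere (0 : E d) 1 => estimator F ρ w q.1 q.2.1 :=
  Measurable.of_uncurry_left (f := fun (w : E d) (q : Ξ × Metric.sphere (0 : E d) 1) =>
    estimator F ρ w q.1 q.2.1) h.measurable_estimator

theorem measurable_estimator_direction (h : IsLipschitzOracle P F ℓ p L) (w : E d) (ξ : Ξ) :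
    Measurable fun u : Metric.sphere (0 : E d) 1 => estimator F ρ w ξ u.1 :=
  Measurable.of_uncurry_left (f := fun (ξ : Ξ) (u : Metric.sphere (0 : E d) 1) =>
    estimator F ρ w ξ u.1) (h.measurable_estimator_sample w)

theorem abs_difference_le (h : IsLipschitzOracle P F ℓ p L) (hρ : 0 < ρ) (w : E d) (ξ : Ξ)
    (x y : E d) :
    |(F (w + ρ • x) ξ - F (w - ρ • x) ξ) - (F (w + ρ • y) ξ - F (w - ρ • y) ξ)| ≤
      2 * ρ * ℓ ξ * ‖x - y‖ := by
  have h1 := h.abs_sub_le ξ (w + ρ • x) (w + ρ • y)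
  have h2 := h.abs_sub_le ξ (w - ρ • y) (w - ρ • x)
  rw [add_sub_add_left_eq_sub, ← smul_sub, norm_smul, Real.norm_of_nonneg hρ.le] at h1
  rw [sub_sub_sub_cancel_left, ← smul_sub, norm_smul, Real.norm_of_nonneg hρ.le] at h2
  have h3 := abs_add_le (F (w + ρ • x) ξ - F (w + ρ • y) ξ) (F (w - ρ • y) ξ - F (w - ρ • x) ξ)
  rw [show (F (w + ρ • x) ξ - F (w - ρ • x) ξ) - (F (w + ρ • y) ξ - F (w - ρ • y) ξ) =
    F (w + ρ • x) ξ - F (w + ρ • y) ξ + (F (w - ρ • y) ξ - F (w - ρ • x) ξ) by ring]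
  linarith

theorem difference_neg (w : E d) (ξ : Ξ) (x : E d) :
    F (w + ρ • (-x)) ξ - F (w - ρ • (-x)) ξ = -(F (w + ρ • x) ξ - F (w - ρ • x) ξ) := by
  rw [smul_neg, sub_neg_eq_add, ← sub_eq_add_neg]; ring

theorem norm_estimator (hρ : 0 < ρ) (w : E d) (ξ : Ξ)
    (u : Metric.sphere (0 : E d) 1) :
    ‖estimator F ρ w ξ u.1‖ = (d : ℝ) / (2 * ρ) * |F (w + ρ • u.1) ξ - F (w - ρ • u.1) ξ| := by
  rw [estimator_eq, norm_smul, norm_eq_of_mem_sphere, mul_one, norm_mul, Real.norm_eq_abs,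
    Real.norm_eq_abs, abs_of_nonneg (a := (d : ℝ) / (2 * ρ)) (by positivity)]

theorem norm_estimator_le (h : IsLipschitzOracle P F ℓ p L) (hρ : 0 < ρ) (w : E d) (ξ : Ξ)
    (u : Metric.sphere (0 : E d) 1) : ‖estimator F ρ w ξ u.1‖ ≤ d * ℓ ξ := by
  rw [norm_estimator hρ]
  have h1 := abs_le_of_odd_of_lipschitz (h.abs_difference_le hρ w ξ) (difference_neg w ξ) u.1
  rw [norm_eq_of_mem_sphere, mul_one] at h1
  calc (d : ℝ) / (2 * ρ) * |F (w + ρ • u.1) ξ - F (w - ρ • u.1) ξ|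
      ≤ (d : ℝ) / (2 * ρ) * (2 * ρ * ℓ ξ) := by gcongr
    _ = d * ℓ ξ := by field_simp

theorem integrable_estimator [NeZero d] (h : IsLipschitzOracle P F ℓ p L) (hρ : 0 < ρ) (w : E d) :
    Integrable (fun q : Ξ × Metric.sphere (0 : E d) 1 => estimator F ρ w q.1 q.2.1)
      (P.prod (uniformSphere d)) := by
  refine ((h.integrable_const.const_mul (d : ℝ)).comp_fst (uniformSphere d)).mono'
    (h.measurable_estimator_sample w).aestronglyMeasurable
    (.of_forall fun q => h.norm_estimator_le hρ w q.1 q.2)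

/-- Integrating `ξ` first replaces `F` by the objective, whose two-point formula then gives the
smoothed gradient. -/
theorem integral_estimator [NeZero d] (h : IsLipschitzOracle P F ℓ p L) (hρ : 0 < ρ) (w : E d) :
    ∫ q : Ξ × Metric.sphere (0 : E d) 1, estimator F ρ w q.1 q.2.1 ∂(P.prod (uniformSphere d)) =
      smoothedGradient (objective P F) ρ w := by
  rw [integral_prod_symm _ (h.integrable_estimator hρ w),
    ← integral_two_point h.pos.le hρ h.abs_objective_sub_le]
  refine integral_congr_ae (.of_forall fun u => ?_)
  simp only [estimator_eq, objective]
  rw [integral_smul_const, integral_const_mul, integral_sub (h.integrable _) (h.integrable _)]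

/-- The symmetric difference is odd and `2 ρ ℓ(ξ)`-Lipschitz in `u`, so the spherical variance bound
gains a factor of order `d` over the trivial `(d ℓ)²`. -/
theorem integral_norm_estimator_sq_le [NeZero d] (h : IsLipschitzOracle P F ℓ p L) (hρ : 0 < ρ)
    (w : E d) (ξ : Ξ) :
    ∫ u : Metric.sphere (0 : E d) 1, ‖estimator F ρ w ξ u.1‖ ^ 2 ∂(uniformSphere d) ≤
      8 / 5 * (d + 1) * ℓ ξ ^ 2 := by
  have h0 := h.nonneg ξ
  have h1 := sq_mul_integral_sq_uniformSphere_le (h := fun x => F (w + ρ • x) ξ - F (w - ρ • x) ξ)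
    (by positivity) (h.abs_difference_le hρ w ξ) (difference_neg w ξ)
  simp_rw [norm_estimator hρ, mul_pow, sq_abs]
  rw [integral_const_mul, div_pow, div_mul_eq_mul_div, div_le_iff₀ (by positivity)]
  refine h1.trans_eq ?_
  ring

/-- Jensen for the concave power `p/2` passes from the second moment to the `p`-th, and
subadditivity of that power splits `(d + 1)^{p/2}`. Working with `ξ` fixed matters, since only the
`p`-th moment of `ℓ` is assumed. -/
theorem integral_norm_estimator_rpow_le_const [NeZero d] (h : IsLipschitzOracle P F ℓ p L)
    (hρ : 0 < ρ) (w : E d) (ξ : Ξ) :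
    ∫ u : Metric.sphere (0 : E d) 1, ‖estimator F ρ w ξ u.1‖ ^ p ∂(uniformSphere d) ≤
      8 / 5 * ((d : ℝ) ^ (p / 2) + 1) * ℓ ξ ^ p := by
  have hp := h.one_lt
  have hp2 := h.le_two
  have h0 := h.nonneg ξ
  have hm : Measurable fun u : Metric.sphere (0 : E d) 1 => ‖estimator F ρ w ξ u.1‖ :=
    (h.measurable_estimator_direction w ξ).norm
  have hb : ∀ u : Metric.sphere (0 : E d) 1, ‖estimator F ρ w ξ u.1‖ ^ 2 ≤ (d * ℓ ξ) ^ 2 :=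
    fun u => pow_le_pow_left₀ (norm_nonneg _) (h.norm_estimator_le hρ w ξ u) 2
  have hpow : ∀ a : ℝ, 0 ≤ a → (a ^ 2) ^ (p / 2) = a ^ p := by
    intro a ha
    rw [← Real.rpow_natCast, ← Real.rpow_mul ha]
    congr 1
    push_cast
    ring
  have hi2 : Integrable (fun u : Metric.sphere (0 : E d) 1 => ‖estimator F ρ w ξ u.1‖ ^ 2)
      (uniformSphere d) :=
    Integrable.of_bound (hm.pow_const 2).aestronglyMeasurable _
      (.of_forall fun u => by rw [Real.norm_of_nonneg (sq_nonneg _)]; exact hb u)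
  have hip : Integrable ((fun x : ℝ => x ^ (p / 2)) ∘
      fun u : Metric.sphere (0 : E d) 1 => ‖estimator F ρ w ξ u.1‖ ^ 2) (uniformSphere d) := by
    refine Integrable.of_bound (C := ((d * ℓ ξ) ^ 2) ^ (p / 2))
      ((hm.pow_const 2).pow_const _).aestronglyMeasurable (.of_forall fun u => ?_)
    simp only [Function.comp_apply]
    rw [Real.norm_of_nonneg (by positivity)]
    exact Real.rpow_le_rpow (sq_nonneg _) (hb u) (by linarith)
  have hJ := (Real.concaveOn_rpow (p := p / 2) (by linarith) (by linarith)).le_map_integral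
    (Real.continuous_rpow_const (by linarith)).continuousOn isClosed_Ici
    (.of_forall fun u => Set.mem_Ici.2 (sq_nonneg _)) hi2 hip
  simp_rw [hpow _ (norm_nonneg _)] at hJ
  refine hJ.trans ?_
  calc (∫ u : Metric.sphere (0 : E d) 1, ‖estimator F ρ w ξ u.1‖ ^ 2 ∂(uniformSphere d)) ^ (p / 2)
      ≤ (8 / 5 * (d + 1) * ℓ ξ ^ 2) ^ (p / 2) :=
        Real.rpow_le_rpow (integral_nonneg fun _ => sq_nonneg _)
          (h.integral_norm_estimator_sq_le hρ w ξ) (by linarith)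
    _ = (8 / 5 : ℝ) ^ (p / 2) * ((d : ℝ) + 1) ^ (p / 2) * ℓ ξ ^ p := by
        rw [Real.mul_rpow (by positivity) (by positivity), Real.mul_rpow (by positivity)
          (by positivity), hpow _ h0]
    _ ≤ 8 / 5 * ((d : ℝ) ^ (p / 2) + 1) * ℓ ξ ^ p := by
        have h1 : (8 / 5 : ℝ) ^ (p / 2) ≤ 8 / 5 :=
          Real.rpow_le_self_of_one_le (by norm_num) (by linarith)
        have h2 : ((d : ℝ) + 1) ^ (p / 2) ≤ (d : ℝ) ^ (p / 2) + 1 := by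
          have := Real.rpow_add_le_add_rpow (a := (d : ℝ)) (b := 1) (p := p / 2) (by positivity)
            (by positivity) (by linarith) (by linarith)
          rwa [Real.one_rpow] at this
        gcongr

theorem integrable_norm_estimator_rpow [NeZero d] (h : IsLipschitzOracle P F ℓ p L)
    (hρ : 0 < ρ) (w : E d) :
    Integrable (fun q : Ξ × Metric.sphere (0 : E d) 1 => ‖estimator F ρ w q.1 q.2.1‖ ^ p)
      (P.prod (uniformSphere d)) := by
  have hp := h.one_lt
  refine ((h.integrable_rpow.const_mul ((d : ℝ) ^ p)).comp_fst (uniformSphere d)).mono'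
    (Measurable.aestronglyMeasurable ?_) (.of_forall fun q => ?_)
  · exact (h.measurable_estimator_sample w).norm.pow_const _
  · rw [Real.norm_of_nonneg (by positivity), ← Real.mul_rpow (by positivity) (h.nonneg _)]
    exact Real.rpow_le_rpow (norm_nonneg _) (h.norm_estimator_le hρ w q.1 q.2) (by linarith)

/-- The `p`-th moment of the two-point estimator grows like `d ^ (p / 2)`. -/
theorem integral_norm_estimator_rpow_le [NeZero d] (h : IsLipschitzOracle P F ℓ p L)
    (hρ : 0 < ρ) (w : E d) :
    ∫ q : Ξ × Metric.sphere (0 : E d) 1, ‖estimator F ρ w q.1 q.2.1‖ ^ p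
      ∂(P.prod (uniformSphere d)) ≤ 8 / 5 * (((d : ℝ) ^ (p / 2) + 1) * L ^ p) := by
  have hi := h.integrable_norm_estimator_rpow hρ w
  rw [integral_prod _ hi]
  calc ∫ ξ, ∫ u : Metric.sphere (0 : E d) 1, ‖estimator F ρ w ξ u.1‖ ^ p ∂(uniformSphere d) ∂P
      ≤ ∫ ξ, 8 / 5 * ((d : ℝ) ^ (p / 2) + 1) * ℓ ξ ^ p ∂P :=
        integral_mono hi.integral_prod_left (h.integrable_rpow.const_mul _)
          fun ξ => h.integral_norm_estimator_rpow_le_const hρ w ξ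
    _ = 8 / 5 * (((d : ℝ) ^ (p / 2) + 1) * ∫ ξ, ℓ ξ ^ p ∂P) := by
        rw [integral_const_mul]; ring
    _ ≤ _ := by gcongr; exact h.integral_rpow_le

end IsLipschitzOracle

/-! ### Clipping -/

theorem clip_eq (g : E d) (τ : ℝ) : clip g τ = min 1 (τ / ‖g‖) • g := by
  unfold clip
  split_ifs with h
  · simp [h]
  · rfl

theorem measurable_clip (τ : ℝ) : Measurable fun g : E d => clip g τ := by
  simp only [clip_eq]
  exact (measurable_const.min (measurable_norm.const_div τ)).smul measurable_id

theorem clip_of_norm_le {g : E d} {τ : ℝ} (h : ‖g‖ ≤ τ) : clip g τ = g := by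
  rw [clip_eq]
  rcases eq_or_ne g 0 with rfl | hg
  · simp
  · rw [min_eq_left, one_smul]
    rwa [one_le_div (norm_pos_iff.2 hg)]

theorem clip_of_lt_norm {g : E d} {τ : ℝ} (hτ : 0 < τ) (h : τ < ‖g‖) :
    clip g τ = (τ / ‖g‖) • g := by
  rw [clip_eq, min_eq_right]
  exact (div_le_one (hτ.trans h)).2 h.le

theorem norm_clip_of_lt_norm {g : E d} {τ : ℝ} (hτ : 0 < τ) (h : τ < ‖g‖) : ‖clip g τ‖ = τ := by
  rw [clip_of_lt_norm hτ h, norm_smul, Real.norm_of_nonneg (by positivity),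
    div_mul_cancel₀ _ (hτ.trans h).ne']

theorem norm_clip_le (g : E d) {τ : ℝ} (hτ : 0 < τ) : ‖clip g τ‖ ≤ τ := by
  rcases le_or_gt ‖g‖ τ with h | h
  · rwa [clip_of_norm_le h]
  · exact (norm_clip_of_lt_norm hτ h).le

theorem norm_clip_sq_le (g : E d) {τ p : ℝ} (hτ : 0 < τ) (hp : 1 < p) (hp2 : p ≤ 2) :
    ‖clip g τ‖ ^ 2 ≤ τ ^ (2 - p) * ‖g‖ ^ p := by
  -- Applied to `a = min(‖g‖, τ)`, the norm of the clipped vector: one factor is bounded by `τ`, the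
  -- other by `‖g‖`.
  have key : ∀ a : ℝ, 0 ≤ a → a ^ 2 = a ^ (2 - p) * a ^ p := by
    intro a ha
    rcases ha.eq_or_lt with rfl | ha
    · rw [Real.zero_rpow (by linarith : p ≠ 0)]; simp
    · rw [← Real.rpow_add ha, ← Real.rpow_natCast]; congr 1; push_cast; ring
  rcases le_or_gt ‖g‖ τ with h | h
  · rw [clip_of_norm_le h, key _ (norm_nonneg _)]
    gcongr
  · rw [norm_clip_of_lt_norm hτ h, key _ hτ.le]
    gcongr

theorem norm_sub_clip_le (g : E d) {τ p : ℝ} (hτ : 0 < τ) (hp : 1 < p) :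
    ‖g - clip g τ‖ ≤ τ ^ (1 - p) * ‖g‖ ^ p := by
  rcases le_or_gt ‖g‖ τ with h | h
  · rw [clip_of_norm_le h, sub_self, norm_zero]; positivity
  · have hg : 0 < ‖g‖ := hτ.trans h
    have h1 : g - clip g τ = (1 - τ / ‖g‖) • g := by
      rw [clip_of_lt_norm hτ h, sub_smul, one_smul]
    have h2 : τ / ‖g‖ ≤ 1 := (div_le_one hg).2 h.le
    rw [h1, norm_smul, Real.norm_of_nonneg (by linarith)]
    have h3 : ‖g‖ = ‖g‖ ^ (1 - p) * ‖g‖ ^ p := by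
      rw [← Real.rpow_add hg]; simp
    have h4 : ‖g‖ ^ (1 - p) ≤ τ ^ (1 - p) :=
      Real.rpow_le_rpow_of_nonpos hτ h.le (by linarith)
    have h5 : 0 < τ / ‖g‖ := by positivity
    calc (1 - τ / ‖g‖) * ‖g‖ ≤ ‖g‖ := mul_le_of_le_one_left hg.le (by linarith)
      _ = ‖g‖ ^ (1 - p) * ‖g‖ ^ p := h3
      _ ≤ _ := by gcongr

/-- The conditional mean of the clipped estimator at `w`. -/
def clippedMean (P : Measure Ξ) (F : E d → Ξ → ℝ) (ρ τ : ℝ) (w : E d) : E d :=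
  ∫ q : Ξ × Metric.sphere (0 : E d) 1, clip (estimator F ρ w q.1 q.2.1) τ
    ∂(P.prod (uniformSphere d))

/-! ### Bias and second moment of the clipped estimator. -/

namespace IsLipschitzOracle

variable {P : Measure Ξ} [IsProbabilityMeasure P] {F : E d → Ξ → ℝ} {ℓ : Ξ → ℝ} {p L ρ τ : ℝ}

theorem measurable_clip_estimator (h : IsLipschitzOracle P F ℓ p L) :
    Measurable fun q : E d × (Ξ × Metric.sphere (0 : E d) 1) =>
      clip (estimator F ρ q.1 q.2.1 q.2.2.1) τ :=
  (measurable_clip τ).comp h.measurable_estimator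

theorem integrable_clip [NeZero d] (h : IsLipschitzOracle P F ℓ p L) (hτ : 0 < τ) (w : E d) :
    Integrable (fun q : Ξ × Metric.sphere (0 : E d) 1 => clip (estimator F ρ w q.1 q.2.1) τ)
      (P.prod (uniformSphere d)) :=
  Integrable.of_bound ((measurable_clip τ).comp (h.measurable_estimator_sample w)).aestronglyMeasurable
    τ (.of_forall fun _ => norm_clip_le _ hτ)

theorem measurable_clippedMean [NeZero d] (h : IsLipschitzOracle P F ℓ p L) :
    Measurable (clippedMean P F ρ τ) :=
  (h.measurable_clip_estimator.stronglyMeasurable.integral_prod_right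
    (ν := P.prod (uniformSphere d))).measurable

theorem norm_clippedMean_le [NeZero d] (hτ : 0 < τ) (w : E d) :
    ‖clippedMean P F ρ τ w‖ ≤ τ := by
  refine (norm_integral_le_of_norm_le_const (C := τ)
    (.of_forall fun _ => norm_clip_le _ hτ)).trans ?_
  simp

variable {T : ℝ}

theorem integral_norm_clip_sq_le [NeZero d] (h : IsLipschitzOracle P F ℓ p L) (hρ : 0 < ρ)
    (hτ : 0 < τ) (hT : 0 < T) (hτT : τ ^ p = T * (((d : ℝ) ^ (p / 2) + 1) * L ^ p)) (w : E d) :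
    ∫ q : Ξ × Metric.sphere (0 : E d) 1, ‖clip (estimator F ρ w q.1 q.2.1) τ‖ ^ 2
      ∂(P.prod (uniformSphere d)) ≤ 8 / 5 * τ ^ 2 / T := by
  have hi := (h.integrable_norm_estimator_rpow hρ w).const_mul (τ ^ (2 - p))
  calc _ ≤ ∫ q : Ξ × Metric.sphere (0 : E d) 1, τ ^ (2 - p) * ‖estimator F ρ w q.1 q.2.1‖ ^ p
        ∂(P.prod (uniformSphere d)) :=
        integral_mono_of_nonneg (.of_forall fun _ => sq_nonneg _) hi
          (.of_forall fun q => norm_clip_sq_le _ hτ h.one_lt h.le_two)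
    _ ≤ τ ^ (2 - p) * (8 / 5 * (((d : ℝ) ^ (p / 2) + 1) * L ^ p)) := by
        rw [integral_const_mul]; gcongr; exact h.integral_norm_estimator_rpow_le hρ w
    _ = 8 / 5 * (τ ^ (2 - p) * τ ^ p) / T := by rw [hτT]; field_simp
    _ = 8 / 5 * τ ^ 2 / T := by
        rw [← Real.rpow_add hτ, ← Real.rpow_natCast τ 2]; congr 3; push_cast; ring

/-- The bias is the mean of what clipping removes, at most `τ^{1-p}` times the `p`-th moment; the
choice of `τ^p` converts the moment into `8/5 τ^p / T`. -/
theorem norm_smoothedGradient_sub_clippedMean_le [NeZero d] (h : IsLipschitzOracle P F ℓ p L)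
    (hρ : 0 < ρ) (hτ : 0 < τ) (hT : 0 < T)
    (hτT : τ ^ p = T * (((d : ℝ) ^ (p / 2) + 1) * L ^ p)) (w : E d) :
    ‖smoothedGradient (objective P F) ρ w - clippedMean P F ρ τ w‖ ≤ 8 / 5 * τ / T := by
  have hi := (h.integrable_norm_estimator_rpow hρ w).const_mul (τ ^ (1 - p))
  rw [← h.integral_estimator hρ, clippedMean,
    ← integral_sub (h.integrable_estimator hρ w) (h.integrable_clip hτ w)]
  calc _ ≤ ∫ q : Ξ × Metric.sphere (0 : E d) 1, τ ^ (1 - p) * ‖estimator F ρ w q.1 q.2.1‖ ^ p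
        ∂(P.prod (uniformSphere d)) :=
        norm_integral_le_of_norm_le hi (.of_forall fun q => norm_sub_clip_le _ hτ h.one_lt)
    _ ≤ τ ^ (1 - p) * (8 / 5 * (((d : ℝ) ^ (p / 2) + 1) * L ^ p)) := by
        rw [integral_const_mul]; gcongr; exact h.integral_norm_estimator_rpow_le hρ w
    _ = 8 / 5 * (τ ^ (1 - p) * τ ^ p) / T := by rw [hτT]; field_simp
    _ = 8 / 5 * τ / T := by
        rw [← Real.rpow_add hτ, show 1 - p + p = 1 by ring, Real.rpow_one]

end IsLipschitzOracle

end Oracle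

/-! ### Deterministic analysis of a run -/

section Path

variable {d : ℕ}

theorem norm_projBall_sub_le {D : ℝ} (hD : 0 ≤ D) (y v : E d) (hv : ‖v‖ ≤ D) :
    ‖projBall D y - v‖ ≤ ‖y - v‖ := by
  unfold projBall
  split_ifs with h
  · exact le_rfl
  · have hy : D < ‖y‖ := not_le.1 h
    have hy0 : 0 < ‖y‖ := hD.trans_lt hy
    set a := D / ‖y‖ with ha
    have ha1 : a ≤ 1 := (div_le_one hy0).2 hy.le
    have haD : a * ‖y‖ = D := div_mul_cancel₀ _ hy0.ne'
    have hin : inner ℝ y v ≤ a * ‖y‖ ^ 2 := by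
      calc inner ℝ y v ≤ ‖y‖ * ‖v‖ := real_inner_le_norm _ _
        _ ≤ ‖y‖ * D := by gcongr
        _ = a * ‖y‖ ^ 2 := by rw [← haD]; ring
    rw [← sq_le_sq₀ (norm_nonneg _) (norm_nonneg _), norm_sub_sq_real, norm_sub_sq_real, norm_smul,
      inner_smul_left, Real.norm_of_nonneg (div_nonneg hD hy0.le)]
    simp only [conj_trivial]
    nlinarith [mul_nonneg (sub_nonneg.2 ha1) (sub_nonneg.2 hin),
      mul_nonneg (sq_nonneg (1 - a)) (sq_nonneg ‖y‖)]

theorem norm_projBall_le {D : ℝ} (hD : 0 ≤ D) (y : E d) : ‖projBall D y‖ ≤ D :=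
  mem_closedBall_zero_iff.1 (projBall_mem hD y)

theorem measurable_projBall (D : ℝ) : Measurable fun y : E d => projBall D y := by
  unfold projBall
  exact Measurable.ite (measurableSet_le measurable_norm measurable_const) measurable_id
    ((measurable_norm.const_div D).smul measurable_id)

/-- The regret of projected online gradient descent on the ball of radius `D`. -/
theorem sum_inner_le_of_projected_descent {D τ : ℝ} (hD : 0 < D) (hτ : 0 < τ) {c Δ : ℕ → E d}
    (hΔ : ∀ n, ‖Δ n‖ ≤ D) (hstep : ∀ n, Δ (n + 1) = projBall D (Δ n - (D / τ) • c n))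
    {v : E d} (hv : ‖v‖ ≤ D) (T : ℕ) :
    ∑ t ∈ Finset.range T, inner ℝ (c t) (Δ t - v) ≤
      2 * D * τ + D / (2 * τ) * ∑ t ∈ Finset.range T, ‖c t‖ ^ 2 := by
  have h1 : ∀ n, 2 * (D / τ) * inner ℝ (c n) (Δ n - v) ≤
      ‖Δ n - v‖ ^ 2 - ‖Δ (n + 1) - v‖ ^ 2 + (D / τ) ^ 2 * ‖c n‖ ^ 2 := by
    intro n
    have h2 := norm_projBall_sub_le hD.le (Δ n - (D / τ) • c n) v hv
    rw [← hstep] at h2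
    have h3 := pow_le_pow_left₀ (norm_nonneg _) h2 2
    rw [sub_right_comm, norm_sub_sq_real (Δ n - v), inner_smul_right, norm_smul, mul_pow,
      Real.norm_eq_abs, sq_abs, real_inner_comm] at h3
    linarith
  have h4 : 2 * (D / τ) * ∑ t ∈ Finset.range T, inner ℝ (c t) (Δ t - v) ≤
      ‖Δ 0 - v‖ ^ 2 - ‖Δ T - v‖ ^ 2 + (D / τ) ^ 2 * ∑ t ∈ Finset.range T, ‖c t‖ ^ 2 := by
    rw [Finset.mul_sum, Finset.mul_sum, ← Finset.sum_range_sub' (fun n => ‖Δ n - v‖ ^ 2),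
      ← Finset.sum_add_distrib]
    exact Finset.sum_le_sum fun n _ => h1 n
  -- The round inherits its first `Δ` from the preceding one, so only the diameter `2 D` of the ball
  -- is available.
  have h5 : ‖Δ 0 - v‖ ^ 2 ≤ (2 * D) ^ 2 := by
    refine pow_le_pow_left₀ (norm_nonneg _) ?_ 2
    have := norm_sub_le (Δ 0) v
    linarith [hΔ 0]
  have h6 : 0 ≤ ‖Δ T - v‖ ^ 2 := sq_nonneg _
  have h7 : 2 * (D / τ) * ∑ t ∈ Finset.range T, inner ℝ (c t) (Δ t - v) ≤
      2 * (D / τ) * (2 * D * τ + D / (2 * τ) * ∑ t ∈ Finset.range T, ‖c t‖ ^ 2) := by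
    have : 2 * (D / τ) * (2 * D * τ + D / (2 * τ) * ∑ t ∈ Finset.range T, ‖c t‖ ^ 2) =
        (2 * D) ^ 2 + (D / τ) ^ 2 * ∑ t ∈ Finset.range T, ‖c t‖ ^ 2 := by
      field_simp
    rw [this]
    linarith
  exact le_of_mul_le_mul_left h7 (by positivity)

/-- The online-to-nonconvex bound for one round. -/
theorem norm_sum_le_of_projected_descent {D τ B : ℝ} (hD : 0 < D) (hτ : 0 < τ)
    {G b c Δ : ℕ → E d}
    (hΔ : ∀ n, ‖Δ n‖ ≤ D) (hstep : ∀ n, Δ (n + 1) = projBall D (Δ n - (D / τ) • c n))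
    (hB : ∀ n, ‖G n - b n‖ ≤ B) (T : ℕ) :
    D * ‖∑ t ∈ Finset.range T, G t‖ ≤
      -∑ t ∈ Finset.range T, inner ℝ (G t) (Δ t) + 2 * D * τ +
        D / (2 * τ) * ∑ t ∈ Finset.range T, ‖c t‖ ^ 2 +
        ∑ t ∈ Finset.range T, inner ℝ (b t - c t) (Δ t) + 2 * D * T * B +
        D * ‖∑ t ∈ Finset.range T, (c t - b t)‖ := by
  set S := ∑ t ∈ Finset.range T, G t with hS
  -- The comparator is the minimizer of `⟨S, ·⟩` on the ball; if `S = 0` the division convention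
  -- gives `v = 0`.
  set v : E d := (-(D / ‖S‖)) • S with hv
  have hvS : inner ℝ S v = -(D * ‖S‖) := by
    rw [hv, inner_smul_right, real_inner_self_eq_norm_sq]
    rcases eq_or_ne ‖S‖ 0 with h | h
    · simp [h]
    · field_simp
  have hvn : ‖v‖ ≤ D := by
    rw [hv, norm_smul, norm_neg, norm_div, norm_norm, Real.norm_of_nonneg hD.le]
    rcases eq_or_ne ‖S‖ 0 with h | h
    · rw [h, mul_zero]; exact hD.le
    · exact (div_mul_cancel₀ D h).le
  have h1 := sum_inner_le_of_projected_descent hD hτ hΔ hstep hvn T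
  have h2 : ∑ t ∈ Finset.range T, inner ℝ (G t) (Δ t - v) =
      ∑ t ∈ Finset.range T, inner ℝ (G t) (Δ t) + D * ‖S‖ := by
    simp_rw [inner_sub_right]
    rw [Finset.sum_sub_distrib, ← sum_inner, ← hS, hvS]
    ring
  have h3 : ∑ t ∈ Finset.range T, inner ℝ (G t - b t) (Δ t - v) ≤ 2 * D * T * B := by
    have : ∀ t ∈ Finset.range T, inner ℝ (G t - b t) (Δ t - v) ≤ B * (2 * D) := by
      intro t _
      refine (real_inner_le_norm _ _).trans ?_
      have h5 : ‖Δ t - v‖ ≤ 2 * D := by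
        have := norm_sub_le (Δ t) v
        linarith [hΔ t]
      exact mul_le_mul (hB t) h5 (norm_nonneg _) ((norm_nonneg _).trans (hB t))
    refine (Finset.sum_le_sum this).trans_eq ?_
    rw [Finset.sum_const, Finset.card_range, nsmul_eq_mul]
    ring
  -- Since `v` depends on the whole round, this noise term is not centred; Cauchy–Schwarz leaves the
  -- norm of the noise sum, to be handled by its second moment.
  have h4 : ∑ t ∈ Finset.range T, inner ℝ (c t - b t) v ≤
      D * ‖∑ t ∈ Finset.range T, (c t - b t)‖ := by
    rw [← sum_inner, mul_comm]
    refine (real_inner_le_norm _ _).trans ?_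
    gcongr
  have h5 : ∑ t ∈ Finset.range T, inner ℝ (G t) (Δ t - v) =
      ∑ t ∈ Finset.range T, inner ℝ (c t) (Δ t - v) +
      ∑ t ∈ Finset.range T, inner ℝ (b t - c t) (Δ t) +
      ∑ t ∈ Finset.range T, inner ℝ (G t - b t) (Δ t - v) +
      ∑ t ∈ Finset.range T, inner ℝ (c t - b t) v := by
    rw [← Finset.sum_add_distrib, ← Finset.sum_add_distrib, ← Finset.sum_add_distrib]
    refine Finset.sum_congr rfl fun t _ => ?_
    simp only [inner_sub_left, inner_sub_right]
    ring
  linarith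

variable {Ξ : Type*} {F : E d → Ξ → ℝ} {x₀ : E d} {ρ τ D : ℝ} {ξ : ℕ → Ξ} {s : ℕ → ℝ}
  {u : ℕ → Metric.sphere (0 : E d) 1}

theorem iter_succ_x (n : ℕ) : (iter F x₀ ρ τ D ξ s u (n + 1)).x =
    (iter F x₀ ρ τ D ξ s u n).x + (iter F x₀ ρ τ D ξ s u n).Δ := rfl

theorem iter_succ_w (n : ℕ) : (iter F x₀ ρ τ D ξ s u (n + 1)).w =
    (iter F x₀ ρ τ D ξ s u n).x + s n • (iter F x₀ ρ τ D ξ s u n).Δ := rfl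

theorem iter_calls (n : ℕ) : (iter F x₀ ρ τ D ξ s u n).calls = 2 * n := by
  induction n with
  | zero => rfl
  | succ n ih =>
    have h : (iter F x₀ ρ τ D ξ s u (n + 1)).calls = (iter F x₀ ρ τ D ξ s u n).calls + 2 := rfl
    rw [h, ih]; ring

theorem norm_iter_Δ_le (hD : 0 ≤ D) (n : ℕ) : ‖(iter F x₀ ρ τ D ξ s u n).Δ‖ ≤ D := by
  cases n with
  | zero => exact norm_zero.trans_le hD
  | succ n => exact norm_projBall_le hD _

theorem norm_iter_x_sub_le (hD : 0 ≤ D) (m n : ℕ) :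
    ‖(iter F x₀ ρ τ D ξ s u (m + n)).x - (iter F x₀ ρ τ D ξ s u m).x‖ ≤ n * D := by
  induction n with
  | zero => simp
  | succ n ih =>
    rw [← add_assoc, iter_succ_x, add_sub_right_comm]
    refine (norm_add_le _ _).trans ?_
    have := norm_iter_Δ_le (F := F) (x₀ := x₀) (ρ := ρ) (τ := τ) (ξ := ξ) (s := s) (u := u) hD
      (m + n)
    push_cast
    linarith

theorem norm_iter_w_sub_le (hD : 0 ≤ D) (hs : ∀ n, s n ∈ Set.Icc (0 : ℝ) 1) (m n : ℕ) :
    ‖(iter F x₀ ρ τ D ξ s u (m + n + 1)).w - (iter F x₀ ρ τ D ξ s u (m + 1)).w‖ ≤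
      (n + 1) * D := by
  cases n with
  | zero => simpa using hD
  | succ n =>
    -- The displacement consists of the last partial step, `n` full steps, and the rest of the first
    -- partial step, so `n + 2` pieces of length at most `D`.
    have h1 : (iter F x₀ ρ τ D ξ s u (m + (n + 1) + 1)).w - (iter F x₀ ρ τ D ξ s u (m + 1)).w =
        s (m + (n + 1)) • (iter F x₀ ρ τ D ξ s u (m + (n + 1))).Δ +
        ((iter F x₀ ρ τ D ξ s u (m + 1 + n)).x - (iter F x₀ ρ τ D ξ s u (m + 1)).x) +
        (1 - s m) • (iter F x₀ ρ τ D ξ s u m).Δ := by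
      rw [iter_succ_w, iter_succ_w, iter_succ_x, sub_smul, one_smul,
        show m + 1 + n = m + (n + 1) by ring]
      abel
    rw [h1]
    have hΔ := norm_iter_Δ_le (F := F) (x₀ := x₀) (ρ := ρ) (τ := τ) (ξ := ξ) (s := s) (u := u) hD
    have hx := norm_iter_x_sub_le (F := F) (x₀ := x₀) (ρ := ρ) (τ := τ) (ξ := ξ) (s := s) (u := u)
      hD (m + 1) n
    have hsm : ∀ (r : ℝ) (k : ℕ), r ∈ Set.Icc (0 : ℝ) 1 →
        ‖r • (iter F x₀ ρ τ D ξ s u k).Δ‖ ≤ D := by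
      intro r k hr
      rw [norm_smul, Real.norm_of_nonneg hr.1]
      exact (mul_le_of_le_one_left (norm_nonneg _) hr.2).trans (hΔ k)
    refine (norm_add₃_le).trans ?_
    have h2 := hsm _ (m + (n + 1)) (hs (m + (n + 1)))
    have h3 := hsm (1 - s m) m ⟨by linarith [(hs m).2], by linarith [(hs m).1]⟩
    push_cast
    linarith

theorem roundAverage_eq (T k : ℕ) : roundAverage F x₀ T ρ τ D ξ s u k =
    (T : ℝ)⁻¹ • ∑ t ∈ Finset.range T, (iter F x₀ ρ τ D ξ s u ((k - 1) * T + t + 1)).w := by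
  unfold roundAverage
  congr 1
  refine Finset.sum_nbij' (· - 1) (· + 1) ?_ ?_ ?_ ?_ ?_ <;> intro t ht <;>
    simp only [Finset.mem_Icc, Finset.mem_range] at ht ⊢
  any_goals omega
  rw [show (k - 1) * T + (t - 1) + 1 = (k - 1) * T + t by omega]

theorem dist_roundAverage_le (hD : 0 ≤ D) (hs : ∀ n, s n ∈ Set.Icc (0 : ℝ) 1) (T k : ℕ) {t : ℕ}
    (ht : t ∈ Finset.range T) :
    dist (iter F x₀ ρ τ D ξ s u ((k - 1) * T + t + 1)).w (roundAverage F x₀ T ρ τ D ξ s u k) ≤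
      T * D := by
  have ht' := Finset.mem_range.1 ht
  have hT : (T : ℝ) ≠ 0 := by
    have : T ≠ 0 := by omega
    exact_mod_cast this
  rw [dist_comm, ← Metric.mem_closedBall, roundAverage_eq, Finset.smul_sum]
  refine (convex_closedBall _ _).sum_mem (fun _ _ => by positivity) ?_ fun r hr => ?_
  · rw [Finset.sum_const, Finset.card_range, nsmul_eq_mul, mul_inv_cancel₀ hT]
  · have hr' := Finset.mem_range.1 hr
    set j := (k - 1) * T
    have key : ∀ a b : ℕ, a ≤ b → b < T →
        ‖(iter F x₀ ρ τ D ξ s u (j + b + 1)).w - (iter F x₀ ρ τ D ξ s u (j + a + 1)).w‖ ≤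
          T * D := by
      intro a b hab hb
      obtain ⟨e, rfl⟩ := Nat.exists_eq_add_of_le hab
      rw [← add_assoc]
      refine (norm_iter_w_sub_le hD hs (j + a) e).trans ?_
      have : ((e : ℝ) + 1) ≤ T := by exact_mod_cast (by omega : e + 1 ≤ T)
      gcongr
    rw [mem_closedBall_iff_norm]
    rcases le_total t r with h | h
    · exact key t r h hr'
    · rw [norm_sub_rev]; exact key r t h ht'

end Path

/-! ### Independent samples and their history -/

section History

set_option linter.unusedSectionVars false

variable {Ω Z : Type*} [mΩ : MeasurableSpace Ω] [mZ : MeasurableSpace Z] {μ : Measure Ω}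
  {z : ℕ → Ω → Z}

/-- The σ-algebra generated by the first `n` samples. -/
abbrev history (z : ℕ → Ω → Z) (n : ℕ) : MeasurableSpace Ω :=
  ⨆ i ∈ Set.Iio n, mZ.comap (z i)

theorem history_le (hz : ∀ n, Measurable (z n)) (n : ℕ) : history z n ≤ mΩ :=
  iSup₂_le fun i _ => (hz i).comap_le

theorem history_mono {m n : ℕ} (hmn : m ≤ n) : history z m ≤ history z n :=
  biSup_mono fun _ hi => lt_of_lt_of_le hi hmn

theorem measurable_sample_history {m n : ℕ} (hmn : m < n) : Measurable[history z n] (z m) := by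
  have h : mZ.comap (z m) ≤ history z n := le_iSup₂ (f := fun i (_ : i ∈ Set.Iio n) =>
    mZ.comap (z i)) m hmn
  exact (comap_measurable (z m)).mono h le_rfl

theorem indepFun_sample (hz : ∀ n, Measurable (z n)) (hind : iIndepFun z μ) {β : Type*}
    [MeasurableSpace β] {n : ℕ} {Y : Ω → β} (hY : Measurable[history z n] Y) :
    IndepFun Y (z n) μ := by
  have h1 : Indep (history z n) (⨆ i ∈ ({n} : Set ℕ), mZ.comap (z i)) μ :=
    indep_iSup_of_disjoint (fun i => (hz i).comap_le) hind.iIndep (by simp)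
  rw [iSup_singleton] at h1
  exact indep_of_indep_of_le_left h1 hY.comap_le

/-- The current sample can be integrated out with the past frozen. -/
theorem integral_eq_integral_integral_sample [IsProbabilityMeasure μ] (hz : ∀ n, Measurable (z n))
    (hind : iIndepFun z μ) {β : Type*} [MeasurableSpace β] {n : ℕ} {Y : Ω → β}
    (hY : Measurable[history z n] Y) {φ : β × Z → ℝ} (hφ : Measurable φ)
    (hi : Integrable (fun ω => φ (Y ω, z n ω)) μ) :
    ∫ ω, φ (Y ω, z n ω) ∂μ = ∫ ω, ∫ y, φ (Y ω, y) ∂(μ.map (z n)) ∂μ := by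
  have hYm : Measurable Y := hY.mono (history_le hz n) le_rfl
  have hprod := (indepFun_iff_map_prod_eq_prod_map_map hYm.aemeasurable (hz n).aemeasurable).1
    (indepFun_sample hz hind hY)
  have hpair : Measurable fun ω => (Y ω, z n ω) := hYm.prodMk (hz n)
  have : IsProbabilityMeasure (μ.map (z n)) := Measure.isProbabilityMeasure_map (hz n).aemeasurable
  have : IsProbabilityMeasure (μ.map Y) := Measure.isProbabilityMeasure_map hYm.aemeasurable
  have hi' : Integrable φ ((μ.map Y).prod (μ.map (z n))) := by
    rw [← hprod, integrable_map_measure hφ.aestronglyMeasurable hpair.aemeasurable]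
    exact hi
  rw [← integral_map (f := φ) hpair.aemeasurable hφ.aestronglyMeasurable, hprod,
    integral_prod _ hi', integral_map hYm.aemeasurable]
  exact hφ.stronglyMeasurable.integral_prod_right'.aestronglyMeasurable

end History

/-! ### The law of one sample -/

section SampleLaw

variable {d : ℕ} {Ξ : Type*} [MeasurableSpace Ξ]

/-- The samples `(ξ, s, u)` of one iteration. -/
abbrev Sample (d : ℕ) (Ξ : Type*) : Type _ := Ξ × ℝ × Metric.sphere (0 : E d) 1

/-- The distribution of the samples of one iteration. -/
def sampleLaw (d : ℕ) (P : Measure Ξ) : Measure (Sample d Ξ) :=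
  P.prod (((volume : Measure ℝ).restrict (Set.Icc 0 1)).prod (uniformSphere d))

instance : IsProbabilityMeasure ((volume : Measure ℝ).restrict (Set.Icc 0 1)) :=
  ⟨by simp⟩

variable {P : Measure Ξ} [IsProbabilityMeasure P]

instance [NeZero d] : IsProbabilityMeasure (sampleLaw d P) := by
  unfold sampleLaw; infer_instance

/-- Reordering puts `s` outermost: the oracle samples can then be integrated with the query point
fixed, and `s` afterwards. -/
theorem measurePreserving_sampleLaw [NeZero d] :
    MeasurePreserving (fun r : ℝ × (Ξ × Metric.sphere (0 : E d) 1) => (r.2.1, r.1, r.2.2))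
      (((volume : Measure ℝ).restrict (Set.Icc 0 1)).prod (P.prod (uniformSphere d)))
      (sampleLaw d P) := by
  set U := (volume : Measure ℝ).restrict (Set.Icc 0 1)
  have h1 := (measurePreserving_prodAssoc U P (uniformSphere d)).symm
  have h2 := (Measure.measurePreserving_swap (μ := U) (ν := P)).prod
    (MeasurePreserving.id (uniformSphere d))
  have h3 := measurePreserving_prodAssoc P U (uniformSphere d)
  exact h3.comp (h2.comp h1)

theorem integral_sampleLaw [NeZero d] {Φ : Sample d Ξ → ℝ} (hΦ : Integrable Φ (sampleLaw d P)) :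
    ∫ y, Φ y ∂(sampleLaw d P) = ∫ t in (0 : ℝ)..1,
      ∫ q : Ξ × Metric.sphere (0 : E d) 1, Φ (q.1, t, q.2) ∂(P.prod (uniformSphere d)) := by
  have hmp := measurePreserving_sampleLaw (d := d) (P := P)
  rw [intervalIntegral.integral_of_le zero_le_one, ← integral_Icc_eq_integral_Ioc, ← hmp.map_eq,
    integral_map hmp.measurable.aemeasurable
      (by rw [hmp.map_eq]; exact hΦ.aestronglyMeasurable)]
  exact integral_prod _ (hmp.integrable_comp_of_integrable hΦ)

end SampleLaw

/-! ### The stochastic process of a run -/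

section RunProcess

set_option linter.unusedSectionVars false

variable {d : ℕ} {Ξ Ω : Type*} [MeasurableSpace Ξ] [MeasurableSpace Ω]

/-- The state after `n` iterations, driven by a sequence of samples. -/
def run (F : E d → Ξ → ℝ) (x₀ : E d) (ρ τ D : ℝ) (z : ℕ → Ω → Sample d Ξ) (n : ℕ) (ω : Ω) :
    State d :=
  iter F x₀ ρ τ D (fun n => (z n ω).1) (fun n => (z n ω).2.1) (fun n => (z n ω).2.2) n

/-- The query point of iteration `n + 1`. -/
def runPoint (F : E d → Ξ → ℝ) (x₀ : E d) (ρ τ D : ℝ) (z : ℕ → Ω → Sample d Ξ) (n : ℕ) (ω : Ω) :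
    E d :=
  (run F x₀ ρ τ D z n ω).x + (z n ω).2.1 • (run F x₀ ρ τ D z n ω).Δ

/-- The clipped estimator of iteration `n + 1`. -/
def runClip (F : E d → Ξ → ℝ) (x₀ : E d) (ρ τ D : ℝ) (z : ℕ → Ω → Sample d Ξ) (n : ℕ) (ω : Ω) :
    E d :=
  clip (estimator F ρ (runPoint F x₀ ρ τ D z n ω) (z n ω).1 (z n ω).2.2.1) τ

variable {F : E d → Ξ → ℝ} {x₀ : E d} {ρ τ D : ℝ} {z : ℕ → Ω → Sample d Ξ}

theorem run_zero (ω : Ω) : (run F x₀ ρ τ D z 0 ω).x = x₀ ∧ (run F x₀ ρ τ D z 0 ω).Δ = 0 :=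
  ⟨rfl, rfl⟩

theorem run_succ_x (n : ℕ) (ω : Ω) : (run F x₀ ρ τ D z (n + 1) ω).x =
    (run F x₀ ρ τ D z n ω).x + (run F x₀ ρ τ D z n ω).Δ := rfl

theorem run_succ_Δ (n : ℕ) (ω : Ω) : (run F x₀ ρ τ D z (n + 1) ω).Δ =
    projBall D ((run F x₀ ρ τ D z n ω).Δ - (D / τ) • runClip F x₀ ρ τ D z n ω) := rfl

theorem norm_run_Δ_le (hD : 0 ≤ D) (n : ℕ) (ω : Ω) : ‖(run F x₀ ρ τ D z n ω).Δ‖ ≤ D :=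
  norm_iter_Δ_le hD n

theorem norm_run_x_sub_le (hD : 0 ≤ D) (n : ℕ) (ω : Ω) :
    ‖(run F x₀ ρ τ D z n ω).x - x₀‖ ≤ n * D := by
  have h := norm_iter_x_sub_le (F := F) (x₀ := x₀) (ρ := ρ) (τ := τ) (ξ := fun n => (z n ω).1)
    (s := fun n => (z n ω).2.1) (u := fun n => (z n ω).2.2) hD 0 n
  rw [zero_add] at h
  exact h

variable {P : Measure Ξ} [IsProbabilityMeasure P] {ℓ : Ξ → ℝ} {p L : ℝ}

namespace IsLipschitzOracle

theorem measurable_clip_of_measurable (h : IsLipschitzOracle P F ℓ p L) {α : Type*}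
    {m : MeasurableSpace α} {w : α → E d} {y : α → Ξ} {v : α → Metric.sphere (0 : E d) 1}
    (hw : Measurable w) (hy : Measurable y) (hv : Measurable v) :
    Measurable fun a => clip (estimator F ρ (w a) (y a) (v a).1) τ := by
  have h1 : Measurable fun a => (w a, y a, v a) := hw.prodMk (hy.prodMk hv)
  have h2 := (h.measurable_clip_estimator (ρ := ρ) (τ := τ)).comp h1
  simp only [Function.comp_def] at h2
  exact h2

theorem measurable_run (h : IsLipschitzOracle P F ℓ p L) (n : ℕ) :
    Measurable[history z n] (fun ω => (run F x₀ ρ τ D z n ω).x) ∧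
      Measurable[history z n] (fun ω => (run F x₀ ρ τ D z n ω).Δ) := by
  induction n with
  | zero => exact ⟨_root_.measurable_const, _root_.measurable_const⟩
  | succ n ih =>
    have hx := ih.1.mono (history_mono (Nat.le_succ n)) le_rfl
    have hΔ := ih.2.mono (history_mono (Nat.le_succ n)) le_rfl
    have hz : Measurable[history z (n + 1)] (z n) := measurable_sample_history (Nat.lt_succ_self n)
    have hs : Measurable[history z (n + 1)] fun ω => (z n ω).2.1 := hz.snd.fst
    have hw : Measurable[history z (n + 1)] (runPoint F x₀ ρ τ D z n) := hx.add (hs.smul hΔ)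
    have hc : Measurable[history z (n + 1)] (runClip F x₀ ρ τ D z n) :=
      h.measurable_clip_of_measurable hw hz.fst hz.snd.snd
    refine ⟨hx.add hΔ, ?_⟩
    simp only [run_succ_Δ]
    exact (measurable_projBall D).comp (hΔ.sub (hc.const_smul (D / τ)))

theorem measurable_runPoint (h : IsLipschitzOracle P F ℓ p L) (n : ℕ) :
    Measurable[history z (n + 1)] (runPoint F x₀ ρ τ D z n) := by
  have hx := (h.measurable_run (x₀ := x₀) (ρ := ρ) (τ := τ) (D := D) (z := z) n).1.mono
    (history_mono (Nat.le_succ n)) le_rfl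
  have hΔ := (h.measurable_run (x₀ := x₀) (ρ := ρ) (τ := τ) (D := D) (z := z) n).2.mono
    (history_mono (Nat.le_succ n)) le_rfl
  have hz : Measurable[history z (n + 1)] (z n) := measurable_sample_history (Nat.lt_succ_self n)
  exact hx.add (hz.snd.fst.smul hΔ)

theorem measurable_runClip (h : IsLipschitzOracle P F ℓ p L) (n : ℕ) :
    Measurable[history z (n + 1)] (runClip F x₀ ρ τ D z n) := by
  have hz : Measurable[history z (n + 1)] (z n) := measurable_sample_history (Nat.lt_succ_self n)
  exact h.measurable_clip_of_measurable (h.measurable_runPoint n) hz.fst hz.snd.snd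

end IsLipschitzOracle

/-- The samples are independent with the prescribed distribution. -/
structure IsSampleSequence (P : Measure Ξ) (μ : Measure Ω) (z : ℕ → Ω → Sample d Ξ) : Prop where
  measurable : ∀ n, Measurable (z n)
  law : ∀ n, μ.map (z n) = sampleLaw d P
  indep : iIndepFun z μ

variable {μ : Measure Ω} [IsProbabilityMeasure μ] [NeZero d]

/-- Integrating out the current sample, when the integrand is a function of the past `Y`, the
query point and the oracle samples. -/
theorem integral_run (h : IsLipschitzOracle P F ℓ p L) (hz : IsSampleSequence P μ z) (n : ℕ)
    {Y : Ω → E d} (hY : Measurable[history z n] Y)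
    {Φ : (E d × E d) × (Ξ × Metric.sphere (0 : E d) 1) → ℝ} (hΦ : Measurable Φ) {B : ℝ}
    (hB : ∀ ω w q, |Φ ((Y ω, w), q)| ≤ B) :
    ∫ ω, Φ ((Y ω, runPoint F x₀ ρ τ D z n ω), ((z n ω).1, (z n ω).2.2)) ∂μ =
      ∫ ω, (∫ t in (0 : ℝ)..1, ∫ q, Φ ((Y ω, (run F x₀ ρ τ D z n ω).x +
        t • (run F x₀ ρ τ D z n ω).Δ), q) ∂(P.prod (uniformSphere d))) ∂μ := by
  obtain ⟨hx, hΔ⟩ := h.measurable_run (x₀ := x₀) (ρ := ρ) (τ := τ) (D := D) (z := z) n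
  set φ : (E d × E d × E d) × Sample d Ξ → ℝ := fun r =>
    Φ ((r.1.1, r.1.2.1 + r.2.2.1 • r.1.2.2), (r.2.1, r.2.2.2)) with hφ
  have hφm : Measurable φ := by
    have h1 : Measurable fun r : (E d × E d × E d) × Sample d Ξ =>
        (((r.1.1, r.1.2.1 + r.2.2.1 • r.1.2.2), (r.2.1, r.2.2.2)) :
          (E d × E d) × (Ξ × Metric.sphere (0 : E d) 1)) := by fun_prop
    exact hΦ.comp h1
  have hYY : Measurable[history z n] fun ω =>
      (Y ω, (run F x₀ ρ τ D z n ω).x, (run F x₀ ρ τ D z n ω).Δ) := hY.prodMk (hx.prodMk hΔ)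
  have hpair : Measurable fun ω =>
      ((Y ω, (run F x₀ ρ τ D z n ω).x, (run F x₀ ρ τ D z n ω).Δ), z n ω) :=
    (hYY.mono (history_le hz.measurable n) le_rfl).prodMk (hz.measurable n)
  have key := integral_eq_integral_integral_sample hz.measurable hz.indep hYY hφm
    (Integrable.of_bound (hφm.comp hpair).aestronglyMeasurable B (.of_forall fun ω => hB _ _ _))
  refine key.trans ?_
  refine integral_congr_ae (.of_forall fun ω => ?_)
  simp only [hz.law]
  rw [integral_sampleLaw]
  refine Integrable.of_bound (C := B) ?_ (.of_forall fun y => hB _ _ _)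
  have h2 : Measurable fun y : Sample d Ξ =>
      ((Y ω, (run F x₀ ρ τ D z n ω).x, (run F x₀ ρ τ D z n ω).Δ), y) := measurable_prodMk_left
  exact (hφm.comp h2).aestronglyMeasurable

end RunProcess

/-! ### Expectations along a run -/

section Expectation

set_option linter.unusedSectionVars false

variable {d : ℕ} {Ξ Ω : Type*} [MeasurableSpace Ξ] [MeasurableSpace Ω]
  {F : E d → Ξ → ℝ} {x₀ : E d} {ρ τ D : ℝ} {z : ℕ → Ω → Sample d Ξ}
  {P : Measure Ξ} [IsProbabilityMeasure P] {ℓ : Ξ → ℝ} {p L : ℝ}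
  {μ : Measure Ω} [IsProbabilityMeasure μ] [NeZero d]

theorem measurable_clip_fst_snd (h : IsLipschitzOracle P F ℓ p L) :
    Measurable fun r : (E d × E d) × (Ξ × Metric.sphere (0 : E d) 1) =>
      clip (estimator F ρ r.1.2 r.2.1 r.2.2.1) τ :=
  h.measurable_clip_of_measurable (by fun_prop) (by fun_prop) (by fun_prop)

/-- The clipping noise is orthogonal to the past and to functions of the query point. -/
theorem integral_inner_clippedMean_sub (h : IsLipschitzOracle P F ℓ p L)
    (hz : IsSampleSequence P μ z) (hτ : 0 < τ) (n : ℕ) {Y : Ω → E d}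
    (hY : Measurable[history z n] Y) {Ψ : E d × E d → E d} (hΨ : Measurable Ψ) {B : ℝ}
    (hB : ∀ ω w, ‖Ψ (Y ω, w)‖ ≤ B) :
    ∫ ω, inner ℝ (clippedMean P F ρ τ (runPoint F x₀ ρ τ D z n ω) - runClip F x₀ ρ τ D z n ω)
      (Ψ (Y ω, runPoint F x₀ ρ τ D z n ω)) ∂μ = 0 := by
  set Φ : (E d × E d) × (Ξ × Metric.sphere (0 : E d) 1) → ℝ := fun r =>
    inner ℝ (clippedMean P F ρ τ r.1.2 - clip (estimator F ρ r.1.2 r.2.1 r.2.2.1) τ) (Ψ r.1)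
    with hΦdef
  have hmean : Measurable fun r : (E d × E d) × (Ξ × Metric.sphere (0 : E d) 1) =>
      clippedMean P F ρ τ r.1.2 := h.measurable_clippedMean.comp (by fun_prop)
  have hΦ : Measurable Φ :=
    (hmean.sub (measurable_clip_fst_snd h)).inner (hΨ.comp measurable_fst)
  have hbound : ∀ ω w q, |Φ ((Y ω, w), q)| ≤ 2 * τ * B := by
    intro ω w q
    refine (abs_real_inner_le_norm _ _).trans ?_
    refine mul_le_mul ?_ (hB ω w) (norm_nonneg _) (by positivity)
    refine (norm_sub_le _ _).trans ?_
    have h1 := IsLipschitzOracle.norm_clippedMean_le (P := P) (F := F) (ρ := ρ) hτ w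
    have h2 := norm_clip_le (estimator F ρ w q.1 q.2.1) hτ
    linarith
  have key := integral_run (x₀ := x₀) (ρ := ρ) (τ := τ) (D := D) h hz n hY hΦ hbound
  refine key.trans ?_
  -- With past and query point frozen, `clippedMean` is exactly the mean of the clipped estimator.
  have h0 : ∀ y w : E d, ∫ q, Φ ((y, w), q) ∂(P.prod (uniformSphere d)) = 0 := by
    intro y w
    have hi : Integrable (fun q : Ξ × Metric.sphere (0 : E d) 1 =>
        clippedMean P F ρ τ w - clip (estimator F ρ w q.1 q.2.1) τ) (P.prod (uniformSphere d)) :=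
      (integrable_const _).sub (h.integrable_clip hτ w)
    have h1 : ∀ q : Ξ × Metric.sphere (0 : E d) 1, Φ ((y, w), q) =
        inner ℝ (Ψ (y, w)) (clippedMean P F ρ τ w - clip (estimator F ρ w q.1 q.2.1) τ) :=
      fun q => real_inner_comm _ _
    simp_rw [h1]
    rw [integral_inner hi, integral_sub (integrable_const _) (h.integrable_clip hτ w)]
    simp [clippedMean]
  simp [h0]

theorem integral_norm_runClip_sq_le (h : IsLipschitzOracle P F ℓ p L)
    (hz : IsSampleSequence P μ z) (hρ : 0 < ρ) (hτ : 0 < τ) {T : ℝ} (hT : 0 < T)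
    (hτT : τ ^ p = T * (((d : ℝ) ^ (p / 2) + 1) * L ^ p)) (n : ℕ) :
    ∫ ω, ‖runClip F x₀ ρ τ D z n ω‖ ^ 2 ∂μ ≤ 8 / 5 * τ ^ 2 / T := by
  set Φ : (E d × E d) × (Ξ × Metric.sphere (0 : E d) 1) → ℝ := fun r =>
    ‖clip (estimator F ρ r.1.2 r.2.1 r.2.2.1) τ‖ ^ 2
  have hΦ : Measurable Φ := (measurable_clip_fst_snd h).norm.pow_const 2
  have key := integral_run (x₀ := x₀) (ρ := ρ) (τ := τ) (D := D) h hz n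
    (Y := fun _ => 0) measurable_const hΦ (B := τ ^ 2) (fun ω w q => by
      rw [abs_of_nonneg (sq_nonneg _)]
      exact pow_le_pow_left₀ (norm_nonneg _) (norm_clip_le _ hτ) 2)
  refine key.trans_le ?_
  have hin : ∀ ω, (∫ t in (0 : ℝ)..1, ∫ q, Φ ((0, (run F x₀ ρ τ D z n ω).x +
        t • (run F x₀ ρ τ D z n ω).Δ), q) ∂(P.prod (uniformSphere d))) ≤ 8 / 5 * τ ^ 2 / T := by
    intro ω
    rw [intervalIntegral.integral_of_le zero_le_one]
    refine (integral_mono_of_nonneg (g := fun _ => 8 / 5 * τ ^ 2 / T)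
      (.of_forall fun t => integral_nonneg fun q => sq_nonneg _)
      (integrable_const _) (.of_forall fun t => h.integral_norm_clip_sq_le hρ hτ hT hτT _)).trans ?_
    simp
  refine (integral_mono_of_nonneg (g := fun _ => 8 / 5 * τ ^ 2 / T)
    (.of_forall fun ω => ?_) (integrable_const _) (.of_forall hin)).trans ?_
  · exact intervalIntegral.integral_nonneg zero_le_one fun t _ =>
      integral_nonneg fun q => sq_nonneg _
  · simp

theorem continuous_smoothed {f : E d → ℝ} (hL : 0 ≤ L) (hρ : 0 < ρ)
    (hf : ∀ x y, |f x - f y| ≤ L * ‖x - y‖) : Continuous (smoothed f ρ) :=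
  continuous_iff_continuousAt.2 fun w => (hasGradientAt_smoothed hL hρ.ne' hf w).continuousAt

theorem integrable_smoothed_run (h : IsLipschitzOracle P F ℓ p L)
    (hz : IsSampleSequence P μ z) (hρ : 0 < ρ) (hD : 0 ≤ D) (n : ℕ) :
    Integrable (fun ω => smoothed (objective P F) ρ (run F x₀ ρ τ D z n ω).x) μ := by
  have hx := (h.measurable_run (x₀ := x₀) (ρ := ρ) (τ := τ) (D := D) (z := z) n).1.mono
    (history_le hz.measurable n) le_rfl
  have hf := h.abs_objective_sub_le
  refine Integrable.of_bound (C := |objective P F x₀| + L * (n * D) + L * ρ)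
    ((continuous_smoothed h.pos.le hρ hf).measurable.comp hx).aestronglyMeasurable
    (.of_forall fun ω => ?_)
  set x := (run F x₀ ρ τ D z n ω).x
  have h1 := abs_smoothed_sub_le h.pos.le hρ.le hf x
  have h2 := hf x x₀
  have h3 : L * ‖x - x₀‖ ≤ L * (n * D) :=
    mul_le_mul_of_nonneg_left (norm_run_x_sub_le hD n ω) h.pos.le
  rw [Real.norm_eq_abs]
  have h4 := abs_sub_abs_le_abs_sub (smoothed (objective P F) ρ x) (objective P F x)
  have h5 := abs_sub_abs_le_abs_sub (objective P F x) (objective P F x₀)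
  linarith

/-- In expectation, the linearization at the query point is the exact progress. -/
theorem integral_inner_smoothedGradient_run (h : IsLipschitzOracle P F ℓ p L)
    (hz : IsSampleSequence P μ z) (hρ : 0 < ρ) (hD : 0 ≤ D) (n : ℕ) :
    ∫ ω, inner ℝ (smoothedGradient (objective P F) ρ (runPoint F x₀ ρ τ D z n ω))
      (run F x₀ ρ τ D z n ω).Δ ∂μ =
      ∫ ω, smoothed (objective P F) ρ (run F x₀ ρ τ D z (n + 1) ω).x ∂μ -
        ∫ ω, smoothed (objective P F) ρ (run F x₀ ρ τ D z n ω).x ∂μ := by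
  have hf := h.abs_objective_sub_le
  set Φ : (E d × E d) × (Ξ × Metric.sphere (0 : E d) 1) → ℝ := fun r =>
    inner ℝ (smoothedGradient (objective P F) ρ r.1.2) r.1.1 with hΦdef
  have hΦ : Measurable Φ := by
    have := (continuous_smoothedGradient h.pos.le hρ hf).measurable
    exact (this.comp (by fun_prop)).inner (by fun_prop)
  have key := integral_run (x₀ := x₀) (ρ := ρ) (τ := τ) (D := D) h hz n
    (h.measurable_run (x₀ := x₀) (ρ := ρ) (τ := τ) (D := D) (z := z) n).2 hΦ (B := L * D)
    (fun ω w q => (abs_real_inner_le_norm _ _).trans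
      (mul_le_mul (norm_smoothedGradient_le h.pos.le hf w) (norm_run_Δ_le hD n ω)
        (norm_nonneg _) h.pos.le))
  refine key.trans ?_
  rw [← integral_sub (integrable_smoothed_run h hz hρ hD (n + 1))
    (integrable_smoothed_run h hz hρ hD n)]
  refine integral_congr_ae (.of_forall fun ω => ?_)
  simp only [hΦdef, integral_const, probReal_univ, one_smul]
  -- Averaging over the uniform `t` is integration along the segment from `x` to `x + Δ`, so it
  -- yields the exact increment.
  rw [integral_inner_smoothedGradient h.pos.le hρ hf, run_succ_x]

/-- The accumulated clipping noise of `m` iterations starting after iteration `j`. -/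
def runNoise (P : Measure Ξ) (F : E d → Ξ → ℝ) (x₀ : E d) (ρ τ D : ℝ) (z : ℕ → Ω → Sample d Ξ)
    (j m : ℕ) (ω : Ω) : E d :=
  ∑ t ∈ Finset.range m, (runClip F x₀ ρ τ D z (j + t) ω -
    clippedMean P F ρ τ (runPoint F x₀ ρ τ D z (j + t) ω))

theorem norm_runNoise_le (hτ : 0 < τ) (j m : ℕ) (ω : Ω) :
    ‖runNoise P F x₀ ρ τ D z j m ω‖ ≤ m * (2 * τ) := by
  refine (norm_sum_le_of_le (n := fun _ => 2 * τ) _ fun t _ => ?_).trans_eq (by simp)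
  refine (norm_sub_le _ _).trans ?_
  have h1 := IsLipschitzOracle.norm_clippedMean_le (P := P) (F := F) (ρ := ρ) hτ
    (runPoint F x₀ ρ τ D z (j + t) ω)
  have h2 : ‖runClip F x₀ ρ τ D z (j + t) ω‖ ≤ τ := norm_clip_le _ hτ
  linarith

theorem measurable_runNoise (h : IsLipschitzOracle P F ℓ p L) (j m : ℕ) :
    Measurable[history z (j + m)] (runNoise P F x₀ ρ τ D z j m) := by
  unfold runNoise
  refine Finset.measurable_sum _ fun t ht => ?_
  have hle : j + t + 1 ≤ j + m := by have := Finset.mem_range.1 ht; omega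
  have h1 := (h.measurable_runClip (x₀ := x₀) (ρ := ρ) (τ := τ) (D := D) (z := z) (j + t)).mono
    (history_mono hle) le_rfl
  have h2 := (h.measurable_runPoint (x₀ := x₀) (ρ := ρ) (τ := τ) (D := D) (z := z) (j + t)).mono
    (history_mono hle) le_rfl
  exact h1.sub (h.measurable_clippedMean.comp h2)

/-- Martingale increments are orthogonal, so second moments add up; centring only decreases them, so
each is bounded by that of the clipped estimator. -/
theorem integral_norm_runNoise_sq_le (h : IsLipschitzOracle P F ℓ p L)
    (hz : IsSampleSequence P μ z) (hρ : 0 < ρ) (hτ : 0 < τ) {T : ℝ} (hT : 0 < T)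
    (hτT : τ ^ p = T * (((d : ℝ) ^ (p / 2) + 1) * L ^ p)) (j m : ℕ) :
    ∫ ω, ‖runNoise P F x₀ ρ τ D z j m ω‖ ^ 2 ∂μ ≤ m * (8 / 5 * τ ^ 2 / T) := by
  have hle := history_le hz.measurable
  have hbd : ∀ {φ : Ω → ℝ} (_ : Measurable φ) {B : ℝ} (_ : ∀ ω, |φ ω| ≤ B), Integrable φ μ :=
    fun {φ} hφ {B} hB => Integrable.of_bound hφ.aestronglyMeasurable B (.of_forall hB)
  induction m with
  | zero => simp [runNoise]
  | succ m ih =>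
    set c := runClip F x₀ ρ τ D z (j + m) with hc
    set b : Ω → E d := fun ω => clippedMean P F ρ τ (runPoint F x₀ ρ τ D z (j + m) ω) with hb
    set S := runNoise P F x₀ ρ τ D z j m with hS
    have hcm : Measurable c := (h.measurable_runClip (j + m)).mono (hle _) le_rfl
    have hbm : Measurable b := h.measurable_clippedMean.comp
      ((h.measurable_runPoint (j + m)).mono (hle _) le_rfl)
    have hSm : Measurable S := (measurable_runNoise h j m).mono (hle _) le_rfl
    have hcn : ∀ ω, ‖c ω‖ ≤ τ := fun ω => norm_clip_le _ hτ
    have hbn : ∀ ω, ‖b ω‖ ≤ τ := fun ω => IsLipschitzOracle.norm_clippedMean_le hτ _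
    have hSn : ∀ ω, ‖S ω‖ ≤ m * (2 * τ) := fun ω => norm_runNoise_le hτ j m ω
    have e1 : ∫ ω, inner ℝ (b ω - c ω) (S ω) ∂μ = 0 :=
      integral_inner_clippedMean_sub h hz hτ (j + m) (measurable_runNoise h j m) measurable_fst
        (fun ω _ => hSn ω)
    have e2 : ∫ ω, inner ℝ (b ω - c ω) (b ω) ∂μ = 0 :=
      integral_inner_clippedMean_sub h hz hτ (j + m) (Y := fun _ => 0) measurable_const
        (Ψ := fun r => clippedMean P F ρ τ r.2) (h.measurable_clippedMean.comp measurable_snd)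
        (fun ω w => IsLipschitzOracle.norm_clippedMean_le hτ w)
    have e3 := integral_norm_runClip_sq_le (x₀ := x₀) (D := D) h hz hρ hτ hT hτT (j + m)
    -- The square is expanded so that both inner products have mean zero, one against the past noise
    -- and one against a function of the query point; `-‖b‖²` is dropped.
    have hle1 : ∀ ω, ‖runNoise P F x₀ ρ τ D z j (m + 1) ω‖ ^ 2 ≤ ‖S ω‖ ^ 2 -
        2 * inner ℝ (b ω - c ω) (S ω) + 2 * inner ℝ (b ω - c ω) (b ω) + ‖c ω‖ ^ 2 := by
      intro ω
      have h1 : runNoise P F x₀ ρ τ D z j (m + 1) ω = S ω - (b ω - c ω) := by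
        simp only [hS, hb, hc, runNoise, Finset.sum_range_succ]
        abel
      have h2 : ‖b ω - c ω‖ ^ 2 = ‖c ω‖ ^ 2 - ‖b ω‖ ^ 2 + 2 * inner ℝ (b ω - c ω) (b ω) := by
        rw [norm_sub_sq_real, inner_sub_left, real_inner_self_eq_norm_sq,
          real_inner_comm (b ω) (c ω)]
        ring
      rw [h1, norm_sub_sq_real, h2, real_inner_comm]
      nlinarith [sq_nonneg ‖b ω‖]
    have i1 : Integrable (fun ω => ‖S ω‖ ^ 2) μ := hbd (hSm.norm.pow_const 2) fun ω => by
      rw [abs_of_nonneg (sq_nonneg _)]; exact pow_le_pow_left₀ (norm_nonneg _) (hSn ω) 2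
    have i2 : Integrable (fun ω => ‖c ω‖ ^ 2) μ := hbd (hcm.norm.pow_const 2) fun ω => by
      rw [abs_of_nonneg (sq_nonneg _)]; exact pow_le_pow_left₀ (norm_nonneg _) (hcn ω) 2
    have hbc : ∀ ω, ‖b ω - c ω‖ ≤ 2 * τ := fun ω => by
      have := norm_sub_le (b ω) (c ω)
      linarith [hbn ω, hcn ω]
    have i3 : Integrable (fun ω => inner ℝ (b ω - c ω) (S ω)) μ :=
      hbd ((hbm.sub hcm).inner hSm) fun ω => (abs_real_inner_le_norm _ _).trans
        (mul_le_mul (hbc ω) (hSn ω) (norm_nonneg _) (by positivity))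
    have i4 : Integrable (fun ω => inner ℝ (b ω - c ω) (b ω)) μ :=
      hbd ((hbm.sub hcm).inner hbm) fun ω => (abs_real_inner_le_norm _ _).trans
        (mul_le_mul (hbc ω) (hbn ω) (norm_nonneg _) (by positivity))
    have j1 : Integrable (fun ω => ‖S ω‖ ^ 2 - 2 * inner ℝ (b ω - c ω) (S ω)) μ :=
      i1.sub (i3.const_mul 2)
    have j2 : Integrable (fun ω => ‖S ω‖ ^ 2 - 2 * inner ℝ (b ω - c ω) (S ω) +
        2 * inner ℝ (b ω - c ω) (b ω)) μ := j1.add (i4.const_mul 2)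
    have j3 : Integrable (fun ω => ‖S ω‖ ^ 2 - 2 * inner ℝ (b ω - c ω) (S ω) +
        2 * inner ℝ (b ω - c ω) (b ω) + ‖c ω‖ ^ 2) μ := j2.add i2
    refine (integral_mono_of_nonneg (.of_forall fun ω => sq_nonneg _) j3
      (.of_forall hle1)).trans ?_
    rw [integral_add j2 i2, integral_add j1 (i4.const_mul 2), integral_sub i1 (i3.const_mul 2),
      integral_const_mul, integral_const_mul, e1, e2]
    push_cast
    linarith

end Expectation

/-! ### Expected stationarity of the rounds -/

section Rounds

set_option linter.unusedSectionVars false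

variable {d : ℕ} {Ξ Ω : Type*} [MeasurableSpace Ξ] [MeasurableSpace Ω]
  {F : E d → Ξ → ℝ} {x₀ : E d} {ρ τ D : ℝ} {z : ℕ → Ω → Sample d Ξ}
  {P : Measure Ξ} [IsProbabilityMeasure P] {ℓ : Ξ → ℝ} {p L : ℝ}
  {μ : Measure Ω} [IsProbabilityMeasure μ] [NeZero d]

/-- The sum of the smoothed gradients over `T` iterations starting after iteration `j`. -/
def roundGradient (P : Measure Ξ) (F : E d → Ξ → ℝ) (x₀ : E d) (ρ τ D : ℝ)
    (z : ℕ → Ω → Sample d Ξ) (j T : ℕ) (ω : Ω) : E d :=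
  ∑ t ∈ Finset.range T, smoothedGradient (objective P F) ρ (runPoint F x₀ ρ τ D z (j + t) ω)

theorem measurable_roundGradient (h : IsLipschitzOracle P F ℓ p L) (hz : IsSampleSequence P μ z)
    (hρ : 0 < ρ) (j T : ℕ) : Measurable (roundGradient P F x₀ ρ τ D z j T) :=
  Finset.measurable_sum _ fun t _ =>
    (continuous_smoothedGradient h.pos.le hρ h.abs_objective_sub_le).measurable.comp
      ((h.measurable_runPoint (j + t)).mono (history_le hz.measurable _) le_rfl)

theorem norm_roundGradient_le (h : IsLipschitzOracle P F ℓ p L) (j T : ℕ) (ω : Ω) :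
    ‖roundGradient P F x₀ ρ τ D z j T ω‖ ≤ T * L :=
  (norm_sum_le_of_le (n := fun _ => L) _ fun _ _ =>
    norm_smoothedGradient_le h.pos.le h.abs_objective_sub_le _).trans_eq (by simp)

theorem integrable_norm_roundGradient (h : IsLipschitzOracle P F ℓ p L)
    (hz : IsSampleSequence P μ z) (hρ : 0 < ρ) (j T : ℕ) :
    Integrable (fun ω => ‖roundGradient P F x₀ ρ τ D z j T ω‖) μ :=
  Integrable.of_bound (measurable_roundGradient h hz hρ j T).norm.aestronglyMeasurable (T * L)
    (.of_forall fun ω => by rw [norm_norm]; exact norm_roundGradient_le h j T ω)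

/-- The expected form of the one-round bound. In units of `D τ`: `2` from the diameter, `16/5` from
the bias, `1/2` from Young's inequality, and `4/5` each from the second moments of the clipped
gradients and of the noise sum, in total `73/10`. -/
theorem integral_norm_roundGradient_le (h : IsLipschitzOracle P F ℓ p L)
    (hz : IsSampleSequence P μ z) (hρ : 0 < ρ) (hτ : 0 < τ) (hD : 0 < D) {T : ℕ} (hT : 0 < T)
    (hτT : τ ^ p = T * (((d : ℝ) ^ (p / 2) + 1) * L ^ p)) (j : ℕ) :
    D * ∫ ω, ‖roundGradient P F x₀ ρ τ D z j T ω‖ ∂μ ≤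
      ∫ ω, smoothed (objective P F) ρ (run F x₀ ρ τ D z j ω).x ∂μ -
        ∫ ω, smoothed (objective P F) ρ (run F x₀ ρ τ D z (j + T) ω).x ∂μ +
        73 / 10 * (D * τ) := by
  have hT' : (0 : ℝ) < T := by exact_mod_cast hT
  have hle := history_le hz.measurable
  have hbd : ∀ {φ : Ω → ℝ} (_ : Measurable φ) {B : ℝ} (_ : ∀ ω, |φ ω| ≤ B), Integrable φ μ :=
    fun {φ} hφ {B} hB => Integrable.of_bound hφ.aestronglyMeasurable B (.of_forall hB)
  set Δ : ℕ → Ω → E d := fun t ω => (run F x₀ ρ τ D z (j + t) ω).Δ with hΔdef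
  set c : ℕ → Ω → E d := fun t ω => runClip F x₀ ρ τ D z (j + t) ω with hc
  set b : ℕ → Ω → E d := fun t ω =>
    clippedMean P F ρ τ (runPoint F x₀ ρ τ D z (j + t) ω) with hb
  set G : ℕ → Ω → E d := fun t ω =>
    smoothedGradient (objective P F) ρ (runPoint F x₀ ρ τ D z (j + t) ω) with hG
  set N : Ω → E d := runNoise P F x₀ ρ τ D z j T with hN
  have hΔm : ∀ t, Measurable (Δ t) := fun t => (h.measurable_run (j + t)).2.mono (hle _) le_rfl
  have hcm : ∀ t, Measurable (c t) := fun t =>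
    (h.measurable_runClip (j + t)).mono (hle _) le_rfl
  have hwm : ∀ t, Measurable (runPoint F x₀ ρ τ D z (j + t)) := fun t =>
    (h.measurable_runPoint (j + t)).mono (hle _) le_rfl
  have hbm : ∀ t, Measurable (b t) := fun t => h.measurable_clippedMean.comp (hwm t)
  have hGm : ∀ t, Measurable (G t) := fun t =>
    (continuous_smoothedGradient h.pos.le hρ h.abs_objective_sub_le).measurable.comp (hwm t)
  have hNm : Measurable N := (measurable_runNoise h j T).mono (hle _) le_rfl
  have hΔn : ∀ t ω, ‖Δ t ω‖ ≤ D := fun t ω => norm_run_Δ_le hD.le _ ω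
  have hcn : ∀ t ω, ‖c t ω‖ ≤ τ := fun t ω => norm_clip_le _ hτ
  have hbn : ∀ t ω, ‖b t ω‖ ≤ τ := fun t ω => IsLipschitzOracle.norm_clippedMean_le hτ _
  have hGn : ∀ t ω, ‖G t ω‖ ≤ L := fun t ω =>
    norm_smoothedGradient_le h.pos.le h.abs_objective_sub_le _
  have hNn : ∀ ω, ‖N ω‖ ≤ T * (2 * τ) := fun ω => norm_runNoise_le hτ j T ω
  have iA : ∀ t, Integrable (fun ω => inner ℝ (G t ω) (Δ t ω)) μ := fun t =>
    hbd ((hGm t).inner (hΔm t)) fun ω => (abs_real_inner_le_norm _ _).trans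
      (mul_le_mul (hGn t ω) (hΔn t ω) (norm_nonneg _) h.pos.le)
  have iC : ∀ t, Integrable (fun ω => ‖c t ω‖ ^ 2) μ := fun t =>
    hbd ((hcm t).norm.pow_const 2) fun ω => by
      rw [abs_of_nonneg (sq_nonneg _)]; exact pow_le_pow_left₀ (norm_nonneg _) (hcn t ω) 2
  have iI : ∀ t, Integrable (fun ω => inner ℝ (b t ω - c t ω) (Δ t ω)) μ := fun t =>
    hbd (((hbm t).sub (hcm t)).inner (hΔm t)) fun ω => (abs_real_inner_le_norm _ _).trans
      (mul_le_mul ((norm_sub_le _ _).trans (add_le_add (hbn t ω) (hcn t ω))) (hΔn t ω)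
        (norm_nonneg _) (by positivity))
  have iN : Integrable (fun ω => ‖N ω‖ ^ 2) μ := hbd (hNm.norm.pow_const 2) fun ω => by
    rw [abs_of_nonneg (sq_nonneg _)]; exact pow_le_pow_left₀ (norm_nonneg _) (hNn ω) 2
  have sA : Integrable (fun ω => ∑ t ∈ Finset.range T, inner ℝ (G t ω) (Δ t ω)) μ :=
    integrable_finsetSum _ fun t _ => iA t
  have sC : Integrable (fun ω => ∑ t ∈ Finset.range T, ‖c t ω‖ ^ 2) μ :=
    integrable_finsetSum _ fun t _ => iC t
  have sI : Integrable (fun ω => ∑ t ∈ Finset.range T, inner ℝ (b t ω - c t ω) (Δ t ω)) μ :=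
    integrable_finsetSum _ fun t _ => iI t
  have eA : ∫ ω, ∑ t ∈ Finset.range T, inner ℝ (G t ω) (Δ t ω) ∂μ =
      ∫ ω, smoothed (objective P F) ρ (run F x₀ ρ τ D z (j + T) ω).x ∂μ -
        ∫ ω, smoothed (objective P F) ρ (run F x₀ ρ τ D z j ω).x ∂μ := by
    rw [integral_finsetSum _ fun t _ => iA t]
    rw [Finset.sum_congr rfl fun t _ =>
      integral_inner_smoothedGradient_run (x₀ := x₀) (τ := τ) h hz hρ hD.le (j + t)]
    exact Finset.sum_range_sub (fun t =>
      ∫ ω, smoothed (objective P F) ρ (run F x₀ ρ τ D z (j + t) ω).x ∂μ) T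
  have eC : ∫ ω, ∑ t ∈ Finset.range T, ‖c t ω‖ ^ 2 ∂μ ≤ 8 / 5 * τ ^ 2 := by
    rw [integral_finsetSum _ fun t _ => iC t]
    refine (Finset.sum_le_sum fun t _ =>
      integral_norm_runClip_sq_le (x₀ := x₀) (D := D) h hz hρ hτ hT' hτT (j + t)).trans_eq ?_
    rw [Finset.sum_const, Finset.card_range, nsmul_eq_mul]
    field_simp
  have eI : ∫ ω, ∑ t ∈ Finset.range T, inner ℝ (b t ω - c t ω) (Δ t ω) ∂μ = 0 := by
    rw [integral_finsetSum _ fun t _ => iI t]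
    exact Finset.sum_eq_zero fun t _ => integral_inner_clippedMean_sub h hz hτ (j + t)
      (h.measurable_run (j + t)).2 measurable_fst (fun ω _ => hΔn t ω)
  have eN : ∫ ω, ‖N ω‖ ^ 2 ∂μ ≤ 8 / 5 * τ ^ 2 := by
    refine (integral_norm_runNoise_sq_le (x₀ := x₀) (D := D) h hz hρ hτ hT' hτT j T).trans_eq ?_
    field_simp
  have hpt : ∀ ω, D * ‖roundGradient P F x₀ ρ τ D z j T ω‖ ≤
      (57 / 10 * (D * τ) - ∑ t ∈ Finset.range T, inner ℝ (G t ω) (Δ t ω)) +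
        D / (2 * τ) * ∑ t ∈ Finset.range T, ‖c t ω‖ ^ 2 +
        ∑ t ∈ Finset.range T, inner ℝ (b t ω - c t ω) (Δ t ω) + D / (2 * τ) * ‖N ω‖ ^ 2 := by
    intro ω
    have h1 := norm_sum_le_of_projected_descent (B := 8 / 5 * τ / T) hD hτ
      (G := fun t => G t ω) (b := fun t => b t ω) (c := fun t => c t ω) (Δ := fun t => Δ t ω)
      (fun t => hΔn t ω) (fun t => run_succ_Δ (j + t) ω)
      (fun t => h.norm_smoothedGradient_sub_clippedMean_le hρ hτ hT' hτT _) T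
    have h2 : 2 * D * T * (8 / 5 * τ / T) = 16 / 5 * (D * τ) := by field_simp; norm_num
    -- Young's inequality lets the second moment of the noise stand in for its first moment.
    have h3 : D * ‖N ω‖ ≤ D / (2 * τ) * ‖N ω‖ ^ 2 + D * τ / 2 := by
      have : D / (2 * τ) * ‖N ω‖ ^ 2 + D * τ / 2 - D * ‖N ω‖ =
          D / (2 * τ) * (‖N ω‖ - τ) ^ 2 := by field_simp; ring
      have : 0 ≤ D / (2 * τ) * (‖N ω‖ - τ) ^ 2 := by positivity
      linarith
    have h4 : ∑ t ∈ Finset.range T, (c t ω - b t ω) = N ω := rfl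
    have h5 : ∑ t ∈ Finset.range T, G t ω = roundGradient P F x₀ ρ τ D z j T ω := rfl
    simp only [h2, h4, h5] at h1
    linarith
  have j0 : Integrable (fun ω => 57 / 10 * (D * τ) -
      ∑ t ∈ Finset.range T, inner ℝ (G t ω) (Δ t ω)) μ := (integrable_const _).sub sA
  have j1 : Integrable (fun ω => (57 / 10 * (D * τ) -
      ∑ t ∈ Finset.range T, inner ℝ (G t ω) (Δ t ω)) +
        D / (2 * τ) * ∑ t ∈ Finset.range T, ‖c t ω‖ ^ 2) μ := j0.add (sC.const_mul _)
  have j2 : Integrable (fun ω => (57 / 10 * (D * τ) -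
      ∑ t ∈ Finset.range T, inner ℝ (G t ω) (Δ t ω)) +
        D / (2 * τ) * ∑ t ∈ Finset.range T, ‖c t ω‖ ^ 2 +
        ∑ t ∈ Finset.range T, inner ℝ (b t ω - c t ω) (Δ t ω)) μ := j1.add sI
  have j3 : Integrable (fun ω => (57 / 10 * (D * τ) -
      ∑ t ∈ Finset.range T, inner ℝ (G t ω) (Δ t ω)) +
        D / (2 * τ) * ∑ t ∈ Finset.range T, ‖c t ω‖ ^ 2 +
        ∑ t ∈ Finset.range T, inner ℝ (b t ω - c t ω) (Δ t ω) +
        D / (2 * τ) * ‖N ω‖ ^ 2) μ := j2.add (iN.const_mul _)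
  rw [← integral_const_mul]
  refine (integral_mono ((integrable_norm_roundGradient h hz hρ j T).const_mul D) j3 hpt).trans ?_
  rw [integral_add j2 (iN.const_mul _), integral_add j1 sI, integral_add j0 (sC.const_mul _),
    integral_sub (integrable_const _) sA, integral_const, integral_const_mul, integral_const_mul,
    eA, eI]
  have hc0 : 0 ≤ D / (2 * τ) := by positivity
  have k1 := mul_le_mul_of_nonneg_left eC hc0
  have k2 := mul_le_mul_of_nonneg_left eN hc0
  have k3 : D / (2 * τ) * (8 / 5 * τ ^ 2) = 4 / 5 * (D * τ) := by field_simp; norm_num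
  simp only [probReal_univ, one_smul]
  linarith

/-- The progress telescopes over the rounds; replacing the smoothed values by `f` at the start and
by the infimum at the end costs `L ρ` each. -/
theorem sum_integral_norm_roundGradient_le (h : IsLipschitzOracle P F ℓ p L)
    (hz : IsSampleSequence P μ z) (hρ : 0 < ρ) (hτ : 0 < τ) (hD : 0 < D) {T : ℕ} (hT : 0 < T)
    (hτT : τ ^ p = T * (((d : ℝ) ^ (p / 2) + 1) * L ^ p)) {Δ₀ : ℝ}
    (hbdd : BddBelow (Set.range (objective P F)))
    (hΔ₀ : objective P F x₀ - ⨅ x, objective P F x ≤ Δ₀) (K : ℕ) :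
    D * ∑ k ∈ Finset.range K, ∫ ω, ‖roundGradient P F x₀ ρ τ D z (k * T) T ω‖ ∂μ ≤
      Δ₀ + 2 * (L * ρ) + K * (73 / 10 * (D * τ)) := by
  set V : ℕ → ℝ := fun n => ∫ ω, smoothed (objective P F) ρ (run F x₀ ρ τ D z n ω).x ∂μ
  have hf := h.abs_objective_sub_le
  have h1 : D * ∑ k ∈ Finset.range K, ∫ ω, ‖roundGradient P F x₀ ρ τ D z (k * T) T ω‖ ∂μ ≤
      ∑ k ∈ Finset.range K, (V (k * T) - V ((k + 1) * T) + 73 / 10 * (D * τ)) := by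
    rw [Finset.mul_sum]
    refine Finset.sum_le_sum fun k _ => ?_
    rw [add_one_mul]
    exact integral_norm_roundGradient_le h hz hρ hτ hD hT hτT (k * T)
  rw [Finset.sum_add_distrib, Finset.sum_range_sub' (fun k => V (k * T)), Finset.sum_const,
    Finset.card_range, nsmul_eq_mul, zero_mul] at h1
  have h2 : V 0 ≤ objective P F x₀ + L * ρ := by
    have : V 0 = smoothed (objective P F) ρ x₀ := by
      simp only [V, run_zero, integral_const, probReal_univ, one_smul]
    linarith [(abs_le.1 (abs_smoothed_sub_le h.pos.le hρ.le hf x₀)).2]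
  have h3 : (⨅ x, objective P F x) - L * ρ ≤ V (K * T) := by
    have := integral_mono (integrable_const ((⨅ x, objective P F x) - L * ρ))
      (integrable_smoothed_run (x₀ := x₀) (τ := τ) h hz hρ hD.le (K * T)) fun ω => by
        have a1 := (abs_le.1 (abs_smoothed_sub_le h.pos.le hρ.le hf
          (run F x₀ ρ τ D z (K * T) ω).x)).1
        have a2 := ciInf_le hbdd (run F x₀ ρ τ D z (K * T) ω).x
        show _ ≤ smoothed (objective P F) ρ (run F x₀ ρ τ D z (K * T) ω).x
        linarith
    simpa using this
  linarith

end Rounds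

/-! ### The randomly selected output -/

section Output

set_option linter.unusedSectionVars false

/-- A uniformly random index, independent of the family it selects from. -/
theorem integral_uniform_index {Ω : Type*} [MeasurableSpace Ω] {μ : Measure Ω}
    [IsProbabilityMeasure μ] {K : ℕ} {κ : Ω → ℕ} (hκ : Measurable κ)
    (hlaw : μ.map κ = uniformOn (Set.Icc 1 K)) {g : ℕ → Ω → ℝ} (hg : ∀ k, Integrable (g k) μ)
    (hind : ∀ k, IndepFun (g k) κ μ) :
    Integrable (fun ω => g (κ ω) ω) μ ∧
      ∫ ω, g (κ ω) ω ∂μ = (K : ℝ)⁻¹ * ∑ k ∈ Finset.Icc 1 K, ∫ ω, g k ω ∂μ := by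
  set e : ℕ → ℕ → ℝ := fun k => Set.indicator {k} 1 with he
  have hem : ∀ k, Measurable (e k) := fun k => measurable_from_top
  have hei : ∀ k, Integrable (fun ω => e k (κ ω)) μ := fun k =>
    Integrable.of_bound ((hem k).comp hκ).aestronglyMeasurable 1 (.of_forall fun ω => by
      by_cases h : κ ω = k <;> simp [he, h])
  have hmem : ∀ᵐ ω ∂μ, κ ω ∈ Set.Icc 1 K := by
    have h1 : ∀ᵐ k ∂(μ.map κ), k ∈ Set.Icc 1 K := by
      rw [hlaw]
      exact ae_cond_mem (Set.finite_Icc 1 K).measurableSet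
    exact ae_of_ae_map hκ.aemeasurable h1
  have hprob : ∀ k ∈ Finset.Icc 1 K, ∫ ω, e k (κ ω) ∂μ = (K : ℝ)⁻¹ := by
    intro k hk
    rw [← integral_map (f := e k) hκ.aemeasurable (hem k).aestronglyMeasurable, hlaw, he,
      integral_indicator_one (MeasurableSet.singleton k), measureReal_def, uniformOn,
      cond_apply (Set.finite_Icc 1 K).measurableSet,
      Set.inter_eq_right.2 (Set.singleton_subset_iff.2 (Set.mem_Icc.2 (Finset.mem_Icc.1 hk))),
      Measure.count_singleton, ← Finset.coe_Icc, Measure.count_apply_finset]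
    simp
  have hmul : ∀ k, Integrable (fun ω => g k ω * e k (κ ω)) μ := fun k =>
    ((hind k).comp measurable_id (hem k)).integrable_mul (hg k) (hei k)
  -- Writing the selection as a sum of indicators reduces the claim to independence of `g k` and `κ`
  -- for each fixed `k`.
  have hsum : (fun ω => g (κ ω) ω) =ᵐ[μ] fun ω => ∑ k ∈ Finset.Icc 1 K, g k ω * e k (κ ω) := by
    filter_upwards [hmem] with ω hω
    rw [Finset.sum_eq_single (κ ω)]
    · simp [he]
    · intro k _ hk
      simp [he, hk.symm]
    · intro hk
      exact absurd (Finset.mem_Icc.2 hω) hk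
  refine ⟨(integrable_congr hsum).2 (integrable_finsetSum _ fun k _ => hmul k), ?_⟩
  rw [integral_congr_ae hsum, integral_finsetSum _ fun k _ => hmul k, Finset.mul_sum]
  refine Finset.sum_congr rfl fun k hk => ?_
  have hmul' : ∫ ω, g k ω * e k (κ ω) ∂μ = (∫ ω, g k ω ∂μ) * ∫ ω, e k (κ ω) ∂μ :=
    ((hind k).comp measurable_id (hem k)).integral_mul_eq_mul_integral
      (hg k).aestronglyMeasurable (hei k).aestronglyMeasurable
  rw [hmul', hprob k hk, mul_comm]

variable {d : ℕ} {Ξ Ω : Type*} [MeasurableSpace Ξ] [MeasurableSpace Ω] {P : Measure Ξ}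
  {μ : Measure Ω} {K : ℕ} {ξ : ℕ → Ω → Ξ} {s : ℕ → Ω → ℝ}
  {u : ℕ → Ω → Metric.sphere (0 : E d) 1} {κ : Ω → ℕ}

theorem IsSampling.isSampleSequence (hS : IsSampling P K μ ξ s u κ) :
    IsSampleSequence P μ fun n ω => (ξ n ω, s n ω, u n ω) where
  measurable n := (hS.measurable_ξ n).prodMk ((hS.measurable_s n).prodMk (hS.measurable_u n))
  law := hS.law
  indep := hS.indep

theorem IsSampling.ae_mem_Icc [NeZero d] [IsProbabilityMeasure P] (hS : IsSampling P K μ ξ s u κ) :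
    ∀ᵐ ω ∂μ, ∀ n, s n ω ∈ Set.Icc (0 : ℝ) 1 := by
  refine ae_all_iff.2 fun n => ?_
  have hz := hS.isSampleSequence.measurable n
  have h1 : ∀ᵐ y ∂(sampleLaw d P), y.2.1 ∈ Set.Icc (0 : ℝ) 1 := by
    have hU : ∀ᵐ t ∂((volume : Measure ℝ).restrict (Set.Icc 0 1)), t ∈ Set.Icc (0 : ℝ) 1 :=
      ae_restrict_mem measurableSet_Icc
    have h2 : ∀ᵐ y ∂(((volume : Measure ℝ).restrict (Set.Icc 0 1)).prod (uniformSphere d)),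
        y.1 ∈ Set.Icc (0 : ℝ) 1 := Measure.quasiMeasurePreserving_fst.ae hU
    exact Measure.quasiMeasurePreserving_snd.ae h2
  rw [sampleLaw, ← hS.law n] at h1
  exact ae_of_ae_map hz.aemeasurable h1

theorem history_le_comap_sequence {Z : Type*} [MeasurableSpace Z] (z : ℕ → Ω → Z) (n : ℕ) :
    history z n ≤ MeasurableSpace.comap (fun ω n => z n ω) MeasurableSpace.pi := by
  refine iSup₂_le fun i _ => ?_
  have h1 : Measurable[MeasurableSpace.comap (fun ω n => z n ω) MeasurableSpace.pi] (z i) :=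
    (measurable_pi_apply i).comp (comap_measurable fun ω n => z n ω)
  exact h1.comap_le

variable [IsProbabilityMeasure P] [IsProbabilityMeasure μ] [NeZero d] {F : E d → Ξ → ℝ}
  {x₀ : E d} {ρ τ D : ℝ} {ℓ : Ξ → ℝ} {p L : ℝ}

theorem IsLipschitzOracle.measurable_roundAverage (h : IsLipschitzOracle P F ℓ p L) (T k : ℕ) :
    Measurable[MeasurableSpace.comap (fun ω n => (ξ n ω, s n ω, u n ω)) MeasurableSpace.pi]
      fun ω => roundAverage F x₀ T ρ τ D (fun n => ξ n ω) (fun n => s n ω) (fun n => u n ω) k := by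
  simp only [roundAverage_eq]
  have hsum := Finset.measurable_sum (Finset.range T) fun t _ =>
    (h.measurable_runPoint (x₀ := x₀) (ρ := ρ) (τ := τ) (D := D)
    (z := fun n ω => (ξ n ω, s n ω, u n ω)) ((k - 1) * T + t)).mono
      (history_le_comap_sequence _ _) le_rfl
  exact hsum.const_smul (T : ℝ)⁻¹

theorem goldsteinNorm_roundAverage_le (h : IsLipschitzOracle P F ℓ p L) (hρ : 0 < ρ) (hD : 0 ≤ D)
    {T : ℕ} (hT : 0 < T) {δ : ℝ} (hδ : T * D + ρ ≤ δ) (k : ℕ) {ω : Ω}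
    (hs : ∀ n, s n ω ∈ Set.Icc (0 : ℝ) 1) :
    goldsteinNorm (objective P F) δ (roundAverage F x₀ T ρ τ D (fun n => ξ n ω) (fun n => s n ω)
      (fun n => u n ω) k) ≤ (T : ℝ)⁻¹ * ‖roundGradient P F x₀ ρ τ D
        (fun n ω => (ξ n ω, s n ω, u n ω)) ((k - 1) * T) T ω‖ := by
  have h1 := goldsteinNorm_le_norm_average (δ := δ) h.pos.le h.abs_objective_sub_le hρ
    (Finset.nonempty_range_iff.2 hT.ne')
    (fun t => runPoint F x₀ ρ τ D (fun n ω => (ξ n ω, s n ω, u n ω)) ((k - 1) * T + t) ω)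
    (roundAverage F x₀ T ρ τ D (fun n => ξ n ω) (fun n => s n ω) (fun n => u n ω) k)
    (fun t ht => (add_le_add_left (dist_roundAverage_le (F := F) (x₀ := x₀) (ρ := ρ) (τ := τ)
      (ξ := fun n => ξ n ω) (u := fun n => u n ω) hD hs T k ht) ρ).trans hδ)
  refine h1.trans_eq ?_
  rw [Finset.card_range, norm_smul, Real.norm_of_nonneg (by positivity)]
  rfl

/-- The expected Goldstein stationarity of the randomly selected round average. -/
theorem integral_goldsteinNorm_le (h : IsLipschitzOracle P F ℓ p L)
    (hS : IsSampling P K μ ξ s u κ) {T : ℕ} (hT : 0 < T) (hK : 0 < K) (hτ : 0 < τ)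
    (hτT : τ ^ p = T * (((d : ℝ) ^ (p / 2) + 1) * L ^ p)) {Δ₀ : ℝ}
    (hbdd : BddBelow (Set.range (objective P F)))
    (hΔ₀ : objective P F x₀ - ⨅ x, objective P F x ≤ Δ₀) {δ : ℝ} (hδ : 0 < δ)
    (hρ : ρ = δ / 2) (hD : D = δ / (2 * T)) {wOut : Ω → E d}
    (hw : ∀ ω, wOut ω = roundAverage F x₀ T ρ τ D (fun n => ξ n ω) (fun n => s n ω)
      (fun n => u n ω) (κ ω)) :
    Integrable (fun ω => goldsteinNorm (objective P F) δ (wOut ω)) μ ∧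
      ∫ ω, goldsteinNorm (objective P F) δ (wOut ω) ∂μ ≤
        (2 * Δ₀ + 2 * δ * L) / (δ * K) + 73 / 10 * (τ / T) := by
  have hT' : (0 : ℝ) < T := by exact_mod_cast hT
  have hK' : (0 : ℝ) < K := by exact_mod_cast hK
  have hρ0 : 0 < ρ := by rw [hρ]; positivity
  have hD0 : 0 < D := by rw [hD]; positivity
  have hz := hS.isSampleSequence
  have hf := h.abs_objective_sub_le
  set g : ℕ → Ω → ℝ := fun k ω => goldsteinNorm (objective P F) δ (roundAverage F x₀ T ρ τ D
    (fun n => ξ n ω) (fun n => s n ω) (fun n => u n ω) k) with hg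
  have hseq : Measurable fun ω n => (ξ n ω, s n ω, u n ω) := measurable_pi_lambda _ hz.measurable
  have hgm : ∀ k, Measurable[MeasurableSpace.comap (fun ω n => (ξ n ω, s n ω, u n ω))
      MeasurableSpace.pi] (g k) := fun k =>
    (measurable_goldsteinNorm h.pos.le hf hδ).comp (h.measurable_roundAverage T k)
  have hgi : ∀ k, Integrable (g k) μ := fun k =>
    Integrable.of_bound ((hgm k).mono hseq.comap_le le_rfl).aestronglyMeasurable L
      (.of_forall fun ω => by
        rw [Real.norm_of_nonneg (goldsteinNorm_nonneg _ _ _)]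
        exact goldsteinNorm_le h.pos.le hf hδ _)
  have hind : ∀ k, IndepFun (g k) κ μ := fun k =>
    indep_of_indep_of_le_left hS.indep_κ (hgm k).comap_le
  obtain ⟨hi, he⟩ := integral_uniform_index hS.measurable_κ hS.law_κ hgi hind
  simp only [hw]
  refine ⟨hi, he.trans_le ?_⟩
  have hround : ∀ k, ∫ ω, g k ω ∂μ ≤ (T : ℝ)⁻¹ * ∫ ω, ‖roundGradient P F x₀ ρ τ D
      (fun n ω => (ξ n ω, s n ω, u n ω)) ((k - 1) * T) T ω‖ ∂μ := fun k => by
    rw [← integral_const_mul]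
    refine integral_mono_ae (hgi k)
      ((integrable_norm_roundGradient h hz hρ0 _ T).const_mul _) ?_
    filter_upwards [hS.ae_mem_Icc] with ω hω
    refine goldsteinNorm_roundAverage_le h hρ0 hD0.le hT (le_of_eq ?_) k hω
    rw [hD, hρ]
    field_simp
    norm_num
  have hsum := sum_integral_norm_roundGradient_le (x₀ := x₀) h hz hρ0 hτ hD0 hT hτT hbdd hΔ₀ K
  set S := ∑ k ∈ Finset.range K, ∫ ω, ‖roundGradient P F x₀ ρ τ D
    (fun n ω => (ξ n ω, s n ω, u n ω)) (k * T) T ω‖ ∂μ with hSdef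
  have hle : ∑ k ∈ Finset.Icc 1 K, ∫ ω, g k ω ∂μ ≤ (T : ℝ)⁻¹ * S := by
    rw [hSdef, Finset.mul_sum, ← Finset.Ico_add_one_right_eq_Icc, Finset.sum_Ico_eq_sum_range]
    refine Finset.sum_le_sum fun k _ => ?_
    have := hround (1 + k)
    rwa [Nat.add_sub_cancel_left] at this
  refine (mul_le_mul_of_nonneg_left hle (by positivity)).trans ?_
  have h1 : (K : ℝ)⁻¹ * ((T : ℝ)⁻¹ * S) = 2 / (δ * K) * (D * S) := by
    rw [hD]; field_simp
  rw [h1]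
  refine (mul_le_mul_of_nonneg_left hsum (by positivity)).trans_eq ?_
  rw [hD, hρ]
  field_simp

theorem integral_goldsteinNorm_le_lipschitz (h : IsLipschitzOracle P F ℓ p L) {δ : ℝ} (hδ : 0 < δ)
    {w : Ω → E d} (hi : Integrable (fun ω => goldsteinNorm (objective P F) δ (w ω)) μ) :
    ∫ ω, goldsteinNorm (objective P F) δ (w ω) ∂μ ≤ L := by
  have := integral_mono hi (integrable_const L) fun ω =>
    goldsteinNorm_le h.pos.le h.abs_objective_sub_le hδ (w ω)
  simpa using this

end Output

/-! ### The choice of the parameters -/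

section Parameters

theorem two_rpow_le {a : ℝ} (ha : a ≤ 1 / 2) : (2 : ℝ) ^ a ≤ 3 / 2 := by
  refine (Real.rpow_le_rpow_of_exponent_le one_le_two ha).trans ?_
  rw [← Real.sqrt_eq_rpow, Real.sqrt_le_left (by norm_num)]
  norm_num

theorem three_rpow_le {a : ℝ} (ha : a ≤ 1 / 2) : (3 : ℝ) ^ a ≤ 9 / 5 := by
  refine (Real.rpow_le_rpow_of_exponent_le (by norm_num) ha).trans ?_
  rw [← Real.sqrt_eq_rpow, Real.sqrt_le_left (by norm_num)]
  norm_num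

theorem exponent_add_exponent {p : ℝ} (hp : 1 < p) :
    p / (2 * p - 1) + (p - 1) / (2 * p - 1) = 1 := by
  rw [← add_div, div_eq_one_iff_eq (by linarith)]
  ring

/-- The length `min(⌈(G / y)^{p/(2p-1)}⌉, ⌊M / 2⌋)` of a round balances the two error terms. -/
theorem round_error_le {p G y : ℝ} (hp1 : 1 < p) (hp2 : p ≤ 2) (hG : 0 < G) (hy : 0 < y)
    {M T : ℕ} (hM : 2 ≤ M) (hT : T = min ⌈(G / y) ^ (p / (2 * p - 1))⌉₊ (M / 2)) :
    y * (M / (M / T : ℕ)) + 73 / 10 * (G * (T : ℝ) ^ (-((p - 1) / p))) ≤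
      max (12 * (y * (G / y) ^ (p / (2 * p - 1)))) (16 * G / (M : ℝ) ^ ((p - 1) / p)) + y := by
  have hp : 0 < p := by linarith
  have hq0 : 0 ≤ (p - 1) / p := div_nonneg (by linarith) hp.le
  have hq : (p - 1) / p ≤ 1 / 2 := by rw [div_le_iff₀ hp]; linarith
  set q := (p - 1) / p with hqdef
  set A := (G / y) ^ (p / (2 * p - 1)) with hA
  have hA0 : 0 < A := Real.rpow_pos_of_pos (div_pos hG hy) _
  -- `A` is the real minimizer up to constants: `y A = G A^{-q}`, so both error terms agree at `T =
  -- A`.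
  have hyA : y = G * A ^ (-(q + 1)) := by
    rw [hA, ← Real.rpow_mul (div_pos hG hy).le]
    have : p / (2 * p - 1) * -(q + 1) = -1 := by
      have h1 : 2 * p - 1 ≠ 0 := by linarith
      have h2 : q + 1 = (2 * p - 1) / p := by rw [hqdef]; field_simp; ring
      rw [h2, mul_neg, div_mul_div_cancel₀ h1, div_self hp.ne']
    rw [this, Real.rpow_neg_one]
    field_simp
  have hsub : ∀ {t : ℝ}, 0 < t → G * t ^ (-(q + 1)) * t = G * t ^ (-q) := fun {t} ht => by
    rw [mul_assoc, ← Real.rpow_add_one ht.ne', neg_add_rev, neg_add_cancel_comm]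
  have hAq : y * A = G * A ^ (-q) := by
    conv_lhs => rw [hyA]
    exact hsub hA0
  have hT1 : 1 ≤ T := by
    have : 1 ≤ ⌈A⌉₊ := Nat.one_le_ceil_iff.2 hA0
    omega
  have hT0 : (0 : ℝ) < T := by exact_mod_cast hT1
  have hTM : 2 * T ≤ M := by omega
  set K := M / T with hK
  have hK2 : 2 ≤ K := (Nat.le_div_iff_mul_le hT1).2 hTM
  have hK0 : (0 : ℝ) < K := by exact_mod_cast (by omega : 0 < K)
  -- The cap `T ≤ M/2` gives `K ≥ 2`, hence `M < (K + 1) T ≤ 3/2 K T`.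
  have hKT : (M : ℝ) / K ≤ 3 / 2 * T := by
    rw [div_le_iff₀ hK0]
    have h1 : M < (K + 1) * T := by
      have := Nat.lt_div_mul_add (a := M) hT1
      rw [← hK] at this
      linarith
    have h2 : 2 * M ≤ 3 * T * K := by nlinarith
    have h3 : (2 : ℝ) * M ≤ 3 * T * K := by exact_mod_cast h2
    linarith
  have hZ : 0 < y * A := by positivity
  -- Uncapped: for `T ≥ 2` the terms are at most `3 y A` and `7.3 y A`, below `12 y A`; for `T = 1`
  -- the first is exactly the extra `y`. Capped: `T < A` makes the noise term dominate, and `(3/2 +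
  -- 7.3) · 9/5 < 16`.
  rcases le_or_gt ⌈A⌉₊ (M / 2) with hcase | hcase
  · have hTA : T = ⌈A⌉₊ := by omega
    have hAT : A ≤ T := hTA ▸ Nat.le_ceil A
    have h1 : G * (T : ℝ) ^ (-q) ≤ y * A := by
      rw [hAq]
      exact mul_le_mul_of_nonneg_left
        (Real.rpow_le_rpow_of_nonpos hA0 hAT (by linarith)) hG.le
    refine le_trans ?_ (add_le_add_left (le_max_left _ _) _)
    rcases hT1.eq_or_lt with h | h
    · have h2 : (M : ℝ) / K = 1 := by
        rw [hK, ← h, Nat.div_one, div_self]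
        exact_mod_cast (by omega : M ≠ 0)
      rw [h2]
      linarith
    · have hA1 : 1 < A := by
        have : 1 < ⌈A⌉₊ := hTA ▸ h
        simpa using Nat.lt_ceil.1 this
      have h2 : (T : ℝ) < A + 1 := hTA ▸ Nat.ceil_lt_add_one hA0.le
      have h3 : y * (M / K) ≤ y * (3 * A) :=
        mul_le_mul_of_nonneg_left (by linarith) hy.le
      linarith
  · have hTA : T = M / 2 := by omega
    have hlt : (T : ℝ) < A := Nat.lt_ceil.1 (hTA ▸ hcase)
    have h1 : y * T ≤ G * (T : ℝ) ^ (-q) := by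
      rw [← hsub hT0]
      refine mul_le_mul_of_nonneg_right ?_ hT0.le
      conv_lhs => rw [hyA]
      exact mul_le_mul_of_nonneg_left
        (Real.rpow_le_rpow_of_nonpos hT0 hlt.le (by linarith)) hG.le
    have h2 : y * (M / K) ≤ 3 / 2 * (y * T) :=
      (mul_le_mul_of_nonneg_left hKT hy.le).trans_eq (by ring)
    have hM0 : (0 : ℝ) < M := by exact_mod_cast (by omega : 0 < M)
    have h3 : (M : ℝ) / 3 ≤ T := by
      have : M ≤ 3 * T := by omega
      have : (M : ℝ) ≤ 3 * T := by exact_mod_cast this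
      linarith
    have h4 : (T : ℝ) ^ (-q) ≤ 9 / 5 * (M : ℝ) ^ (-q) := by
      refine (Real.rpow_le_rpow_of_nonpos (by positivity) h3 (by linarith)).trans ?_
      rw [Real.div_rpow hM0.le (by norm_num), Real.rpow_neg (by norm_num : (0 : ℝ) ≤ 3),
        div_inv_eq_mul, mul_comm]
      exact mul_le_mul_of_nonneg_right (three_rpow_le hq) (by positivity)
    have h5 : G * (T : ℝ) ^ (-q) ≤ 9 / 5 * (G * (M : ℝ) ^ (-q)) :=
      (mul_le_mul_of_nonneg_left h4 hG.le).trans_eq (by ring)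
    have h6 : 16 * G / (M : ℝ) ^ q = 16 * (G * (M : ℝ) ^ (-q)) := by
      rw [Real.rpow_neg hM0.le]; ring
    have h7 : 0 < G * (M : ℝ) ^ (-q) := by positivity
    refine le_trans ?_ (add_le_add_left (le_max_right _ _) _)
    linarith

/-- A number of iterations that makes the balanced error at most `ε`. -/
theorem balanced_error_le {p G y N ε m : ℝ} (hp1 : 1 < p) (hG : 0 < G) (hy : 0 < y)
    (hε : 0 < ε) (hεN : ε < N) (hGN : G ≤ 2 * N)
    (hyC : (64 : ℝ) ^ ((2 * p - 1) / (p - 1)) * y ≤ 2 * ε * (ε / N) ^ (p / (p - 1)))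
    (hm : (64 : ℝ) ^ ((2 * p - 1) / (p - 1)) * (N / ε) ^ (p / (p - 1)) ≤ m) :
    max (12 * (y * (G / y) ^ (p / (2 * p - 1)))) (16 * G / m ^ ((p - 1) / p)) + y ≤ ε := by
  have hp : 0 < p := by linarith
  have hp' : 0 < p - 1 := by linarith
  have hp'' : 0 < 2 * p - 1 := by linarith
  have hN : 0 < N := hε.trans hεN
  set C : ℝ := (64 : ℝ) ^ ((2 * p - 1) / (p - 1)) with hC
  have hC64 : 64 ≤ C := by
    have : (1 : ℝ) ≤ (2 * p - 1) / (p - 1) := by rw [le_div_iff₀ hp']; linarith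
    calc (64 : ℝ) = 64 ^ (1 : ℝ) := (Real.rpow_one _).symm
      _ ≤ C := Real.rpow_le_rpow_of_exponent_le (by norm_num) this
  have hC0 : 0 < C := by linarith
  have hr1 : (ε / N) ^ (p / (p - 1)) ≤ 1 :=
    Real.rpow_le_one (by positivity) ((div_le_one hN).2 hεN.le) (by positivity)
  have hy1 : y ≤ ε / 2 := by
    have h1 : C * y ≤ 2 * ε :=
      hyC.trans (mul_le_of_le_one_right (by positivity) hr1)
    nlinarith
  -- The quantity equals `G^a y^{1-a}` with `a = p/(2p-1)`. The exponent in `C` is the reciprocal of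
  -- `1 - a`, so `C` contributes exactly `64`; the powers of `N` cancel, leaving `2 ε / 64`.
  have hZ : y * (G / y) ^ (p / (2 * p - 1)) ≤ ε / 32 := by
    have ha : 0 < (p - 1) / (2 * p - 1) := by positivity
    have h1 : y * (G / y) ^ (p / (2 * p - 1)) =
        G ^ (p / (2 * p - 1)) * y ^ ((p - 1) / (2 * p - 1)) := by
      rw [Real.div_rpow hG.le hy.le]
      have : y ^ ((p - 1) / (2 * p - 1)) = y / y ^ (p / (2 * p - 1)) := by
        rw [show (p - 1) / (2 * p - 1) = 1 - p / (2 * p - 1) by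
          linarith [exponent_add_exponent hp1],
          Real.rpow_sub hy, Real.rpow_one]
      rw [this]; ring
    have h2 : y ≤ 2 * ε * (ε / N) ^ (p / (p - 1)) / C := by
      rw [le_div_iff₀ hC0]; linarith
    have hCa : C ^ ((p - 1) / (2 * p - 1)) = 64 := by
      rw [hC, ← Real.rpow_mul (by norm_num),
        show (2 * p - 1) / (p - 1) * ((p - 1) / (2 * p - 1)) = 1 by field_simp, Real.rpow_one]
    have h3 : y ^ ((p - 1) / (2 * p - 1)) ≤
        2 ^ ((p - 1) / (2 * p - 1)) * ε ^ ((p - 1) / (2 * p - 1)) *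
          (ε / N) ^ (p / (2 * p - 1)) / 64 := by
      refine (Real.rpow_le_rpow hy.le h2 ha.le).trans_eq ?_
      rw [Real.div_rpow (by positivity) hC0.le, hCa, Real.mul_rpow (by positivity) (by positivity),
        Real.mul_rpow (by norm_num) hε.le, ← Real.rpow_mul (by positivity),
        show p / (p - 1) * ((p - 1) / (2 * p - 1)) = p / (2 * p - 1) by field_simp]
    have h4 : G ^ (p / (2 * p - 1)) ≤ 2 ^ (p / (2 * p - 1)) * N ^ (p / (2 * p - 1)) := by
      rw [← Real.mul_rpow (by norm_num) hN.le]
      exact Real.rpow_le_rpow hG.le hGN (by positivity)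
    rw [h1]
    refine (mul_le_mul h4 h3 (by positivity) (by positivity)).trans_eq ?_
    rw [Real.div_rpow hε.le hN.le]
    have e1 : (2 : ℝ) ^ (p / (2 * p - 1)) * 2 ^ ((p - 1) / (2 * p - 1)) = 2 := by
      rw [← Real.rpow_add (by norm_num), exponent_add_exponent hp1, Real.rpow_one]
    have e2 : ε ^ (p / (2 * p - 1)) * ε ^ ((p - 1) / (2 * p - 1)) = ε := by
      rw [← Real.rpow_add hε, exponent_add_exponent hp1, Real.rpow_one]
    have hNr : 0 < N ^ (p / (2 * p - 1)) := by positivity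
    calc _ = (2 ^ (p / (2 * p - 1)) * 2 ^ ((p - 1) / (2 * p - 1))) *
          (ε ^ (p / (2 * p - 1)) * ε ^ ((p - 1) / (2 * p - 1))) / 64 := by field_simp
      _ = ε / 32 := by rw [e1, e2]; ring
  have hm0 : 0 < m := lt_of_lt_of_le (by positivity) hm
  have hmq : 16 * G / m ^ ((p - 1) / p) ≤ ε / 2 := by
    have hq0 : 0 < (p - 1) / p := by positivity
    have h1 : 64 * (N / ε) ≤ m ^ ((p - 1) / p) := by
      refine le_trans ?_ (Real.rpow_le_rpow (by positivity) hm hq0.le)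
      rw [Real.mul_rpow hC0.le (by positivity),
        ← Real.rpow_mul (by positivity : 0 ≤ N / ε) (p / (p - 1)),
        show p / (p - 1) * ((p - 1) / p) = 1 by field_simp, Real.rpow_one, hC,
        ← Real.rpow_mul (by norm_num),
        show (2 * p - 1) / (p - 1) * ((p - 1) / p) = (2 * p - 1) / p by field_simp]
      refine mul_le_mul_of_nonneg_right ?_ (by positivity)
      have : (1 : ℝ) ≤ (2 * p - 1) / p := by rw [le_div_iff₀ hp]; linarith
      calc (64 : ℝ) = 64 ^ (1 : ℝ) := (Real.rpow_one _).symm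
        _ ≤ _ := Real.rpow_le_rpow_of_exponent_le (by norm_num) this
    rw [div_le_iff₀ (by positivity)]
    have h2 : ε / 2 * (64 * (N / ε)) = 32 * N := by field_simp; norm_num
    have h3 := mul_le_mul_of_nonneg_left h1 (by positivity : 0 ≤ ε / 2)
    linarith
  have hmax : max (12 * (y * (G / y) ^ (p / (2 * p - 1)))) (16 * G / m ^ ((p - 1) / p)) ≤ ε / 2 :=
    max_le (by linarith) hmq
  linarith

variable {p L Δ δ : ℝ} {d M T : ℕ}

theorem clipLevel_pos (hL : 0 < L) (hT : 0 < T) : 0 < clipLevel p L d T := by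
  unfold clipLevel; positivity

theorem clipLevel_rpow (hp : 0 < p) (hL : 0 < L) :
    clipLevel p L d T ^ p = T * (((d : ℝ) ^ (p / 2) + 1) * L ^ p) := by
  unfold clipLevel
  rw [Real.mul_rpow (by positivity) (by positivity), Real.mul_rpow (by positivity) hL.le,
    ← Real.rpow_mul (by positivity), ← Real.rpow_mul (by positivity), one_div_mul_cancel hp.ne',
    Real.rpow_one, Real.rpow_one]
  ring

theorem clipLevel_div (hp : 0 < p) (hT : 0 < T) : clipLevel p L d T / T =
    L * ((d : ℝ) ^ (p / 2) + 1) ^ (1 / p) * (T : ℝ) ^ (-((p - 1) / p)) := by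
  have hT' : (0 : ℝ) < T := by exact_mod_cast hT
  have : (T : ℝ) ^ (-((p - 1) / p)) = (T : ℝ) ^ (1 / p) / T := by
    rw [show -((p - 1) / p) = 1 / p - 1 by field_simp; ring, Real.rpow_sub hT', Real.rpow_one]
  rw [this, clipLevel]
  ring

theorem roundLength_eq :
    roundLength p L Δ δ d M = min ⌈(L * ((d : ℝ) ^ (p / 2) + 1) ^ (1 / p) /
      ((2 * Δ + 2 * δ * L) / (δ * M))) ^ (p / (2 * p - 1))⌉₊ (M / 2) := by
  unfold roundLength
  rw [add_comm (2 * δ * L), div_div_eq_mul_div]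
  congr 4
  ring

theorem roundLength_pos (hH : 0 < 2 * Δ + 2 * δ * L) (hδ : 0 < δ) (hL : 0 < L) (hM : 2 ≤ M) :
    0 < roundLength p L Δ δ d M := by
  have hM' : (0 : ℝ) < M := by exact_mod_cast (by omega : 0 < M)
  rw [roundLength_eq]
  have : 0 < ⌈(L * ((d : ℝ) ^ (p / 2) + 1) ^ (1 / p) /
      ((2 * Δ + 2 * δ * L) / (δ * M))) ^ (p / (2 * p - 1))⌉₊ := Nat.ceil_pos.2 (by positivity)
  omega

/-- The factor `2` in `2 (Δ + δ L)` enters with exponent at most `1/2`, hence costs at most `3/2`,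
and `12 · 3/2 = 18`. -/
theorem twelve_mul_balanced_error_le (hp1 : 1 < p) (hH : 0 < 2 * Δ + 2 * δ * L) (hδ : 0 < δ)
    (hL : 0 < L) (hM : 0 < M) :
    12 * ((2 * Δ + 2 * δ * L) / (δ * M) * (L * ((d : ℝ) ^ (p / 2) + 1) ^ (1 / p) /
      ((2 * Δ + 2 * δ * L) / (δ * M))) ^ (p / (2 * p - 1))) ≤
    18 * (Δ + δ * L) ^ ((p - 1) / (2 * p - 1)) *
      ((d : ℝ) ^ (p / 2) * L ^ p + L ^ p) ^ (1 / (2 * p - 1)) /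
        (δ * M) ^ ((p - 1) / (2 * p - 1)) := by
  have hM' : (0 : ℝ) < M := by exact_mod_cast hM
  have hp : 0 < p := by linarith
  have hp'' : 0 < 2 * p - 1 := by linarith
  set y := (2 * Δ + 2 * δ * L) / (δ * M) with hy
  have hy0 : 0 < y := by positivity
  set B := (d : ℝ) ^ (p / 2) + 1 with hB
  have hB0 : 0 < B := by positivity
  have hG : (L * B ^ (1 / p)) ^ (p / (2 * p - 1)) =
      ((d : ℝ) ^ (p / 2) * L ^ p + L ^ p) ^ (1 / (2 * p - 1)) := by
    rw [← add_one_mul, ← hB, Real.mul_rpow hL.le (by positivity), ← Real.rpow_mul hB0.le,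
      Real.mul_rpow hB0.le (by positivity), ← Real.rpow_mul hL.le,
      show 1 / p * (p / (2 * p - 1)) = 1 / (2 * p - 1) by field_simp,
      show p * (1 / (2 * p - 1)) = p / (2 * p - 1) by field_simp, mul_comm]
  have hH' : 0 < Δ + δ * L := by linarith
  have hya : y / y ^ (p / (2 * p - 1)) = 2 ^ ((p - 1) / (2 * p - 1)) *
      (Δ + δ * L) ^ ((p - 1) / (2 * p - 1)) / (δ * M) ^ ((p - 1) / (2 * p - 1)) := by
    rw [← Real.mul_rpow (by norm_num) hH'.le, ← Real.div_rpow (by positivity) (by positivity),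
      show 2 * (Δ + δ * L) / (δ * M) = y by rw [hy]; ring,
      show (p - 1) / (2 * p - 1) = 1 - p / (2 * p - 1) by
          linarith [exponent_add_exponent hp1], Real.rpow_sub hy0,
      Real.rpow_one]
  rw [Real.div_rpow (by positivity) hy0.le, hG, mul_div_left_comm, hya]
  have h2 : (2 : ℝ) ^ ((p - 1) / (2 * p - 1)) ≤ 3 / 2 :=
    two_rpow_le (by rw [div_le_div_iff₀ hp'' two_pos]; linarith)
  set W := (Δ + δ * L) ^ ((p - 1) / (2 * p - 1)) *
    ((d : ℝ) ^ (p / 2) * L ^ p + L ^ p) ^ (1 / (2 * p - 1)) /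
      (δ * M) ^ ((p - 1) / (2 * p - 1)) with hW
  have hW0 : 0 ≤ W := by positivity
  calc _ = 12 * (2 ^ ((p - 1) / (2 * p - 1)) * W) := by rw [hW]; ring
    _ ≤ 12 * (3 / 2 * W) := by gcongr
    _ = _ := by rw [hW]; ring

theorem mul_add_one_rpow_le (hp1 : 1 < p) (hL : 0 < L) (hd : 1 ≤ d) :
    L * ((d : ℝ) ^ (p / 2) + 1) ^ (1 / p) ≤ 2 * ((d : ℝ) ^ (1 / 2 : ℝ) * L) := by
  have hp : 0 < p := by linarith
  have hd' : (1 : ℝ) ≤ d := by exact_mod_cast hd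
  have h1 : (1 : ℝ) ≤ (d : ℝ) ^ (p / 2) := Real.one_le_rpow hd' (by positivity)
  have h2 : (d : ℝ) ^ (p / 2) + 1 ≤ (2 * (d : ℝ) ^ (1 / 2 : ℝ)) ^ p := by
    rw [Real.mul_rpow (by norm_num) (by positivity), ← Real.rpow_mul (by positivity),
      one_div_mul_eq_div]
    have : (2 : ℝ) ≤ 2 ^ p := by
      calc (2 : ℝ) = 2 ^ (1 : ℝ) := (Real.rpow_one _).symm
        _ ≤ _ := Real.rpow_le_rpow_of_exponent_le (by norm_num) hp1.le
    nlinarith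
  have h3 : ((d : ℝ) ^ (p / 2) + 1) ^ (1 / p) ≤ 2 * (d : ℝ) ^ (1 / 2 : ℝ) := by
    refine (Real.rpow_le_rpow (by positivity) h2 (by positivity)).trans_eq ?_
    rw [← Real.rpow_mul (by positivity), mul_one_div_cancel hp.ne', Real.rpow_one]
  nlinarith

/-- In terms of `N = √d L` the sample size becomes a ratio times `(N/ε)^{p/(p-1)}`, the form in
which the error bound is solved for `M`. -/
theorem sampleSize_eq {ε : ℝ} (hp1 : 1 < p) (hL : 0 < L) (hε : 0 < ε) :
    sampleSize p L Δ δ ε d = (Δ + δ * L) / (δ * ε) *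
      ((d : ℝ) ^ (1 / 2 : ℝ) * L / ε) ^ (p / (p - 1)) := by
  have hp' : 0 < p - 1 := by linarith
  unfold sampleSize
  rw [Real.div_rpow (by positivity) hε.le, Real.mul_rpow (by positivity) hL.le,
    ← Real.rpow_mul (by positivity),
    show 1 / 2 * (p / (p - 1)) = p / (2 * (p - 1)) by field_simp,
    show (2 * p - 1) / (p - 1) = 1 + p / (p - 1) by field_simp; ring, Real.rpow_add hε,
    Real.rpow_one]
  field_simp

theorem sampleSize_le {ε : ℝ} (hL : 0 < L) (hδ : 0 < δ) (hδ1 : δ < 1) (hε : 0 < ε) :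
    sampleSize p L Δ δ ε d ≤ (Δ + L) * L ^ (p / (p - 1)) *
      ((d : ℝ) ^ (p / (2 * (p - 1))) * δ⁻¹ * ε ^ (-((2 * p - 1) / (p - 1)))) := by
  have h1 : Δ + δ * L ≤ Δ + L := by nlinarith
  unfold sampleSize
  rw [Real.rpow_neg hε.le]
  calc _ = (Δ + δ * L) * (L ^ (p / (p - 1)) *
        ((d : ℝ) ^ (p / (2 * (p - 1))) * δ⁻¹ * (ε ^ ((2 * p - 1) / (p - 1)))⁻¹)) := by
        rw [div_eq_mul_inv, mul_inv]; ring
    _ ≤ (Δ + L) * (L ^ (p / (p - 1)) *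
        ((d : ℝ) ^ (p / (2 * (p - 1))) * δ⁻¹ * (ε ^ ((2 * p - 1) / (p - 1)))⁻¹)) := by gcongr
    _ = _ := by ring

/-- Lets the additive constant, caused by `M ≥ 2` and the ceiling, be absorbed into the rate. -/
theorem one_le_rate {ε : ℝ} (hp1 : 1 < p) (hd : 1 ≤ d) (hδ : 0 < δ) (hδ1 : δ < 1) (hε : 0 < ε)
    (hε1 : ε < 1) :
    1 ≤ (d : ℝ) ^ (p / (2 * (p - 1))) * δ⁻¹ * ε ^ (-((2 * p - 1) / (p - 1))) := by
  have hp' : 0 < p - 1 := by linarith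
  have hd' : (1 : ℝ) ≤ d := by exact_mod_cast hd
  have h1 : 1 ≤ (d : ℝ) ^ (p / (2 * (p - 1))) := Real.one_le_rpow hd' (by positivity)
  have h2 : 1 ≤ δ⁻¹ := (one_le_inv₀ hδ).2 hδ1.le
  have h3 : 1 ≤ ε ^ (-((2 * p - 1) / (p - 1))) :=
    Real.one_le_rpow_of_pos_of_le_one_of_nonpos hε hε1.le
      (neg_nonpos.2 (div_nonneg (by linarith) hp'.le))
  exact one_le_mul_of_one_le_of_one_le (one_le_mul_of_one_le_of_one_le h1 h2) h3

theorem balanced_error_le_of_sampleSize_le {ε : ℝ} (hp1 : 1 < p) (hd : 1 ≤ d) (hL : 0 < L)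
    (hΔ : 0 ≤ Δ) (hδ : 0 < δ) (hε : 0 < ε) (hεL : ε < L) (hM : 0 < M)
    (hC : (64 : ℝ) ^ ((2 * p - 1) / (p - 1)) * sampleSize p L Δ δ ε d ≤ M) :
    max (12 * ((2 * Δ + 2 * δ * L) / (δ * M) * (L * ((d : ℝ) ^ (p / 2) + 1) ^ (1 / p) /
      ((2 * Δ + 2 * δ * L) / (δ * M))) ^ (p / (2 * p - 1))))
      (16 * (L * ((d : ℝ) ^ (p / 2) + 1) ^ (1 / p)) / (M : ℝ) ^ ((p - 1) / p)) +
        (2 * Δ + 2 * δ * L) / (δ * M) ≤ ε := by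
  have hM' : (0 : ℝ) < M := by exact_mod_cast hM
  have hd' : (1 : ℝ) ≤ d := by exact_mod_cast hd
  set N := (d : ℝ) ^ (1 / 2 : ℝ) * L with hN
  have hLN : L ≤ N := le_mul_of_one_le_left hL.le (Real.one_le_rpow hd' (by norm_num))
  have hN0 : 0 < N := hL.trans_le hLN
  rw [sampleSize_eq hp1 hL hε, ← hN] at hC
  set C : ℝ := (64 : ℝ) ^ ((2 * p - 1) / (p - 1))
  have hC0 : 0 < C := by positivity
  set R := (N / ε) ^ (p / (p - 1)) with hR
  have hR0 : 0 < R := by positivity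
  have hR' : (ε / N) ^ (p / (p - 1)) = R⁻¹ := by
    rw [hR, ← Real.inv_rpow (by positivity), inv_div]
  refine balanced_error_le hp1 (by positivity) (by positivity) hε (hεL.trans_le hLN)
    (mul_add_one_rpow_le hp1 hL hd) ?_ ?_
  · rw [hR', ← div_eq_mul_inv, le_div_iff₀ hR0, mul_div_assoc', div_mul_eq_mul_div,
      div_le_iff₀ (by positivity)]
    have : C * ((Δ + δ * L) / (δ * ε) * R) = C * (Δ + δ * L) * R / (δ * ε) := by ring
    rw [this, div_le_iff₀ (by positivity)] at hC
    linarith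
  · refine le_trans ?_ hC
    -- Here `ε < L` and `Δ ≥ 0` are used; the ratio may then be discarded.
    have h1 : 1 ≤ (Δ + δ * L) / (δ * ε) := by
      rw [le_div_iff₀ (by positivity)]
      nlinarith
    have := mul_le_mul_of_nonneg_left (le_mul_of_one_le_left hR0.le h1) hC0.le
    exact this

theorem oracleCalls_le {Ξ : Type*} {F : E d → Ξ → ℝ} {x₀ : E d} {ρ τ D : ℝ} {ξ : ℕ → Ξ}
    {s : ℕ → ℝ} {u : ℕ → Metric.sphere (0 : E d) 1} :
    oracleCalls F x₀ (M / T) T ρ τ D ξ s u ≤ 2 * M := by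
  rw [oracleCalls, iter_calls]
  exact Nat.mul_le_mul_left 2 (Nat.div_mul_le_self M T)

end Parameters

end ZOCOON

end

/-! ### Assembly: convergence rate and oracle complexity. -/

theorem theorem1 (p : ℝ) (hp1 : 1 < p) (hp2 : p ≤ 2) :
    ∃ C : ℝ, 0 < C ∧
      ∀ (d : ℕ) (_ : 1 ≤ d) (L Δ δ : ℝ) (_ : 0 < L) (_ : 0 < δ) (_ : δ < 1)
        -- the stochastic problem and its assumptions
        (Ξ : Type*) [MeasurableSpace Ξ] (P : Measure Ξ) [IsProbabilityMeasure P]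
        (F : E d → Ξ → ℝ) (_ : ∀ x, Measurable (F x)) (_ : ∀ x, Integrable (F x) P)
        (_ : LipschitzWithMoment P F p L)
        (_ : WellBehaved (objective P F))
        (_ : BddBelow (Set.range (objective P F)))
        (x₀ : E d) (_ : objective P F x₀ - ⨅ x, objective P F x ≤ Δ)
        -- the parameters
        (M T K : ℕ) (D τ δ' : ℝ) (_ : 2 ≤ M) (_ : T = roundLength p L Δ δ d M)
        (_ : K = ⌊(M : ℝ) / T⌋₊) (_ : D = δ / (2 * T)) (_ : τ = clipLevel p L d T)
        (_ : δ' = δ / 2)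
        -- the random samples and the output of the run
        (Ω : Type*) [MeasurableSpace Ω] (μ : Measure Ω) [IsProbabilityMeasure μ]
        (ξ : ℕ → Ω → Ξ) (s : ℕ → Ω → ℝ) (u : ℕ → Ω → Metric.sphere (0 : E d) 1) (κ : Ω → ℕ)
        (_ : IsSampling P K μ ξ s u κ)
        (wOut : Ω → E d)
        (_ : ∀ ω, wOut ω =
          roundAverage F x₀ T δ' τ D (fun n => ξ n ω) (fun n => s n ω) (fun n => u n ω) (κ ω))
        (calls : Ω → ℕ)
        (_ : ∀ ω, calls ω =
          oracleCalls F x₀ K T δ' τ D (fun n => ξ n ω) (fun n => s n ω) (fun n => u n ω)),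
        Integrable (fun ω => goldsteinNorm (objective P F) δ (wOut ω)) μ ∧
        ∫ ω, goldsteinNorm (objective P F) δ (wOut ω) ∂μ ≤
          max (18 * (Δ + δ * L) ^ ((p - 1) / (2 * p - 1)) *
                ((d : ℝ) ^ (p / 2) * L ^ p + L ^ p) ^ (1 / (2 * p - 1)) /
                (δ * M) ^ ((p - 1) / (2 * p - 1)))
              (16 * L * ((d : ℝ) ^ (p / 2) + 1) ^ (1 / p) / (M : ℝ) ^ ((p - 1) / p)) +
            (2 * Δ + 2 * δ * L) / (δ * M) ∧
        (∀ ω, calls ω ≤ 2 * M) ∧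
        ∀ ε : ℝ, 0 < ε → ε < 1 →
          (C * sampleSize p L Δ δ ε d ≤ M →
            ∫ ω, goldsteinNorm (objective P F) δ (wOut ω) ∂μ ≤ ε) ∧
          (M = max 2 ⌈C * sampleSize p L Δ δ ε d⌉₊ →
            ∀ ω, (calls ω : ℝ) ≤ 4 * (1 + C * (Δ + L) * L ^ (p / (p - 1))) *
              ((d : ℝ) ^ (p / (2 * (p - 1))) * δ⁻¹ * ε ^ (-((2 * p - 1) / (p - 1))))) := by
  refine ⟨(64 : ℝ) ^ ((2 * p - 1) / (p - 1)), by positivity, ?_⟩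
  intro d hd L Δ δ hL hδ hδ1 Ξ _ P _ F hFm hFi hF _ hbdd x₀ hΔ M T K D τ δ' hM hT hK hD hτ hδ'
    Ω _ μ _ ξ s u κ hS wOut hw calls hcalls
  have : NeZero d := ⟨by omega⟩
  obtain ⟨ℓ, hℓm, hℓ0, hℓ, hℓi, hℓL⟩ := hF
  have h : IsLipschitzOracle P F ℓ p L := ⟨hp1, hp2, hL, hFm, hFi, hℓm, hℓ0, hℓ, hℓi, hℓL⟩
  have hp : 0 < p := by linarith
  have hΔ0 : 0 ≤ Δ := (sub_nonneg.2 (ciInf_le hbdd x₀)).trans hΔ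
  have hH : 0 < 2 * Δ + 2 * δ * L := by positivity
  have hM0 : 0 < M := by omega
  have hM' : (0 : ℝ) < M := by exact_mod_cast hM0
  have hT0 : 0 < T := hT ▸ roundLength_pos hH hδ hL hM
  have hKd : K = M / T := by rw [hK, Nat.floor_div_eq_div]
  have hTM : T ≤ M := by
    rw [hT, roundLength_eq]
    omega
  have hK0 : 0 < K := hKd ▸ Nat.div_pos hTM hT0
  have hK' : (0 : ℝ) < K := by exact_mod_cast hK0
  obtain ⟨hi, hle⟩ := integral_goldsteinNorm_le h hS hT0 hK0 (hτ ▸ clipLevel_pos hL hT0)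
    (hτ ▸ clipLevel_rpow hp hL) hbdd hΔ hδ hδ' hD hw
  have hround := round_error_le (G := L * ((d : ℝ) ^ (p / 2) + 1) ^ (1 / p))
    (y := (2 * Δ + 2 * δ * L) / (δ * M)) hp1 hp2 (by positivity) (by positivity) hM
    (hT.trans (roundLength_eq))
  rw [← hKd, ← clipLevel_div hp hT0, ← hτ,
    show (2 * Δ + 2 * δ * L) / (δ * M) * (M / K) = (2 * Δ + 2 * δ * L) / (δ * K) by
      field_simp] at hround
  have hbound := hle.trans hround
  have hcalls2 : ∀ ω, calls ω ≤ 2 * M := fun ω => by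
    rw [hcalls, hKd]
    exact oracleCalls_le
  refine ⟨hi, hbound.trans ?_, hcalls2, fun ε hε hε1 => ⟨fun hC => ?_, fun hMε ω => ?_⟩⟩
  · rw [mul_assoc 16 L]
    exact add_le_add_left (max_le_max_right _ (twelve_mul_balanced_error_le hp1 hH hδ hL hM0)) _
  -- If `L ≤ ε` every point is already good enough, because the Goldstein norm never exceeds `L`;
  -- otherwise the balanced bound applies.
  · rcases le_or_gt L ε with hεL | hεL
    · exact (integral_goldsteinNorm_le_lipschitz h hδ hi).trans hεL
    · exact hbound.trans (balanced_error_le_of_sampleSize_le hp1 hd hL hΔ0 hδ hε hεL hM0 hC)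
  · have hR := one_le_rate hp1 hd hδ hδ1 hε hε1
    have hQ := sampleSize_le (p := p) (Δ := Δ) (d := d) hL hδ hδ1 hε
    set R := (d : ℝ) ^ (p / (2 * (p - 1))) * δ⁻¹ * ε ^ (-((2 * p - 1) / (p - 1)))
    set C : ℝ := (64 : ℝ) ^ ((2 * p - 1) / (p - 1))
    have hC0 : 0 < C := by positivity
    set Q := sampleSize p L Δ δ ε d with hQdef
    have hQ0 : 0 ≤ Q := by rw [hQdef, sampleSize]; positivity
    -- Both branches of the maximum are covered, and `2 M ≤ 4 + 2 C Q` is then compared with the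
    -- rate `R ≥ 1`.
    have hMQ : (M : ℝ) ≤ 2 + C * Q := by
      rw [hMε, Nat.cast_max]
      exact max_le (by push_cast; nlinarith)
        ((Nat.ceil_lt_add_one (by positivity)).le.trans (by linarith))
    have hc : (calls ω : ℝ) ≤ 2 * M := by exact_mod_cast hcalls2 ω
    have hCQ := mul_le_mul_of_nonneg_left hQ hC0.le
    have hnn : 0 ≤ C * ((Δ + L) * L ^ (p / (p - 1)) * R) := by positivity
    have : 4 * (1 + C * (Δ + L) * L ^ (p / (p - 1))) * R =
        4 * R + 4 * (C * ((Δ + L) * L ^ (p / (p - 1)) * R)) := by ring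
    linarith
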